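/- All logarithms are binary. For $n\ge 1$ let $\log^{(0)}n=n$, $\log^{(i+1)}n=\log(\log^{(i)}n)$ and $\log^*n=\min\{i:\log^{(i)}n\le 1\}$. Let $\Delta_{n,k}=\{x\in[0,1]^n:\|x\|_1\le k\}$. A distribution over deterministic maps $\mathcal A:\Delta_{n,k}\to 2^{[n]}$ is an *$\alpha$-stretch correlated sampling algorithm* for $\Delta_{n,k}$ if each $\mathcal A(x)$ is a random variable and (P1) almost surely, $|\mathcal A(x)|\in\{\lfloor\|x\|_1\rfloor,\lceil\|x\|_1\rceil\}$ for all $x\in\Delta_{n,k}$; (P2) $\Pr[i\in\mathcal A(x)]=x_i$ for all $x$ and $i$; (P3) $\mathbb E|\mathcal A(x)\oplus\mathcal A(y)|\le\alpha\|x-y\|_1$ for all $x,y\in\Delta_{n,k}$. The *stretch* of an algorithm is the least $\alpha\ge 0$ for which (P3) holds. *Simplex algorithm* $\mathcal A_1$ (dimension $n$): draw independent $E_i\sim\mathrm{Exp}(1)$; on input $x$ output $\{i\}$, where $i$ minimises $E_i/x_i$ among the coordinates with $x_i>0$ (ties are broken by the smaller index). *Tree rounding* (dimension $n$): take the balanced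 full binary tree with leaves $1,\dots,n$ in order (a node with $\ell\ge 2$ leaves has $\lceil \ell/2\rceil$ of them on the left). Draw independent thresholds uniform in $[0,1]$: a $\theta_z$ for every internal node $z$ and one more, $\theta$, for the root. Leaf $i$ passes $(i,x_i)$ to its parent. A node $z$ that receives $(i,a)$ from the left and $(j,b)$ from the right proceeds as follows. If $a+b\le1$: when $\theta_z\le\frac{a}{a+b}$, it fixes $j$ to $0$ and passes up $(i,a+b)$, otherwise it fixes $i$ to $0$ and passes up $(j,a+b)$. If $a+b>1$: when $\theta_z\le\frac{1-b}{2-a-b}$, it fixes $i$ to $1$ and passes up $(j,a+b-1)$, otherwise it fixes $j$ to $1$ and passes up $(i,a+b-1)$. (Here $0/0=0$.) The last unfixed coordinate, with marginal $\gamma$, is fixed to $1$ if $\theta\le\gamma$ and to $0$ otherwise. The output is the set of the coordinates fixed to $1$. *Composition.* Given a randomised algorithm $\mathcal A$ of stretch $\alpha$ on $\Delta_{n,k}$, let $m=\lceil 2^5k^5\alpha^5\rceil$. Draw independently: the seeds of $\mathcal A_1$ (dimension $n$), of $\mathcal A$, and of tree rounding $\mathcal A_k$ in dimension $m^3$; uniform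 hashes $R_b\in[m^3]$ $(b\in[m])$ and $C_i\in[m^3]$ $(i\in[n])$; a uniform bucket in $[m]$ for each $i\in[n]$, which gives buckets $\mathcal B_1,\dots,\mathcal B_m$; and $\sigma,\tau$ uniform in $[0,1/10]$. On input $x$ let $S=\{i:0<x_i\le\frac1{10}+\sigma\}$, $L=\{i:x_i>\frac1{10}+\sigma\}$ and $S_b=S\cap\mathcal B_b$. If for some $h\in[m^3]$ the number of $i\in L$ with $C_i=h$ plus the number of $b$ with $R_b=h$ exceeds $1$, or if $\sum_{i\in S_b}x_i>1-\tau$ for some $b$, return $\mathcal A(x)$. Otherwise, let $REP_b=\mathcal A_1\big(\tfrac{x_i}{\sum_{j\in S_b}x_j}\mathbf 1[i\in S_b]\big)_i$ if $\sum_{j\in S_b}x_j>0$, and $REP_b=\emptyset$ otherwise; replace the entries of $x$ in each $S_b$ by $\sum_{j\in S_b}x_j$ at the representative and $0$ elsewhere; let $\hat x\in\mathbb R^{m^3}$ have at position $R_b$ the entry of the representative of $b$, at position $C_i$ the entry of $i\in L$, and zeros elsewhere; let $T=\mathcal A_k(\hat x)$ and return $\{i\in L:C_i\in T\}\cup\bigcup_{b:R_b\in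 T}REP_b$. *Recursive construction.* For given $n,k$, let $\mathcal A'_0$ be tree rounding in dimension $n$, and let $\mathcal A'_i$ $(i\ge1)$ be the composition with fallback $\mathcal A=\mathcal A'_{i-1}$. **Theorem.** There is an absolute constant $c>0$ such that the following hold. 1. For every $n\ge1$ there is a level $i$, depending only on $n$, with $|i-\log^*n|\le c\log\log^*n$ (where $\log 0$ is read as $0$ if $n=1$) and $i\le c\log^*n$, such that for every $k\ge2$, $\mathcal A'_i$ is a $(c\log k)$-stretch correlated sampling algorithm for $\Delta_{n,k}$. 2. For all $n\ge1$, $k\ge2$ and all $i\ge 0$ with $i\le\log^*n-2$, $\mathcal A'_i$ is a $c\,(i\log k+\log^{(i)}n)$-stretch correlated sampling algorithm for $\Delta_{n,k}$. -/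

import Mathlib

open MeasureTheory

noncomputable section

namespace CorrSampling

/-! ### Points of the hypersimplex, and iterated logarithms -/

/-- The `ℓ₁` norm on `ℝⁿ`. -/
def l1 {n : ℕ} (x : Fin n → ℝ) : ℝ := ∑ i, |x i|

/-- `Δ_{n,k}`: vectors of `[0,1]ⁿ` of `ℓ₁` norm at most `k`. -/
def hypersimplex (n k : ℕ) : Set (Fin n → ℝ) :=
  {x | (∀ i, 0 ≤ x i ∧ x i ≤ 1) ∧ l1 x ≤ k}

/-- The `i`-th iterated binary logarithm `log^{(i)} t`. -/
def iterLog (i : ℕ) (t : ℝ) : ℝ := (Real.logb 2)^[i] t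

/-- The iterated logarithm `log* n = min {i | log^{(i)} n ≤ 1}`. -/
def logStar (n : ℕ) : ℕ := sInf {i : ℕ | iterLog i n ≤ 1}

/-! ### Randomised algorithms: distributions over deterministic ones -/

/-- A random map `X → Y`: a seed is drawn once from `law`, and then `run seed` is a deterministic
map, used for all inputs. -/
structure RandMap (X Y : Type) where
  /-- the space of seeds -/
  Ω : Type
  [ms : MeasurableSpace Ω]
  /-- the distribution of the seed -/
  law : Measure Ω
  /-- the deterministic algorithm determined by a seed -/
  run : Ω → X → Y

attribute [instance] RandMap.ms

/-- A randomised algorithm that maps vectors of `ℝⁿ` to subsets of `[n]`. -/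
abbrev RandAlg (n : ℕ) : Type 1 := RandMap (Fin n → ℝ) (Finset (Fin n))

/-- The stretch property on `Δ_{n,k}`: `E |A(x) ⊕ A(y)| ≤ α ‖x - y‖₁`. -/
def HasStretch {n : ℕ} (k : ℕ) (A : RandAlg n) (α : ℝ) : Prop :=
  ∀ x ∈ hypersimplex n k, ∀ y ∈ hypersimplex n k,
    ∫⁻ ω, ((symmDiff (A.run ω x) (A.run ω y)).card : ENNReal) ∂A.law
      ≤ ENNReal.ofReal (α * l1 (x - y))

/-- The stretch of an algorithm on `Δ_{n,k}`: the least `α ≥ 0` with the stretch property. -/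
def stretch {n : ℕ} (k : ℕ) (A : RandAlg n) : ℝ :=
  sInf {α : ℝ | 0 ≤ α ∧ HasStretch k A α}

/-- `A` is an `α`-stretch correlated sampling algorithm for `Δ_{n,k}`. -/
structure IsCorrelatedSampling {n : ℕ} (k : ℕ) (A : RandAlg n) (α : ℝ) : Prop where
  /-- the seed is drawn from a probability distribution -/
  prob : IsProbabilityMeasure A.law
  /-- every output `A(x)` is a random variable -/
  meas : ∀ x ∈ hypersimplex n k, ∀ s : Finset (Fin n), MeasurableSet {ω | A.run ω x = s}
  /-- almost every deterministic algorithm drawn satisfies the cardinality constraint on the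
  whole of `Δ_{n,k}` -/
  cardinality : ∀ᵐ ω ∂A.law, ∀ x ∈ hypersimplex n k,
    (A.run ω x).card = ⌊l1 x⌋₊ ∨ (A.run ω x).card = ⌈l1 x⌉₊
  /-- the marginals are preserved -/
  marginals : ∀ x ∈ hypersimplex n k, ∀ i, A.law {ω | i ∈ A.run ω x} = ENNReal.ofReal (x i)
  /-- the stretch is at most `α` -/
  stretch_le : HasStretch k A α

/-- The uniform distribution on the real interval `[a, b]`. -/
def unifIcc (a b : ℝ) : Measure ℝ := ProbabilityTheory.cond volume (Set.Icc a b)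

/-- The uniform distribution on `[m]`. -/
def unifFin (m : ℕ) : Measure (Fin m) := ProbabilityTheory.uniformOn Set.univ

/-! ### Exponential clocks: the algorithm for the probability simplex -/

/-- The set `{argmin_i R_i / x_i}`, over the coordinates with `x_i > 0`; ties (an event of
probability zero for each `x`) are broken in favour of the smaller index. -/
def clockRound {n : ℕ} (R : Fin n → ℝ) (x : Fin n → ℝ) : Finset (Fin n) :=
  open Classical in
  Finset.univ.filter fun i => 0 < x i ∧
    ∀ j, 0 < x j → R i / x i < R j / x j ∨ (R i / x i = R j / x j ∧ i ≤ j)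

/-- The exponential clocks algorithm, with independent `R_i ∼ Exp(1)`. -/
def clockAlg (n : ℕ) : RandAlg n where
  Ω := Fin n → ℝ
  law := Measure.pi fun _ => ProbabilityTheory.expMeasure 1
  run := clockRound

/-! ### Coordinate tree rounding: the basic algorithm for the hypersimplex -/

/-- Full binary trees with leaves labelled by `ι`. -/
inductive CoordTree (ι : Type) : Type
  | leaf (i : ι) : CoordTree ι
  | node (l r : CoordTree ι) : CoordTree ι

/-- The balanced full binary tree with leaves `f lo, f (lo + 1), …, f (lo + len - 1)`, for
`len ≥ 1`. -/
def balancedTree {ι : Type} (f : ℕ → ι) (lo : ℕ) : ℕ → CoordTree ι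
  | 0 => .leaf (f lo)
  | 1 => .leaf (f lo)
  | len + 2 => .node (balancedTree f lo ((len + 3) / 2))
      (balancedTree f (lo + (len + 3) / 2) ((len + 2) / 2))
termination_by len => len
decreasing_by all_goals omega

/-- What a tree node passes to its parent: the coordinate that is not yet fixed, its updated
marginal, and the set of the coordinates below the node whose marginal has been fixed to `1`
(all other coordinates below it have been fixed to `0`). -/
abbrev NodeState (ι : Type) : Type := ι × ℝ × Finset ι

/-- The rounding step at an internal node, with threshold `θ`, for coordinates `i`, `j` with
marginals `a`, `b`: the unfixed coordinate, its updated marginal, and the set of coordinates that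
this step fixes to `1`. -/
def resolve {ι : Type} (θ : ℝ) (i : ι) (a : ℝ) (j : ι) (b : ℝ) : NodeState ι :=
  open Classical in
  if a + b ≤ 1 then
    if θ ≤ a / (a + b) then (i, a + b, ∅) else (j, a + b, ∅)
  else
    if θ ≤ (1 - b) / (2 - a - b) then (j, a + b - 1, {i}) else (i, a + b - 1, {j})

/-- Bottom-up processing of a coordinate tree; every internal node has its own independent
threshold, uniform in `[0,1]`. -/
def treeRound {ι : Type} [DecidableEq ι] : CoordTree ι → RandMap (ι → ℝ) (NodeState ι)
  | .leaf i =>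
    { Ω := Unit
      law := Measure.dirac ()
      run := fun _ x => (i, x i, ∅) }
  | .node l r =>
    { Ω := ℝ × (treeRound l).Ω × (treeRound r).Ω
      law := (unifIcc 0 1).prod ((treeRound l).law.prod (treeRound r).law)
      run := fun ω x =>
        let u := (treeRound l).run ω.2.1 x
        let v := (treeRound r).run ω.2.2 x
        let w := resolve ω.1 u.1 u.2.1 v.1 v.2.1
        (w.1, w.2.1, w.2.2 ∪ (u.2.2 ∪ v.2.2)) }

/-- Coordinate tree rounding on the balanced tree with `n` leaves; the last unfixed coordinate is
rounded up when its marginal is at least an additional threshold, drawn for the root. -/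
def treeAlg : (n : ℕ) → RandAlg n
  | 0 =>
    { Ω := Unit
      law := Measure.dirac ()
      run := fun _ _ => ∅ }
  | d + 1 =>
    let T := treeRound (balancedTree (Fin.ofNat (d + 1)) 0 (d + 1))
    { Ω := ℝ × T.Ω
      law := (unifIcc 0 1).prod T.law
      run := fun ω x =>
        let u := T.run ω.2 x
        if ω.1 ≤ u.2.1 then insert u.1 u.2.2 else u.2.2 }

/-! ### The composed algorithm -/

/-- The randomness of the hashing step: the target hashes `R_b` of the buckets, the target hashes
`C_i` of the coordinates, the bucket of every coordinate, and the thresholds `σ` and `τ`. -/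
abbrev HashSeed (n m : ℕ) : Type :=
  (Fin m → Fin (m ^ 3)) × (Fin n → Fin (m ^ 3)) × (Fin n → Fin m) × ℝ × ℝ

/-- All these values are independent; the hashes and buckets are uniform, and `σ` and `τ` are
uniform in `[0, 1/10]`. -/
def hashLaw (n m : ℕ) : Measure (HashSeed n m) :=
  (Measure.pi fun _ => unifFin (m ^ 3)).prod <|
  (Measure.pi fun _ => unifFin (m ^ 3)).prod <|
  (Measure.pi fun _ => unifFin m).prod <|
  (unifIcc 0 (1 / 10)).prod (unifIcc 0 (1 / 10))

/-- The small coordinates, `0 < x_i ≤ 1/10 + σ`. -/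
def smallSet {n : ℕ} (σ : ℝ) (x : Fin n → ℝ) : Finset (Fin n) :=
  open Classical in Finset.univ.filter fun i => 0 < x i ∧ x i ≤ 1 / 10 + σ

/-- The large coordinates, `x_i > 1/10 + σ`. -/
def largeSet {n : ℕ} (σ : ℝ) (x : Fin n → ℝ) : Finset (Fin n) :=
  open Classical in Finset.univ.filter fun i => 1 / 10 + σ < x i

/-- `S_b`: the small coordinates in bucket `b`. -/
def smallIn {n m : ℕ} (B : Fin n → Fin m) (σ : ℝ) (x : Fin n → ℝ) (b : Fin m) :
    Finset (Fin n) :=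
  (smallSet σ x).filter fun i => B i = b

/-- `REP_b`: the output of the simplex algorithm `A₁` on the normalised restriction of `x` to
`S_b` (and no representative when `S_b` has no mass). -/
def rep {n m : ℕ} (A₁ : (Fin n → ℝ) → Finset (Fin n)) (B : Fin n → Fin m) (σ : ℝ)
    (x : Fin n → ℝ) (b : Fin m) : Finset (Fin n) :=
  open Classical in
  if 0 < ∑ i ∈ smallIn B σ x b, x i then
    A₁ fun i => if i ∈ smallIn B σ x b then x i / ∑ j ∈ smallIn B σ x b, x j else 0
  else ∅

/-- The vector `x` after the representative of every bucket has absorbed the mass of all the small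
coordinates of its bucket, whose entries are reset to zero. -/
def compressed {n m : ℕ} (A₁ : (Fin n → ℝ) → Finset (Fin n)) (B : Fin n → Fin m) (σ : ℝ)
    (x : Fin n → ℝ) : Fin n → ℝ := fun i =>
  open Classical in
  if i ∈ smallSet σ x then
    if i ∈ rep A₁ B σ x (B i) then ∑ j ∈ smallIn B σ x (B i), x j else 0
  else x i

/-- The vector `x̂` of dimension `m³`: a representative of bucket `b` is sent to `R_b`, every other
remaining non-zero coordinate `i` to `C_i`. It is used only when there is no hash collision, that
is, when at most one entry is sent to each position. -/
def hatVec {n m : ℕ} (A₁ : (Fin n → ℝ) → Finset (Fin n)) (ρ : HashSeed n m)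
    (x : Fin n → ℝ) : Fin (m ^ 3) → ℝ :=
  match ρ with
  | (R, C, B, σ, _) => fun h =>
    open Classical in
    ∑ i ∈ Finset.univ.filter (fun i => 0 < compressed A₁ B σ x i ∧
        (if i ∈ rep A₁ B σ x (B i) then R (B i) else C i) = h),
      compressed A₁ B σ x i

/-- There is a hash collision among the large coordinates and the buckets. -/
def Collision {n m : ℕ} (ρ : HashSeed n m) (x : Fin n → ℝ) : Prop :=
  match ρ with
  | (R, C, _, σ, _) => ∃ h : Fin (m ^ 3),
    1 < ((largeSet σ x).filter fun i => C i = h).card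
      + (Finset.univ.filter fun b : Fin m => R b = h).card

/-- The small coordinates of some bucket weigh more than `1 - τ`. -/
def Heavy {n m : ℕ} (ρ : HashSeed n m) (x : Fin n → ℝ) : Prop :=
  match ρ with
  | (_, _, B, σ, τ) => ∃ b : Fin m, 1 - τ < ∑ i ∈ smallIn B σ x b, x i

/-- The composed algorithm with fixed seeds, for deterministic algorithms `A₁` (simplex), `A`
(fallback, dimension `n`) and `Aₖ` (dimension `m³`). -/
def composedRun {n m : ℕ} (A₁ A : (Fin n → ℝ) → Finset (Fin n))
    (Aₖ : (Fin (m ^ 3) → ℝ) → Finset (Fin (m ^ 3))) (ρ : HashSeed n m)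
    (x : Fin n → ℝ) : Finset (Fin n) :=
  open Classical in
  if Collision ρ x ∨ Heavy ρ x then A x
  else
    match ρ with
    | (R, C, B, σ, _) =>
      let T := Aₖ (hatVec A₁ ρ x)
      (largeSet σ x).filter (fun i => C i ∈ T) ∪
        (Finset.univ.filter fun b => R b ∈ T).biUnion (rep A₁ B σ x)

/-- The number of buckets `2⁵ k⁵ α⁵` (rounded up), for a fallback algorithm of stretch `α`. -/
def numBuckets (k : ℕ) (α : ℝ) : ℕ := ⌈(2 : ℝ) ^ 5 * (k : ℝ) ^ 5 * α ^ 5⌉₊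

/-- The composed algorithm for `Δ_{n,k}` with fallback algorithm `A`; the seeds of the exponential
clocks, of `A`, of the tree rounding in dimension `m³` and of the hashing are independent. -/
def composedAlg {n : ℕ} (k : ℕ) (A : RandAlg n) : RandAlg n :=
  let m := numBuckets k (stretch k A)
  { Ω := (clockAlg n).Ω × A.Ω × (treeAlg (m ^ 3)).Ω × HashSeed n m
    law := (clockAlg n).law.prod (A.law.prod ((treeAlg (m ^ 3)).law.prod (hashLaw n m)))
    run := fun ω => composedRun ((clockAlg n).run ω.1) (A.run ω.2.1)
      ((treeAlg (m ^ 3)).run ω.2.2.1) ω.2.2.2 }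

/-- The recursive construction `A'_i` for `Δ_{n,k}`. -/
def recAlg (n k : ℕ) : ℕ → RandAlg n
  | 0 => treeAlg n
  | i + 1 => composedAlg k (recAlg n k i)

end CorrSampling

end

/-! The proof is a recursion for the stretch. Tree rounding has stretch O(log N) in dimension N
(`treeAlg_stretch`). Composition turns a fallback of stretch α into an algorithm of stretch O(log k
+ log α) (`isCorrelatedSampling_composedAlg`), because tree rounding is then applied only in
dimension m³, a polynomial in k and α. Hence level i has stretch O(log k + log^{(i+1)} n) with a
constant that does not grow with i (`isCorrelatedSampling_recAlg`). Both claims follow, the first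
with i = log* n.

Tree rounding. The marginal that a node passes up is the mass of its subtree modulo 1 (`NodeInv`).
So on two inputs it differs, modulo 1, by at most the ℓ₁ change of the input below that node. A step
preserves every marginal in expectation, and the distance of two states is affine in a common
marginal. Therefore a step adds to the expected distance only a constant times the change of the
masses (`lintegral_step_dist_le`). These errors sum to one constant per level, and the growth is
linear in the depth. A marginal that wraps around from 1 to 0 is harmless, because the sibling is
unaffected at both ends.

Composition. It suffices to raise one coordinate p by δ (`hasStretch_of_single`), with the hash seed
fixed at first. If both runs succeed and p stays small or stays large, then x̂ moves by at most δ,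
which costs Sδ, S being the stretch of tree rounding in dimension m³. The representative of the
bucket of p changes with probability at most δ/(M+δ), where M is the old mass of the bucket
(`clockLaw_change`). This matters only if the bucket is selected, which has probability M+δ, so the
product is at most δ (`lintegral_goodRun_le_of_noncrossing`). If p crosses from small to large, the
cost is O(S), but σ then lies in a window of probability at most 10δ. If some run fails, then an
event `Bad` occurs for x or y that involves neither σ nor τ and has probability O(k²/m)
(`hashFunsLaw_bad_le`). Two failing runs cost αδ. A single failing run costs at most 2k and forces σ
or τ into a window of probability at most 10δ. The choice of m makes the total contribution of
failures at most 3δ. -/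

noncomputable section
namespace CorrSampling

/-! ### Uniform thresholds -/

lemma unifIcc_eq {a b : ℝ} :
    unifIcc a b = (ENNReal.ofReal (b - a))⁻¹ • volume.restrict (Set.Icc a b) := by
  simp [unifIcc, ProbabilityTheory.cond]

lemma isProbabilityMeasure_unifIcc {a b : ℝ} (h : a < b) : IsProbabilityMeasure (unifIcc a b) := by
  refine ProbabilityTheory.cond_isProbabilityMeasure_of_finite ?_ ?_ <;> simp [h]

instance : IsProbabilityMeasure (unifIcc 0 1) := isProbabilityMeasure_unifIcc one_pos

instance : IsProbabilityMeasure (unifIcc 0 (1 / 10)) :=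
  isProbabilityMeasure_unifIcc (by norm_num)

lemma ae_unifIcc {a b : ℝ} : ∀ᵐ θ ∂unifIcc a b, a < θ ∧ θ ≤ b := by
  rw [unifIcc_eq]
  refine Measure.ae_smul_measure ?_ _
  have h0 : ∀ᵐ θ ∂(volume.restrict (Set.Icc a b)), θ ≠ a := by
    exact ae_restrict_of_ae (by simp [ae_iff])
  filter_upwards [h0, ae_restrict_mem measurableSet_Icc] with θ h1 h2
  exact ⟨lt_of_le_of_ne h2.1 (Ne.symm h1), h2.2⟩

lemma unifIcc_Ioc_le {a b : ℝ} (hab : a < b) (c d : ℝ) :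
    unifIcc a b (Set.Ioc c d) ≤ ENNReal.ofReal ((d - c) / (b - a)) := by
  rw [unifIcc_eq, Measure.smul_apply, smul_eq_mul, ENNReal.ofReal_div_of_pos (by linarith),
    div_eq_mul_inv, mul_comm]
  gcongr
  exact (Measure.restrict_apply_le _ _).trans (by simp)

lemma unifIcc_Iic {p : ℝ} (h1 : p ≤ 1) :
    unifIcc 0 1 (Set.Iic p) = ENNReal.ofReal p := by
  rw [unifIcc_eq, Measure.smul_apply, Measure.restrict_apply measurableSet_Iic]
  have : Set.Iic p ∩ Set.Icc (0 : ℝ) 1 = Set.Icc 0 p := by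
    ext t; simp only [Set.mem_inter_iff, Set.mem_Iic, Set.mem_Icc]; grind
  simp [this]

lemma lintegral_threshold {p : ℝ} (h0 : 0 ≤ p) (h1 : p ≤ 1) (A B : ENNReal) :
    ∫⁻ θ, (if θ ≤ p then A else B) ∂unifIcc 0 1
      = ENNReal.ofReal p * A + ENNReal.ofReal (1 - p) * B := by
  have hf : (fun θ : ℝ => if θ ≤ p then A else B) = fun θ =>
      (Set.Iic p).indicator (fun _ => A) θ + (Set.Iic p)ᶜ.indicator (fun _ => B) θ := by
    ext θ; by_cases h : θ ≤ p <;> simp [h, -Set.compl_Iic]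
  rw [hf, lintegral_add_left (measurable_const.indicator measurableSet_Iic),
    lintegral_indicator_const measurableSet_Iic,
    lintegral_indicator_const measurableSet_Iic.compl,
    prob_compl_eq_one_sub measurableSet_Iic, unifIcc_Iic h1, mul_comm A, mul_comm B,
    ENNReal.ofReal_sub _ h0, ENNReal.ofReal_one]

/-- The cost d is charged for all θ, and M on top of it only on the window between the two
thresholds, whose probability is at most p' - p. -/
lemma lintegral_le_of_threshold {p p' d M : ℝ} (hp : p ≤ p') (hd : 0 ≤ d) (hM : 0 ≤ M)
    {f : ℝ → ENNReal} (h1 : ∀ θ, θ ≤ p ∨ p' < θ → f θ ≤ ENNReal.ofReal d)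
    (h2 : ∀ θ, p < θ → θ ≤ p' → f θ ≤ ENNReal.ofReal M) :
    ∫⁻ θ, f θ ∂unifIcc 0 1 ≤ ENNReal.ofReal (d + (p' - p) * M) := by
  calc ∫⁻ θ, f θ ∂unifIcc 0 1
      ≤ ∫⁻ θ, (ENNReal.ofReal d
          + (Set.Ioc p p').indicator (fun _ => ENNReal.ofReal M) θ) ∂unifIcc 0 1 := by
        refine lintegral_mono fun θ => ?_
        by_cases h : θ ∈ Set.Ioc p p'
        · simp only [h, Set.indicator_of_mem]
          exact (h2 θ h.1 h.2).trans le_add_self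
        · simp only [h, not_false_eq_true, Set.indicator_of_notMem, add_zero]
          refine h1 θ ?_
          by_contra! hc
          exact h ⟨hc.1, hc.2⟩
    _ = ENNReal.ofReal d + ENNReal.ofReal M * unifIcc 0 1 (Set.Ioc p p') := by
        rw [lintegral_add_left measurable_const, lintegral_indicator_const measurableSet_Ioc]
        simp
    _ ≤ ENNReal.ofReal d + ENNReal.ofReal M * ENNReal.ofReal (p' - p) := by
        gcongr
        simpa using unifIcc_Ioc_le one_pos p p'
    _ = ENNReal.ofReal (d + (p' - p) * M) := by
        rw [← ENNReal.ofReal_mul hM, ← ENNReal.ofReal_add hd (mul_nonneg hM (by linarith)),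
          mul_comm M]

/-! ### The step at an internal node -/

/-- The threshold that a node compares `θ` with. -/
def thr (a b : ℝ) : ℝ := if a + b ≤ 1 then a / (a + b) else (1 - b) / (2 - a - b)

/-- The marginal of the left coordinate after the rounding step. -/
def stepL (θ a b : ℝ) : ℝ :=
  if θ ≤ thr a b then (if a + b ≤ 1 then a + b else 1) else (if a + b ≤ 1 then 0 else a + b - 1)

/-- The marginal of the right coordinate after the rounding step. -/
def stepR (θ a b : ℝ) : ℝ :=
  if θ ≤ thr a b then (if a + b ≤ 1 then 0 else a + b - 1) else (if a + b ≤ 1 then a + b else 1)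

/-- `h` is affine and nonnegative on `[0,1]`. -/
def AffineOnUnit (h : ℝ → ℝ) : Prop :=
  (∃ α β : ℝ, ∀ s ∈ Set.Icc (0 : ℝ) 1, h s = α + β * s) ∧ ∀ s ∈ Set.Icc (0 : ℝ) 1, 0 ≤ h s

/-- A mean-preserving step integrates affine functions exactly, and nonnegativity makes
`ENNReal.ofReal` additive on them. Distances of node states are sums of such functions, hence this
closure property. -/
lemma AffineOnUnit.sum {κ : Type*} (s : Finset κ) {h : κ → ℝ → ℝ}
    (hh : ∀ c ∈ s, AffineOnUnit (h c)) : AffineOnUnit fun t => ∑ c ∈ s, h c t := by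
  classical
  refine ⟨?_, fun t ht => Finset.sum_nonneg fun c hc => (hh c hc).2 t ht⟩
  induction s using Finset.induction_on with
  | empty => exact ⟨0, 0, by simp⟩
  | insert c s hc ih =>
    obtain ⟨α, β, h1⟩ := ih fun c' h' => hh c' (Finset.mem_insert_of_mem h')
    obtain ⟨α', β', h2⟩ := (hh c (Finset.mem_insert_self _ _)).1
    refine ⟨α' + α, β' + β, fun t ht => ?_⟩
    have := h1 t ht
    simp only at this ⊢
    rw [Finset.sum_insert hc, this, h2 t ht]
    ring

/-- The marginals of two coordinates are rounded: `f θ a b` is the new marginal of a coordinate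
with marginal `a`, and `g θ a b` that of its sibling with marginal `b`. -/
structure FairStep (f g : ℝ → ℝ → ℝ → ℝ) : Prop where
  mean : ∀ a ∈ Set.Icc (0 : ℝ) 1, ∀ b ∈ Set.Icc (0 : ℝ) 1, ∀ h, AffineOnUnit h →
    ∫⁻ θ, ENNReal.ofReal (h (f θ a b)) ∂unifIcc 0 1 = ENNReal.ofReal (h a)
  lip : ∀ a ∈ Set.Icc (0 : ℝ) 1, ∀ a' ∈ Set.Icc (0 : ℝ) 1, ∀ b ∈ Set.Icc (0 : ℝ) 1, a ≤ a' →
    ∫⁻ θ, ENNReal.ofReal (|f θ a b - f θ a' b| + |g θ a b - g θ a' b|) ∂unifIcc 0 1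
      ≤ ENNReal.ofReal (3 * (a' - a))
  -- Both endpoints leave the sibling as it was. The sibling therefore cannot tell marginal 1 from
  -- marginal 0, which is what makes wrap-around modulo 1 harmless.
  zero : ∀ θ, 0 < θ → θ ≤ 1 → ∀ b ∈ Set.Icc (0 : ℝ) 1, f θ 0 b = 0 ∧ g θ 0 b = b
  one : ∀ θ, 0 < θ → θ ≤ 1 → ∀ b ∈ Set.Icc (0 : ℝ) 1, f θ 1 b = 1 ∧ g θ 1 b = b
  meas_left : ∀ a b, Measurable fun θ => f θ a b
  meas_right : ∀ a b, Measurable fun θ => g θ a b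

lemma thr_mem {a b : ℝ} (ha : a ∈ Set.Icc (0 : ℝ) 1) (hb : b ∈ Set.Icc (0 : ℝ) 1) :
    thr a b ∈ Set.Icc (0 : ℝ) 1 := by
  obtain ⟨ha0, ha1⟩ := ha
  obtain ⟨hb0, hb1⟩ := hb
  unfold thr
  split_ifs with h
  · exact ⟨by positivity, div_le_one_of_le₀ (by linarith) (by linarith)⟩
  · exact ⟨div_nonneg (by linarith) (by linarith), div_le_one_of_le₀ (by linarith) (by linarith)⟩

/-- The product form of the threshold remains true at the degenerate node a = b = 0, where 0/0 = 0.
-/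
lemma thr_mul_of_le {a b : ℝ} (ha : 0 ≤ a) (hb : 0 ≤ b) (h : a + b ≤ 1) :
    thr a b * (a + b) = a := by
  rw [thr, if_pos h]
  rcases (add_nonneg ha hb).eq_or_lt' with h0 | h0
  · rw [h0]; linarith
  · field_simp

lemma thr_mul_of_gt {a b : ℝ} (ha : a ≤ 1) (hb : b ≤ 1) (h : ¬ a + b ≤ 1) :
    thr a b * (2 - a - b) = 1 - b := by
  rw [thr, if_neg h]
  rcases (show 0 ≤ 2 - a - b by linarith).eq_or_lt' with h0 | h0
  · rw [h0]; linarith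
  · field_simp

lemma measurable_stepL (a b : ℝ) : Measurable fun θ => stepL θ a b :=
  Measurable.ite measurableSet_Iic measurable_const measurable_const

lemma measurable_stepR (a b : ℝ) : Measurable fun θ => stepR θ a b :=
  Measurable.ite measurableSet_Iic measurable_const measurable_const

lemma lintegral_affine_threshold {p u v a : ℝ} (hp : p ∈ Set.Icc (0 : ℝ) 1)
    (hu : u ∈ Set.Icc (0 : ℝ) 1) (hv : v ∈ Set.Icc (0 : ℝ) 1) (ha : a ∈ Set.Icc (0 : ℝ) 1)
    (hm : p * u + (1 - p) * v = a) {h : ℝ → ℝ} (hh : AffineOnUnit h) :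
    ∫⁻ θ, ENNReal.ofReal (h (if θ ≤ p then u else v)) ∂unifIcc 0 1 = ENNReal.ofReal (h a) := by
  have : (fun θ : ℝ => ENNReal.ofReal (h (if θ ≤ p then u else v))) =
      fun θ => if θ ≤ p then ENNReal.ofReal (h u) else ENNReal.ofReal (h v) := by
    ext θ; split_ifs <;> rfl
  obtain ⟨⟨α, β, h1⟩, h2⟩ := hh
  have hp' : 0 ≤ 1 - p := by linarith [hp.2]
  rw [this, lintegral_threshold hp.1 hp.2, ← ENNReal.ofReal_mul hp.1, ← ENNReal.ofReal_mul hp',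
    ← ENNReal.ofReal_add (mul_nonneg hp.1 (h2 u hu)) (mul_nonneg hp' (h2 v hv)),
    h1 u hu, h1 v hv, h1 a ha, ← hm]
  congr 1
  ring

lemma lintegral_stepL {a b : ℝ} (ha : a ∈ Set.Icc (0 : ℝ) 1) (hb : b ∈ Set.Icc (0 : ℝ) 1)
    {h : ℝ → ℝ} (hh : AffineOnUnit h) :
    ∫⁻ θ, ENNReal.ofReal (h (stepL θ a b)) ∂unifIcc 0 1 = ENNReal.ofReal (h a) := by
  unfold stepL
  by_cases hab : a + b ≤ 1
  · simp only [hab, if_true]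
    refine lintegral_affine_threshold (thr_mem ha hb) ⟨by linarith [ha.1, hb.1], hab⟩
      (by simp) ha ?_ hh
    rw [thr_mul_of_le ha.1 hb.1 hab]; ring
  · simp only [hab, if_false]
    refine lintegral_affine_threshold (thr_mem ha hb) (by simp)
      ⟨by linarith, by linarith [ha.2, hb.2]⟩ ha ?_ hh
    linarith [thr_mul_of_gt ha.2 hb.2 hab]

lemma lintegral_stepR {a b : ℝ} (ha : a ∈ Set.Icc (0 : ℝ) 1) (hb : b ∈ Set.Icc (0 : ℝ) 1)
    {h : ℝ → ℝ} (hh : AffineOnUnit h) :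
    ∫⁻ θ, ENNReal.ofReal (h (stepR θ a b)) ∂unifIcc 0 1 = ENNReal.ofReal (h b) := by
  unfold stepR
  by_cases hab : a + b ≤ 1
  · simp only [hab, if_true]
    refine lintegral_affine_threshold (thr_mem ha hb) (by simp)
      ⟨by linarith [ha.1, hb.1], hab⟩ hb ?_ hh
    linarith [thr_mul_of_le ha.1 hb.1 hab]
  · simp only [hab, if_false]
    refine lintegral_affine_threshold (thr_mem ha hb) ⟨by linarith, by linarith [ha.2, hb.2]⟩
      (by simp) hb ?_ hh
    linarith [thr_mul_of_gt ha.2 hb.2 hab]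

/-- The two formulas for the threshold agree on the line a + b = 1, so the upper regime may include
its boundary. This allows the two regimes to be glued there. -/
lemma thr_mul_of_ge {a b : ℝ} (ha : a ≤ 1) (hb : b ≤ 1) (h : 1 ≤ a + b) :
    thr a b * (2 - a - b) = 1 - b := by
  by_cases h' : a + b ≤ 1
  · have : a + b = 1 := le_antisymm h' h
    rw [thr, if_pos h', this, show 2 - a - b = 1 by linarith]
    linarith
  · exact thr_mul_of_gt ha hb h'

lemma stepL_of_ge {θ a b : ℝ} (h : 1 ≤ a + b) :
    stepL θ a b = if θ ≤ thr a b then 1 else a + b - 1 := by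
  unfold stepL; split_ifs <;> linarith

lemma stepR_of_ge {θ a b : ℝ} (h : 1 ≤ a + b) :
    stepR θ a b = if θ ≤ thr a b then a + b - 1 else 1 := by
  unfold stepR; split_ifs <;> linarith

/-- Off the window the same coordinate wins on both inputs and the outcomes differ by e. On the
window the roles are swapped at cost s, and the window times s is at most 2e. Together this gives
3e. -/
lemma lintegral_le_of_mixing {p p' e s : ℝ} {f f' g g' : ℝ → ℝ} (he : 0 ≤ e) (hs : 0 ≤ s)
    (hp : p ≤ p') (hps : (p' - p) * s ≤ 2 * e)
    (h1 : ∀ θ, θ ≤ p ∨ p' < θ → |f θ - f' θ| + |g θ - g' θ| ≤ e)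
    (h2 : ∀ θ, p < θ → θ ≤ p' → |f θ - f' θ| + |g θ - g' θ| ≤ s) :
    ∫⁻ θ, ENNReal.ofReal (|f θ - f' θ| + |g θ - g' θ|) ∂unifIcc 0 1
      ≤ ENNReal.ofReal (3 * e) :=
  (lintegral_le_of_threshold hp he hs (fun θ h => ENNReal.ofReal_le_ofReal (h1 θ h))
    (fun θ h h' => ENNReal.ofReal_le_ofReal (h2 θ h h'))).trans
    (ENNReal.ofReal_le_ofReal (by linarith))

lemma lintegral_abs_triangle {f₁ f₂ f₃ g₁ g₂ g₃ : ℝ → ℝ} {u v : ℝ} (hu : 0 ≤ u) (hv : 0 ≤ v)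
    (m1 : Measurable f₁) (m2 : Measurable f₂) (m3 : Measurable g₁) (m4 : Measurable g₂)
    (h1 : ∫⁻ θ, ENNReal.ofReal (|f₁ θ - f₂ θ| + |g₁ θ - g₂ θ|) ∂unifIcc 0 1 ≤ ENNReal.ofReal u)
    (h2 : ∫⁻ θ, ENNReal.ofReal (|f₂ θ - f₃ θ| + |g₂ θ - g₃ θ|) ∂unifIcc 0 1
      ≤ ENNReal.ofReal v) :
    ∫⁻ θ, ENNReal.ofReal (|f₁ θ - f₃ θ| + |g₁ θ - g₃ θ|) ∂unifIcc 0 1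
      ≤ ENNReal.ofReal (u + v) := by
  rw [ENNReal.ofReal_add hu hv]
  refine le_trans ?_ (add_le_add h1 h2)
  rw [← lintegral_add_left (by fun_prop)]
  refine lintegral_mono fun θ => ?_
  rw [← ENNReal.ofReal_add (by positivity) (by positivity)]
  refine ENNReal.ofReal_le_ofReal ?_
  linarith [abs_sub_le (f₁ θ) (f₂ θ) (f₃ θ), abs_sub_le (g₁ θ) (g₂ θ) (g₃ θ)]

lemma stepL_lip {a a' b : ℝ} (ha : a ∈ Set.Icc (0 : ℝ) 1) (ha' : a' ∈ Set.Icc (0 : ℝ) 1)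
    (hb : b ∈ Set.Icc (0 : ℝ) 1) (h : a ≤ a') (hab : a' + b ≤ 1 ∨ 1 ≤ a + b) :
    ∫⁻ θ, ENNReal.ofReal (|stepL θ a b - stepL θ a' b| + |stepR θ a b - stepR θ a' b|)
      ∂unifIcc 0 1 ≤ ENNReal.ofReal (3 * (a' - a)) := by
  have hp := thr_mem ha hb
  have hp' := thr_mem ha' hb
  obtain ⟨a0, a1⟩ := ha
  obtain ⟨a0', a1'⟩ := ha'
  obtain ⟨b0, b1⟩ := hb
  obtain ⟨p0, p1⟩ := hp
  obtain ⟨p0', p1'⟩ := hp'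
  rcases hab with hab | hab
  · have hab1 : a + b ≤ 1 := by linarith
    have e1 := thr_mul_of_le a0 b0 hab1
    have e2 := thr_mul_of_le a0' b0 hab
    have hle : thr a b ≤ thr a' b := by
      rcases (add_nonneg a0 b0).eq_or_lt' with h0 | h0
      · rw [thr, if_pos hab1, h0]; simpa using p0'
      · refine le_of_mul_le_mul_right ?_ h0
        nlinarith
    refine lintegral_le_of_mixing (p := thr a b) (p' := thr a' b) (s := (a + b) + (a' + b))
      (by linarith) (by linarith) hle ?_ ?_ ?_
    -- With p, p' the two thresholds, (p' - p)(a + b) = (1 - p')(a' - a) and (p' - p)(a' + b) = (1 -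
    -- p)(a' - a); each is at most a' - a.
    · nlinarith
    · intro θ hθ
      have hθ' : (θ ≤ thr a b ∧ θ ≤ thr a' b) ∨ (¬ θ ≤ thr a b ∧ ¬ θ ≤ thr a' b) := by
        rcases hθ with hθ | hθ
        · exact Or.inl ⟨hθ, hθ.trans hle⟩
        · exact Or.inr ⟨by linarith, by linarith⟩
      rcases hθ' with ⟨h1, h2⟩ | ⟨h1, h2⟩ <;> simp only [stepL, stepR, h1, h2, hab, hab1, if_true, if_false]
        <;> simp <;> rw [abs_sub_comm, abs_of_nonneg] <;> linarith
    · intro θ h1 h2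
      simp only [stepL, stepR, h1.not_ge, h2, hab, hab1, if_true, if_false]
      rw [abs_of_nonpos (by linarith), abs_of_nonneg (by linarith)]
      linarith
  · have hab1 : 1 ≤ a' + b := by linarith
    have e1 := thr_mul_of_ge a1 b1 hab
    have e2 := thr_mul_of_ge a1' b1 hab1
    have hle : thr a b ≤ thr a' b := by
      -- The degenerate case is a' = b = 1, where the product form says nothing about `thr a' b`.
      -- Then b = 1 forces `thr a b` to be 0, so monotonicity is trivial.
      rcases (show 0 ≤ 2 - a' - b by linarith).eq_or_lt' with h0 | h0
      · have hb : b = 1 := by linarith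
        have : ¬ a + b ≤ 1 ∨ a = 0 := by
          by_cases h : a = 0
          · exact Or.inr h
          · exact Or.inl (by have := lt_of_le_of_ne a0 (Ne.symm h); linarith)
        rcases this with h | h
        · rw [thr, if_neg h, hb]; simpa [hb] using p0'
        · rw [thr, h]; simpa [hb] using p0'
      · refine le_of_mul_le_mul_right ?_ h0
        nlinarith
    refine lintegral_le_of_mixing (p := thr a b) (p' := thr a' b)
      (s := (2 - a - b) + (2 - a' - b)) (by linarith) (by linarith) hle ?_ ?_ ?_
    · nlinarith
    · intro θ hθ
      have hθ' : (θ ≤ thr a b ∧ θ ≤ thr a' b) ∨ (¬ θ ≤ thr a b ∧ ¬ θ ≤ thr a' b) := by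
        rcases hθ with hθ | hθ
        · exact Or.inl ⟨hθ, hθ.trans hle⟩
        · exact Or.inr ⟨by linarith, by linarith⟩
      rcases hθ' with ⟨h1, h2⟩ | ⟨h1, h2⟩ <;>
        simp only [stepL_of_ge, stepR_of_ge, h1, h2, hab, hab1, if_true, if_false]
        <;> simp <;> rw [abs_sub_comm, abs_of_nonneg] <;> linarith
    · intro θ h1 h2
      simp only [stepL_of_ge, stepR_of_ge, h1.not_ge, h2, hab, hab1, if_true, if_false]
      rw [abs_of_nonpos (by linarith), abs_of_nonneg (by linarith)]
      linarith

/-- The mirror image of `stepL_lip`: raising the right marginal lowers the threshold, so the ends of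
the window change places. -/
lemma stepR_lip {a a' b : ℝ} (ha : a ∈ Set.Icc (0 : ℝ) 1) (ha' : a' ∈ Set.Icc (0 : ℝ) 1)
    (hb : b ∈ Set.Icc (0 : ℝ) 1) (h : a ≤ a') (hab : b + a' ≤ 1 ∨ 1 ≤ b + a) :
    ∫⁻ θ, ENNReal.ofReal (|stepR θ b a - stepR θ b a'| + |stepL θ b a - stepL θ b a'|)
      ∂unifIcc 0 1 ≤ ENNReal.ofReal (3 * (a' - a)) := by
  have hp := thr_mem hb ha
  have hp' := thr_mem hb ha'
  obtain ⟨a0, a1⟩ := ha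
  obtain ⟨a0', a1'⟩ := ha'
  obtain ⟨b0, b1⟩ := hb
  obtain ⟨p0, p1⟩ := hp
  obtain ⟨p0', p1'⟩ := hp'
  have hθ' : thr b a' ≤ thr b a → ∀ θ, θ ≤ thr b a' ∨ thr b a < θ →
      (θ ≤ thr b a ∧ θ ≤ thr b a') ∨ (¬ θ ≤ thr b a ∧ ¬ θ ≤ thr b a') := by
    rintro hle θ (hθ | hθ)
    · exact Or.inl ⟨hθ.trans hle, hθ⟩
    · exact Or.inr ⟨by linarith, by linarith⟩
  rcases hab with hab | hab
  · have hab1 : b + a ≤ 1 := by linarith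
    have e1 := thr_mul_of_le b0 a0 hab1
    have e2 := thr_mul_of_le b0 a0' hab
    have hle : thr b a' ≤ thr b a := by
      rcases (add_nonneg b0 a0').eq_or_lt' with h0 | h0
      · rw [thr, if_pos hab, h0]; simpa using p0
      · refine le_of_mul_le_mul_right ?_ h0
        nlinarith
    refine lintegral_le_of_mixing (p := thr b a') (p' := thr b a) (s := (b + a) + (b + a'))
      (by linarith) (by linarith) hle ?_ ?_ ?_
    · nlinarith
    · intro θ hθ
      rcases hθ' hle θ hθ with ⟨h1, h2⟩ | ⟨h1, h2⟩ <;>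
        simp only [stepL, stepR, h1, h2, hab, hab1, if_true, if_false]
        <;> simp <;> rw [abs_sub_comm, abs_of_nonneg] <;> linarith
    · intro θ h1 h2
      simp only [stepL, stepR, h1.not_ge, h2, hab, hab1, if_true, if_false]
      rw [abs_of_nonpos (by linarith), abs_of_nonneg (by linarith)]
      linarith
  · have hab1 : 1 ≤ b + a' := by linarith
    have e1 := thr_mul_of_ge b1 a1 hab
    have e2 := thr_mul_of_ge b1 a1' hab1
    have hle : thr b a' ≤ thr b a := by
      rcases (show 0 ≤ 2 - b - a by linarith).eq_or_lt' with h0 | h0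
      · have : a = a' := by linarith
        rw [this]
      · refine le_of_mul_le_mul_right ?_ h0
        nlinarith
    refine lintegral_le_of_mixing (p := thr b a') (p' := thr b a)
      (s := (2 - b - a) + (2 - b - a')) (by linarith) (by linarith) hle ?_ ?_ ?_
    · nlinarith
    · intro θ hθ
      rcases hθ' hle θ hθ with ⟨h1, h2⟩ | ⟨h1, h2⟩ <;>
        simp only [stepL_of_ge, stepR_of_ge, h1, h2, hab, hab1, if_true, if_false]
        <;> simp <;> rw [abs_sub_comm, abs_of_nonneg] <;> linarith
    · intro θ h1 h2
      simp only [stepL_of_ge, stepR_of_ge, h1.not_ge, h2, hab, hab1, if_true, if_false]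
      rw [abs_of_nonpos (by linarith), abs_of_nonneg (by linarith)]
      linarith

lemma fairStep_left : FairStep stepL stepR where
  mean a ha b hb h hh := lintegral_stepL ha hb hh
  lip a ha a' ha' b hb h := by
    by_cases h1 : a' + b ≤ 1
    · exact stepL_lip ha ha' hb h (Or.inl h1)
    by_cases h2 : 1 ≤ a + b
    · exact stepL_lip ha ha' hb h (Or.inr h2)
    -- If a + b crosses 1, the move is cut at 1 - b, where the two regimes meet, and the two bounds
    -- add up without loss.
    have hm : 1 - b ∈ Set.Icc (0 : ℝ) 1 := ⟨by linarith [hb.2], by linarith [hb.1]⟩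
    have e : 3 * (a' - a) = 3 * ((1 - b) - a) + 3 * (a' - (1 - b)) := by ring
    rw [e]
    exact lintegral_abs_triangle (by linarith) (by linarith) (measurable_stepL _ _)
      (measurable_stepL _ _) (measurable_stepR _ _) (measurable_stepR _ _)
      (stepL_lip ha hm hb (by linarith) (Or.inl (by linarith)))
      (stepL_lip hm ha' hb (by linarith) (Or.inr (by linarith)))
  zero θ h0 h1 b hb := by
    have ht : thr 0 b = 0 := by simp [thr, hb.2]
    simp [stepL, stepR, ht, h0.not_ge, hb.2]
  one θ h0 h1 b hb := by
    rcases hb.1.eq_or_lt with h | h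
    · subst h; simp [stepL, stepR, thr, h1]
    · have hb' : ¬ (1 + b ≤ 1) := by linarith
      rcases hb.2.eq_or_lt with h' | h'
      · subst h'; simp [stepL, stepR, thr]; norm_num
      · have : thr 1 b = 1 := by
          rw [thr, if_neg hb', show 2 - 1 - b = 1 - b by ring, div_self (by linarith)]
        simp only [stepL, stepR, this, h1, hb', if_true, if_false]
        exact ⟨trivial, by ring⟩
  meas_left := measurable_stepL
  meas_right := measurable_stepR

lemma fairStep_right : FairStep (fun θ a b => stepR θ b a) (fun θ a b => stepL θ b a) where
  mean a ha b hb h hh := lintegral_stepR hb ha hh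
  lip a ha a' ha' b hb h := by
    by_cases h1 : b + a' ≤ 1
    · exact stepR_lip ha ha' hb h (Or.inl h1)
    by_cases h2 : 1 ≤ b + a
    · exact stepR_lip ha ha' hb h (Or.inr h2)
    have hm : 1 - b ∈ Set.Icc (0 : ℝ) 1 := ⟨by linarith [hb.2], by linarith [hb.1]⟩
    have e : 3 * (a' - a) = 3 * ((1 - b) - a) + 3 * (a' - (1 - b)) := by ring
    rw [e]
    exact lintegral_abs_triangle (by linarith) (by linarith) (measurable_stepR _ _)
      (measurable_stepR _ _) (measurable_stepL _ _) (measurable_stepL _ _)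
      (stepR_lip ha hm hb (by linarith) (Or.inl (by linarith)))
      (stepR_lip hm ha' hb (by linarith) (Or.inr (by linarith)))
  zero θ h0 h1 b hb := by
    rcases hb.1.eq_or_lt with h | h
    · subst h; simp [stepL, stepR]
    · have ht : thr b 0 = 1 := by simp [thr, hb.2, h.ne']
      simp [stepL, stepR, ht, h1, hb.2]
  one θ h0 h1 b hb := by
    rcases hb.1.eq_or_lt with h | h
    · subst h; simp [stepL, stepR, thr, h0.not_ge]
    · have hb' : ¬ (b + 1 ≤ 1) := by linarith
      have : thr b 1 = 0 := by simp [thr, h.not_ge]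
      simp [stepL, stepR, this, h0.not_ge, h.not_ge]
  meas_left a b := measurable_stepR b a
  meas_right a b := measurable_stepL b a

end CorrSampling
end

noncomputable section
namespace CorrSampling

/-! ### Weights of node states -/

/-- Putting the comparison with `thr` outermost exhibits the outcome as a two-valued function of θ,
in the same shape as `stepL` and `stepR`. -/
lemma resolve_eq {ι : Type} (θ : ℝ) (i : ι) (a : ℝ) (j : ι) (b : ℝ) :
    resolve θ i a j b = if θ ≤ thr a b then (if a + b ≤ 1 then (i, a + b, ∅)
      else (j, a + b - 1, {i})) else (if a + b ≤ 1 then (j, a + b, ∅)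
      else (i, a + b - 1, {j})) := by
  unfold resolve thr
  split_ifs <;> rfl

section Weight

variable {ι : Type} [DecidableEq ι]

/-- The weight of the coordinate `c` in the node state `u`, with the value `t` in place of the
marginal of the unfixed coordinate. -/
def weightAt (u : NodeState ι) (t : ℝ) (c : ι) : ℝ :=
  if c ∈ u.2.2 then 1 else if c = u.1 then t else 0

/-- The current marginal of the coordinate `c` in the node state `u`. -/
def weight (u : NodeState ι) (c : ι) : ℝ := weightAt u u.2.1 c

/-- The `ℓ₁` distance on `s` of the weights of two states. -/
def stateDist (s : Finset ι) (u u' : NodeState ι) (t t' : ℝ) : ℝ :=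
  ∑ c ∈ s, |weightAt u t c - weightAt u' t' c|

/-- The state of a node with threshold `θ` and children in the states `u` and `v`. -/
def nodeOut (θ : ℝ) (u v : NodeState ι) : NodeState ι :=
  ((resolve θ u.1 u.2.1 v.1 v.2.1).1, (resolve θ u.1 u.2.1 v.1 v.2.1).2.1,
    (resolve θ u.1 u.2.1 v.1 v.2.1).2.2 ∪ (u.2.2 ∪ v.2.2))

lemma stateDist_nonneg (s : Finset ι) (u u' : NodeState ι) (t t' : ℝ) :
    0 ≤ stateDist s u u' t t' := Finset.sum_nonneg fun _ _ => abs_nonneg _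

lemma stateDist_comm (s : Finset ι) (u u' : NodeState ι) (t t' : ℝ) :
    stateDist s u u' t t' = stateDist s u' u t' t :=
  Finset.sum_congr rfl fun _ _ => abs_sub_comm _ _

lemma stateDist_triangle (s : Finset ι) (u u' u'' : NodeState ι) (t t' t'' : ℝ) :
    stateDist s u u'' t t'' ≤ stateDist s u u' t t' + stateDist s u' u'' t' t'' := by
  unfold stateDist
  rw [← Finset.sum_add_distrib]
  exact Finset.sum_le_sum fun c _ => abs_sub_le _ _ _

lemma stateDist_self_le (s : Finset ι) (u : NodeState ι) (t t' : ℝ) :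
    stateDist s u u t t' ≤ |t - t'| := by
  have h : ∀ c ∈ s, |weightAt u t c - weightAt u t' c| ≤ if c = u.1 then |t - t'| else 0 := by
    intro c _
    unfold weightAt
    split_ifs <;> simp
  refine (Finset.sum_le_sum h).trans ?_
  rw [Finset.sum_ite_eq']
  split_ifs <;> simp

lemma weightAt_cases (u : NodeState ι) (c : ι) :
    (∀ t, weightAt u t c = 1) ∨ (∀ t, weightAt u t c = t) ∨ ∀ t, weightAt u t c = 0 := by
  unfold weightAt
  split_ifs <;> simp

/-- Both states carry the same value t, so each weight is 0, 1 or t, and |1 - t| = 1 - t on the unit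
interval: the absolute values have no kink there. -/
lemma affineOnUnit_stateDist (s : Finset ι) (u u' : NodeState ι) :
    AffineOnUnit fun t => stateDist s u u' t t := by
  refine AffineOnUnit.sum s fun c _ => ⟨?_, fun _ _ => abs_nonneg _⟩
  rcases weightAt_cases u c with h1 | h1 | h1 <;> rcases weightAt_cases u' c with h2 | h2 | h2 <;>
    simp only [h1, h2] <;> first
    | (refine ⟨0, 0, fun t ht => ?_⟩; simp; done)
    | (refine ⟨1, 0, fun t ht => ?_⟩; simp; done)
    | (refine ⟨0, 1, fun t ht => ?_⟩; simp [abs_of_nonneg ht.1]; done)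
    | (refine ⟨1, -1, fun t ht => ?_⟩; rw [abs_of_nonneg (by linarith [ht.2])]; ring)
    | (refine ⟨1, -1, fun t ht => ?_⟩; rw [abs_of_nonpos (by linarith [ht.2])]; ring)

lemma affineOnUnit_stateDist_one (s : Finset ι) (u u' : NodeState ι) :
    AffineOnUnit fun t => stateDist s u u' 1 t := by
  refine AffineOnUnit.sum s fun c _ => ⟨?_, fun _ _ => abs_nonneg _⟩
  rcases weightAt_cases u c with h1 | h1 | h1 <;> rcases weightAt_cases u' c with h2 | h2 | h2 <;>
    simp only [h1, h2] <;> first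
    | (refine ⟨0, 0, fun t ht => ?_⟩; simp; done)
    | (refine ⟨1, 0, fun t ht => ?_⟩; simp; done)
    | (refine ⟨0, 1, fun t ht => ?_⟩; simp [abs_of_nonneg ht.1]; done)
    | (refine ⟨1, -1, fun t ht => ?_⟩; rw [abs_of_nonneg (by linarith [ht.2])]; ring)

lemma affineOnUnit_weightAt (u : NodeState ι) (c : ι) : AffineOnUnit fun t => weightAt u t c := by
  unfold weightAt
  split_ifs
  · exact ⟨⟨1, 0, by simp⟩, by simp⟩
  · exact ⟨⟨0, 1, by simp⟩, fun t ht => ht.1⟩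
  · exact ⟨⟨0, 0, by simp⟩, by simp⟩

lemma measurable_weightAt (u : NodeState ι) (c : ι) : Measurable fun t => weightAt u t c := by
  unfold weightAt
  split_ifs <;> fun_prop

lemma measurable_stateDist (s : Finset ι) (u u' : NodeState ι) {f g : ℝ → ℝ}
    (hf : Measurable f) (hg : Measurable g) :
    Measurable fun θ => stateDist s u u' (f θ) (g θ) := by
  unfold stateDist
  refine Finset.measurable_sum _ fun c _ => ?_
  have h1 := (measurable_weightAt u c).comp hf
  have h2 := (measurable_weightAt u' c).comp hg
  exact (h1.sub h2).abs

/-- Seen from the left subtree, a step does nothing but replace the marginal of its unfixed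
coordinate by `stepL`; fixing that coordinate amounts to the value 0 or 1. -/
lemma weight_nodeOut_left (θ : ℝ) (u v : NodeState ι) {c : ι} (h1 : c ≠ v.1) (h2 : c ∉ v.2.2) :
    weight (nodeOut θ u v) c = weightAt u (stepL θ u.2.1 v.2.1) c := by
  unfold weight weightAt nodeOut stepL
  rw [resolve_eq]
  split_ifs <;> simp_all

lemma weight_nodeOut_right (θ : ℝ) (u v : NodeState ι) {c : ι} (h1 : c ≠ u.1) (h2 : c ∉ u.2.2) :
    weight (nodeOut θ u v) c = weightAt v (stepR θ u.2.1 v.2.1) c := by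
  unfold weight weightAt nodeOut stepR
  rw [resolve_eq]
  split_ifs <;> simp_all

/-- The change of the state on `s`, caused by a change of one of the two children. -/
lemma FairStep.dist_le_of_le {f g : ℝ → ℝ → ℝ → ℝ} (hfg : FairStep f g) (s s' : Finset ι)
    (u u' v : NodeState ι) {a a' b : ℝ} (ha : a ∈ Set.Icc (0 : ℝ) 1)
    (ha' : a' ∈ Set.Icc (0 : ℝ) 1) (hb : b ∈ Set.Icc (0 : ℝ) 1) (h : a ≤ a') :
    ∫⁻ θ, ENNReal.ofReal (stateDist s u u' (f θ a b) (f θ a' b)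
      + stateDist s' v v (g θ a b) (g θ a' b)) ∂unifIcc 0 1
      ≤ ENNReal.ofReal (stateDist s u u' a a' + 4 * (a' - a)) := by
  -- The state is exchanged at the common marginal a, where the mean property is exact. Then the
  -- marginal moves from a to a', which costs 3(a' - a). Rewriting the distance at (a, a) by the one
  -- at (a, a') costs one more a' - a.
  calc _ ≤ ∫⁻ θ, (ENNReal.ofReal (stateDist s u u' (f θ a b) (f θ a b)) +
        ENNReal.ofReal (|f θ a b - f θ a' b| + |g θ a b - g θ a' b|)) ∂unifIcc 0 1 := by
        refine lintegral_mono fun θ => ?_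
        rw [← ENNReal.ofReal_add (stateDist_nonneg _ _ _ _ _) (by positivity)]
        refine ENNReal.ofReal_le_ofReal ?_
        linarith [stateDist_triangle s u u' u' (f θ a b) (f θ a b) (f θ a' b),
          stateDist_self_le s u' (f θ a b) (f θ a' b),
          stateDist_self_le s' v (g θ a b) (g θ a' b)]
    _ ≤ ENNReal.ofReal (stateDist s u u' a a) + ENNReal.ofReal (3 * (a' - a)) := by
        rw [lintegral_add_left ((measurable_stateDist s u u' (hfg.meas_left a b)
          (hfg.meas_left a b)).ennreal_ofReal),
          hfg.mean a ha b hb _ (affineOnUnit_stateDist s u u')]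
        gcongr
        exact hfg.lip a ha a' ha' b hb h
    _ ≤ _ := by
        rw [← ENNReal.ofReal_add (stateDist_nonneg _ _ _ _ _) (by linarith)]
        refine ENNReal.ofReal_le_ofReal ?_
        have h1 := stateDist_triangle s u u' u' a a' a
        have h2 := stateDist_self_le s u' a' a
        rw [abs_of_nonneg (by linarith)] at h2
        linarith

lemma FairStep.dist_le_of_abs_le {f g : ℝ → ℝ → ℝ → ℝ} (hfg : FairStep f g) (s s' : Finset ι)
    (u u' v : NodeState ι) {a a' b δ : ℝ} (ha : a ∈ Set.Icc (0 : ℝ) 1)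
    (ha' : a' ∈ Set.Icc (0 : ℝ) 1) (hb : b ∈ Set.Icc (0 : ℝ) 1) (h : |a - a'| ≤ δ) :
    ∫⁻ θ, ENNReal.ofReal (stateDist s u u' (f θ a b) (f θ a' b)
      + stateDist s' v v (g θ a b) (g θ a' b)) ∂unifIcc 0 1
      ≤ ENNReal.ofReal (stateDist s u u' a a' + 4 * δ) := by
  obtain ⟨h1, h2⟩ := abs_le.mp h
  rcases le_total a a' with hle | hle
  · exact (hfg.dist_le_of_le s s' u u' v ha ha' hb hle).trans
      (ENNReal.ofReal_le_ofReal (by linarith))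
  · have := hfg.dist_le_of_le s s' u' u v ha' ha hb hle
    simp_rw [stateDist_comm s u' u, stateDist_comm s' v v (g _ a' b)] at this
    exact this.trans (ENNReal.ofReal_le_ofReal (by linarith))

/-- Since marginals 1 and 0 affect the sibling alike, its change is that of a move from 0 to a',
small when a' is small. On s itself, the output for marginal 1 is exactly 1 and the mean property
applies. -/
lemma FairStep.dist_le_of_one {f g : ℝ → ℝ → ℝ → ℝ} (hfg : FairStep f g) (s s' : Finset ι)
    (u u' v : NodeState ι) {a' b : ℝ}
    (ha' : a' ∈ Set.Icc (0 : ℝ) 1) (hb : b ∈ Set.Icc (0 : ℝ) 1) :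
    ∫⁻ θ, ENNReal.ofReal (stateDist s u u' (f θ 1 b) (f θ a' b)
      + stateDist s' v v (g θ 1 b) (g θ a' b)) ∂unifIcc 0 1
      ≤ ENNReal.ofReal (stateDist s u u' 1 a' + 3 * a') := by
  calc _ ≤ ∫⁻ θ, (ENNReal.ofReal (stateDist s u u' 1 (f θ a' b)) +
        ENNReal.ofReal (|f θ 0 b - f θ a' b| + |g θ 0 b - g θ a' b|)) ∂unifIcc 0 1 := by
        refine lintegral_mono_ae ?_
        filter_upwards [ae_unifIcc] with θ hθ
        rw [← ENNReal.ofReal_add (stateDist_nonneg _ _ _ _ _) (by positivity),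
          (hfg.one θ hθ.1 hθ.2 b hb).1, (hfg.one θ hθ.1 hθ.2 b hb).2,
          (hfg.zero θ hθ.1 hθ.2 b hb).2]
        refine ENNReal.ofReal_le_ofReal ?_
        linarith [stateDist_self_le s' v b (g θ a' b), abs_nonneg (f θ 0 b - f θ a' b)]
    _ ≤ ENNReal.ofReal (stateDist s u u' 1 a') + ENNReal.ofReal (3 * (a' - 0)) := by
        rw [lintegral_add_left ((measurable_stateDist s u u' measurable_const
          (hfg.meas_left a' b)).ennreal_ofReal),
          hfg.mean a' ha' b hb _ (affineOnUnit_stateDist_one s u u')]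
        gcongr
        exact hfg.lip 0 (by simp) a' ha' b hb ha'.1
    _ = _ := by
        rw [← ENNReal.ofReal_add (stateDist_nonneg _ _ _ _ _) (by linarith [ha'.1]), sub_zero]

lemma FairStep.dist_triangle {f g : ℝ → ℝ → ℝ → ℝ} (hfg : FairStep f g) (s s' : Finset ι)
    (u u' u'' v v' v'' : NodeState ι) {a a' a'' b b' b'' X Y : ℝ} (hX : 0 ≤ X) (hY : 0 ≤ Y)
    (h1 : ∫⁻ θ, ENNReal.ofReal (stateDist s u u' (f θ a b) (f θ a' b')
      + stateDist s' v v' (g θ a b) (g θ a' b')) ∂unifIcc 0 1 ≤ ENNReal.ofReal X)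
    (h2 : ∫⁻ θ, ENNReal.ofReal (stateDist s u' u'' (f θ a' b') (f θ a'' b'')
      + stateDist s' v' v'' (g θ a' b') (g θ a'' b'')) ∂unifIcc 0 1 ≤ ENNReal.ofReal Y) :
    ∫⁻ θ, ENNReal.ofReal (stateDist s u u'' (f θ a b) (f θ a'' b'')
      + stateDist s' v v'' (g θ a b) (g θ a'' b'')) ∂unifIcc 0 1 ≤ ENNReal.ofReal (X + Y) := by
  rw [ENNReal.ofReal_add hX hY]
  refine le_trans ?_ (add_le_add h1 h2)
  have m1 := measurable_stateDist s u u' (hfg.meas_left a b) (hfg.meas_left a' b')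
  have m2 := measurable_stateDist s' v v' (hfg.meas_right a b) (hfg.meas_right a' b')
  rw [← lintegral_add_left (by fun_prop)]
  refine lintegral_mono fun θ => ?_
  rw [← ENNReal.ofReal_add (add_nonneg (stateDist_nonneg _ _ _ _ _) (stateDist_nonneg _ _ _ _ _))
    (add_nonneg (stateDist_nonneg _ _ _ _ _) (stateDist_nonneg _ _ _ _ _))]
  refine ENNReal.ofReal_le_ofReal ?_
  linarith [stateDist_triangle s u u' u'' (f θ a b) (f θ a' b') (f θ a'' b''),
    stateDist_triangle s' v v' v'' (g θ a b) (g θ a' b') (g θ a'' b'')]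

/-- The route goes from a up to 1 and then, past the identification of 1 with 0, to a'. The costs
add up to 6(1 - a) + 3a': 4(1 - a) for the first move, 2(1 - a) for comparing distances at 1 and at
a, and 3a' for the second move. -/
lemma FairStep.dist_le_of_wrap {f g : ℝ → ℝ → ℝ → ℝ} (hfg : FairStep f g) (s s' : Finset ι)
    (u u' v : NodeState ι) {a a' b δ : ℝ} (ha : a ∈ Set.Icc (0 : ℝ) 1)
    (ha' : a' ∈ Set.Icc (0 : ℝ) 1) (hb : b ∈ Set.Icc (0 : ℝ) 1) (h : 1 - a + a' ≤ δ) :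
    ∫⁻ θ, ENNReal.ofReal (stateDist s u u' (f θ a b) (f θ a' b)
      + stateDist s' v v (g θ a b) (g θ a' b)) ∂unifIcc 0 1
      ≤ ENNReal.ofReal (stateDist s u u' a a' + 6 * δ) := by
  have h1 := hfg.dist_le_of_le s s' u u v ha (by simp) hb ha.2
  have h2 := hfg.dist_le_of_one s s' u u' v ha' hb
  have hn := stateDist_nonneg s u u a 1
  have hn' := stateDist_nonneg s u u' 1 a'
  refine (hfg.dist_triangle s s' u u u' v v v (by linarith [ha.2]) (by linarith [ha'.1])
    h1 h2).trans (ENNReal.ofReal_le_ofReal ?_)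
  have h3 := stateDist_self_le s u a 1
  have h4 := stateDist_triangle s u u u' 1 a a'
  rw [stateDist_comm s u u 1 a] at h4
  rw [abs_of_nonpos (by linarith [ha.2])] at h3
  linarith [ha'.1]

/-- The integer z is the difference of the numbers of coordinates already fixed to 1. If the
marginals are not within δ, then z ≠ 0, and as both lie in [0,1] one is near 1 and the other near 0.
-/
lemma FairStep.dist_le {f g : ℝ → ℝ → ℝ → ℝ} (hfg : FairStep f g) (s s' : Finset ι)
    (u u' v : NodeState ι) {a a' b δ : ℝ} (ha : a ∈ Set.Icc (0 : ℝ) 1)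
    (ha' : a' ∈ Set.Icc (0 : ℝ) 1) (hb : b ∈ Set.Icc (0 : ℝ) 1) {z : ℤ}
    (h : |a - a' - z| ≤ δ) :
    ∫⁻ θ, ENNReal.ofReal (stateDist s u u' (f θ a b) (f θ a' b)
      + stateDist s' v v (g θ a b) (g θ a' b)) ∂unifIcc 0 1
      ≤ ENNReal.ofReal (stateDist s u u' a a' + 6 * δ) := by
  obtain ⟨a0, a1⟩ := id ha
  obtain ⟨a0', a1'⟩ := id ha'
  have hδ : 0 ≤ δ := (abs_nonneg _).trans h
  obtain ⟨h1, h2⟩ := abs_le.mp h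
  by_cases hsmall : |a - a'| ≤ δ
  · exact (hfg.dist_le_of_abs_le s s' u u' v ha ha' hb hsmall).trans
      (ENNReal.ofReal_le_ofReal (by linarith))
  rcases lt_trichotomy z 0 with hz | hz | hz
  · have hz' : (z : ℝ) ≤ -1 := by exact_mod_cast Int.le_sub_one_of_lt hz
    have := hfg.dist_le_of_wrap s s' u' u v ha' ha hb (δ := δ) (by linarith)
    simp_rw [stateDist_comm s u' u, stateDist_comm s' v v (g _ a' b)] at this
    exact this
  · subst hz
    exact absurd (by simpa using h) hsmall
  · have hz' : (1 : ℝ) ≤ z := by exact_mod_cast hz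
    exact hfg.dist_le_of_wrap s s' u u' v ha ha' hb (by linarith)

/-- Rounding at a node increases the distance of two states by at most a constant times the
distance of the masses of the subtrees. -/
lemma lintegral_step_dist_le (s s' : Finset ι) (u u' v v' : NodeState ι) {a a' b b' δ δ' : ℝ}
    (ha : a ∈ Set.Icc (0 : ℝ) 1) (ha' : a' ∈ Set.Icc (0 : ℝ) 1) (hb : b ∈ Set.Icc (0 : ℝ) 1)
    (hb' : b' ∈ Set.Icc (0 : ℝ) 1) {z z' : ℤ} (h : |a - a' - z| ≤ δ) (h' : |b - b' - z'| ≤ δ') :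
    ∫⁻ θ, ENNReal.ofReal (stateDist s u u' (stepL θ a b) (stepL θ a' b')
      + stateDist s' v v' (stepR θ a b) (stepR θ a' b')) ∂unifIcc 0 1
      ≤ ENNReal.ofReal (stateDist s u u' a a' + stateDist s' v v' b b' + 6 * (δ + δ')) := by
  have h1 := fairStep_left.dist_le s s' u u' v ha ha' hb h
  have h2 := fairStep_right.dist_le s' s v v' u' hb hb' ha' h'
  simp_rw [add_comm (stateDist s' _ _ _ _)] at h2
  have hδ : 0 ≤ δ := (abs_nonneg _).trans h
  have hδ' : 0 ≤ δ' := (abs_nonneg _).trans h'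
  have hn := stateDist_nonneg s u u' a a'
  have hn' := stateDist_nonneg s' v v' b b'
  -- The intermediate pair has the left child already changed and the right child not yet.
  refine (fairStep_left.dist_triangle s s' u u' u' v v v' (a' := a') (b' := b)
    (by linarith) (by linarith) h1 h2).trans (ENNReal.ofReal_le_ofReal (by linarith))

end Weight

end CorrSampling
end

noncomputable section
namespace CorrSampling

/-! ### Bottom-up processing of a tree -/

instance {ι : Type} : MeasurableSpace (Finset ι) := ⊤

instance {ι : Type} : DiscreteMeasurableSpace (Finset ι) := ⟨fun _ => trivial⟩

section Tree

variable {ι : Type} [DecidableEq ι]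

/-- The leaves of a tree. -/
def CoordTree.leaves : CoordTree ι → Finset ι
  | .leaf i => {i}
  | .node l r => l.leaves ∪ r.leaves

/-- The number of edges on the longest path from the root to a leaf. -/
def CoordTree.depth {ι : Type} : CoordTree ι → ℕ
  | .leaf _ => 0
  | .node l r => max l.depth r.depth + 1

/-- No label occurs twice. -/
def CoordTree.DistinctLeaves : CoordTree ι → Prop
  | .leaf _ => True
  | .node l r => Disjoint l.leaves r.leaves ∧ l.DistinctLeaves ∧ r.DistinctLeaves

/-- What holds for the state of the root of `T` on input `x`, whatever the thresholds. -/
structure NodeInv (T : CoordTree ι) (x : ι → ℝ) (u : NodeState ι) : Prop where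
  mem : u.2.1 ∈ Set.Icc (0 : ℝ) 1
  idx : u.1 ∈ T.leaves
  sub : u.2.2 ⊆ T.leaves
  notMem : u.1 ∉ u.2.2
  mass : (u.2.2.card : ℝ) + u.2.1 = ∑ i ∈ T.leaves, x i

lemma NodeInv.node {l r : CoordTree ι} (h : Disjoint l.leaves r.leaves) {x : ι → ℝ}
    {u v : NodeState ι} (hu : NodeInv l x u) (hv : NodeInv r x v) (θ : ℝ) :
    NodeInv (.node l r) x (nodeOut θ u v) := by
  obtain ⟨i, a, F⟩ := u
  obtain ⟨j, b, G⟩ := v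
  obtain ⟨⟨a0, a1⟩, hi, hF, hiF, hma⟩ := hu
  obtain ⟨⟨b0, b1⟩, hj, hG, hjG, hmb⟩ := hv
  simp only at a0 a1 b0 b1 hi hF hiF hma hj hG hjG hmb
  have hij : i ≠ j := fun e => (Finset.disjoint_left.mp h) hi (e ▸ hj)
  have hiG : i ∉ G := fun e => (Finset.disjoint_left.mp h) hi (hG e)
  have hjF : j ∉ F := fun e => (Finset.disjoint_left.mp h) (hF e) hj
  have hFG : Disjoint F G := Finset.disjoint_of_subset_left hF (Finset.disjoint_of_subset_right hG h)
  have hsum : ∑ c ∈ (CoordTree.node l r).leaves, x c = (F.card + G.card : ℝ) + (a + b) := by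
    rw [CoordTree.leaves, Finset.sum_union h, ← hma, ← hmb]; ring
  have hFG' : F ∪ G ⊆ (CoordTree.node l r).leaves := Finset.union_subset_union hF hG
  have hi' : i ∈ (CoordTree.node l r).leaves := Finset.mem_union_left _ hi
  have hj' : j ∈ (CoordTree.node l r).leaves := Finset.mem_union_right _ hj
  unfold nodeOut
  rw [resolve_eq]
  split_ifs with h1 h2 h2
  · refine ⟨⟨by simp; linarith, by simpa using h2⟩, hi', by simpa using hFG', by simp [hiF, hiG], ?_⟩
    rw [hsum]; simp [Finset.card_union_of_disjoint hFG]
  · refine ⟨⟨by simp; linarith, by simp; linarith⟩, hj', ?_, by simp [hij.symm, hjF, hjG], ?_⟩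
    · simpa [Finset.insert_subset_iff] using ⟨hi', hFG'⟩
    · rw [hsum]
      simp only [Finset.singleton_union]
      rw [Finset.card_insert_of_notMem (by simp [hiF, hiG]), Finset.card_union_of_disjoint hFG]
      push_cast; ring
  · refine ⟨⟨by simp; linarith, by simpa using h2⟩, hj', by simpa using hFG', by simp [hjF, hjG], ?_⟩
    rw [hsum]; simp [Finset.card_union_of_disjoint hFG]
  · refine ⟨⟨by simp; linarith, by simp; linarith⟩, hi', ?_, by simp [hij, hiF, hiG], ?_⟩
    · simpa [Finset.insert_subset_iff] using ⟨hj', hFG'⟩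
    · rw [hsum]
      simp only [Finset.singleton_union]
      rw [Finset.card_insert_of_notMem (by simp [hjF, hjG]), Finset.card_union_of_disjoint hFG]
      push_cast; ring

lemma NodeInv.weight_left {l r : CoordTree ι} (h : Disjoint l.leaves r.leaves) {x : ι → ℝ}
    {u v : NodeState ι} (hv : NodeInv r x v) (θ : ℝ) {c : ι} (hc : c ∈ l.leaves) :
    weight (nodeOut θ u v) c = weightAt u (stepL θ u.2.1 v.2.1) c := by
  have hcr := Finset.disjoint_left.mp h hc
  exact weight_nodeOut_left θ u v (fun e => hcr (e ▸ hv.idx)) (fun e => hcr (hv.sub e))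

lemma NodeInv.weight_right {l r : CoordTree ι} (h : Disjoint l.leaves r.leaves) {x : ι → ℝ}
    {u v : NodeState ι} (hu : NodeInv l x u) (θ : ℝ) {c : ι} (hc : c ∈ r.leaves) :
    weight (nodeOut θ u v) c = weightAt v (stepR θ u.2.1 v.2.1) c := by
  have hcl := Finset.disjoint_right.mp h hc
  exact weight_nodeOut_right θ u v (fun e => hcl (e ▸ hu.idx)) (fun e => hcl (hu.sub e))

lemma nodeInv_treeRound (T : CoordTree ι) (hT : T.DistinctLeaves) {x : ι → ℝ}
    (hx : ∀ i, 0 ≤ x i ∧ x i ≤ 1) (ω : (treeRound T).Ω) :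
    NodeInv T x ((treeRound T).run ω x) := by
  induction T with
  | leaf i => exact ⟨hx i, by simp [treeRound, CoordTree.leaves], by simp [treeRound],
      by simp [treeRound], by simp [treeRound, CoordTree.leaves]⟩
  | node l r ihl ihr =>
    exact NodeInv.node hT.1 (ihl hT.2.1 ω.2.1) (ihr hT.2.2 ω.2.2) ω.1

instance isProbabilityMeasure_treeRound (T : CoordTree ι) :
    IsProbabilityMeasure (treeRound T).law := by
  induction T with
  | leaf i => exact Measure.dirac.isProbabilityMeasure
  | node l r ihl ihr =>
    change IsProbabilityMeasure ((unifIcc 0 1).prod ((treeRound l).law.prod (treeRound r).law))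
    infer_instance

lemma weightAt_pos {u : NodeState ι} {t t' : ℝ} {c : ι} (h : 0 < weightAt u t c) (ht : 0 < t') :
    0 < weightAt u t' c := by
  rcases weightAt_cases u c with h1 | h1 | h1 <;> simp_all

/-- Almost surely, only coordinates of positive weight stay in the game. -/
lemma ae_treeRound_pos (T : CoordTree ι) (hT : T.DistinctLeaves) :
    ∀ᵐ ω ∂(treeRound T).law, ∀ x : ι → ℝ, (∀ i, 0 ≤ x i ∧ x i ≤ 1) →
      ∀ c, 0 < weight ((treeRound T).run ω x) c → 0 < x c := by
  induction T with
  | leaf i =>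
    refine Filter.Eventually.of_forall fun ω x hx c hc => ?_
    by_cases h : c = i
    · subst h; simpa [weight, weightAt, treeRound] using hc
    · simp [weight, weightAt, treeRound, h] at hc
  | node l r ihl ihr =>
    change ∀ᵐ ω ∂(unifIcc 0 1).prod ((treeRound l).law.prod (treeRound r).law), _
    have h1 : ∀ᵐ ω ∂(unifIcc 0 1).prod ((treeRound l).law.prod (treeRound r).law),
        0 < ω.1 ∧ ω.1 ≤ 1 := Measure.quasiMeasurePreserving_fst.ae ae_unifIcc
    have h2 := (Measure.quasiMeasurePreserving_snd (μ := unifIcc 0 1)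
      (ν := (treeRound l).law.prod (treeRound r).law)).ae
      (Measure.quasiMeasurePreserving_fst.ae (ihl hT.2.1))
    have h3 := (Measure.quasiMeasurePreserving_snd (μ := unifIcc 0 1)
      (ν := (treeRound l).law.prod (treeRound r).law)).ae
      (Measure.quasiMeasurePreserving_snd.ae (ihr hT.2.2))
    filter_upwards [h1, h2, h3] with ω h1 h2 h3 x hx c hc
    have hu := nodeInv_treeRound l hT.2.1 hx ω.2.1
    have hv := nodeInv_treeRound r hT.2.2 hx ω.2.2
    have hinv := nodeInv_treeRound (.node l r) hT hx ω
    have hc' : 0 < weight (nodeOut ω.1 ((treeRound l).run ω.2.1 x) ((treeRound r).run ω.2.2 x)) c :=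
      hc
    specialize h2 x hx c
    specialize h3 x hx c
    generalize (treeRound l).run ω.2.1 x = u at *
    generalize (treeRound r).run ω.2.2 x = v at *
    have hcl : c ∈ (CoordTree.node l r).leaves := by
      by_contra hcn
      have : weight ((treeRound (.node l r)).run ω x) c = 0 := by
        unfold weight weightAt
        rw [if_neg fun e => hcn (hinv.sub e), if_neg fun e : c = _ => hcn (e ▸ hinv.idx)]
      exact hc.ne' this
    rcases Finset.mem_union.mp hcl with hcl | hcr
    · rw [hv.weight_left hT.1 ω.1 hcl] at hc'
      refine h2 ?_
      -- A child with marginal 0 keeps it, because θ > 0. If the marginal of the child is positive,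
      -- then a weight that is positive after the step was positive before it.
      rcases hu.mem.1.eq_or_lt with h | h
      · rw [← h, (fairStep_left.zero ω.1 h1.1 h1.2 _ hv.mem).1] at hc'
        rwa [weight, ← h]
      · exact weightAt_pos hc' h
    · rw [hu.weight_right hT.1 ω.1 hcr] at hc'
      refine h3 ?_
      rcases hv.mem.1.eq_or_lt with h | h
      · rw [← h, (fairStep_right.zero ω.1 h1.1 h1.2 _ hu.mem).1] at hc'
        rwa [weight, ← h]
      · exact weightAt_pos hc' h

/-- The `ℓ₁` distance on `s` of the weights of two states. -/
def weightDist (s : Finset ι) (u u' : NodeState ι) : ℝ := ∑ c ∈ s, |weight u c - weight u' c|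

lemma weightDist_nonneg (s : Finset ι) (u u' : NodeState ι) : 0 ≤ weightDist s u u' :=
  Finset.sum_nonneg fun _ _ => abs_nonneg _

lemma weightDist_nodeOut {l r : CoordTree ι} (h : Disjoint l.leaves r.leaves) {x x' : ι → ℝ}
    {u u' v v' : NodeState ι} (hu : NodeInv l x u) (hu' : NodeInv l x' u')
    (hv : NodeInv r x v) (hv' : NodeInv r x' v') (θ : ℝ) :
    weightDist (CoordTree.node l r).leaves (nodeOut θ u v) (nodeOut θ u' v') =
      stateDist l.leaves u u' (stepL θ u.2.1 v.2.1) (stepL θ u'.2.1 v'.2.1) +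
      stateDist r.leaves v v' (stepR θ u.2.1 v.2.1) (stepR θ u'.2.1 v'.2.1) := by
  rw [weightDist, CoordTree.leaves, Finset.sum_union h]
  congr 1 <;> refine Finset.sum_congr rfl fun c hc => ?_
  · rw [hv.weight_left h θ hc, hv'.weight_left h θ hc]
  · rw [hu.weight_right h θ hc, hu'.weight_right h θ hc]

/-- The number of fixed ones plus the marginal is the mass of the subtree. The bound involves the
change of the input and not the distance accumulated so far, which makes the stretch linear rather
than exponential in the depth. -/
lemma NodeInv.abs_sub_le {T : CoordTree ι} {x y : ι → ℝ} {u u' : NodeState ι}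
    (hu : NodeInv T x u) (hu' : NodeInv T y u') :
    |u.2.1 - u'.2.1 - ((u'.2.2.card : ℤ) - (u.2.2.card : ℤ) : ℤ)| ≤
      ∑ i ∈ T.leaves, |x i - y i| := by
  have : u.2.1 - u'.2.1 - (((u'.2.2.card : ℤ) - (u.2.2.card : ℤ) : ℤ) : ℝ)
      = ∑ i ∈ T.leaves, (x i - y i) := by
    rw [Finset.sum_sub_distrib, ← hu.mass, ← hu'.mass]
    push_cast
    ring
  rw [this]
  exact Finset.abs_sum_le_sum_abs _ _

/-! ### Measurability, marginals and expected distances of tree processing. -/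

section Meas

variable [MeasurableSpace ι] [DiscreteMeasurableSpace ι]

lemma measurable_weight (c : ι) : Measurable fun u : NodeState ι => weight u c := by
  unfold weight weightAt
  have h1 : MeasurableSet {u : NodeState ι | c ∈ u.2.2} :=
    (by fun_prop : Measurable fun u : NodeState ι => u.2.2)
      (MeasurableSet.of_discrete (s := {F | c ∈ F}))
  have h2 : MeasurableSet {u : NodeState ι | c = u.1} :=
    (by fun_prop : Measurable fun u : NodeState ι => u.1)
      (MeasurableSet.of_discrete (s := {i | c = i}))
  exact Measurable.ite h1 measurable_const (Measurable.ite h2 (by fun_prop) measurable_const)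

variable [Countable ι]

lemma measurable_nodeOut :
    Measurable fun p : ℝ × NodeState ι × NodeState ι => nodeOut p.1 p.2.1 p.2.2 := by
  have hu : Measurable fun q : Finset ι × Finset ι => q.1 ∪ q.2 := .of_discrete
  have hs : Measurable fun i : ι => ({i} : Finset ι) := .of_discrete
  have hF : Measurable fun p : ℝ × NodeState ι × NodeState ι => p.2.1.2.2 ∪ p.2.2.2.2 :=
    hu.comp (by fun_prop : Measurable fun p : ℝ × NodeState ι × NodeState ι =>
      (p.2.1.2.2, p.2.2.2.2))
  have hFi : Measurable fun p : ℝ × NodeState ι × NodeState ι =>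
      {p.2.1.1} ∪ (p.2.1.2.2 ∪ p.2.2.2.2) :=
    hu.comp (((hs.comp (by fun_prop : Measurable
      fun p : ℝ × NodeState ι × NodeState ι => p.2.1.1))).prodMk hF)
  have hFj : Measurable fun p : ℝ × NodeState ι × NodeState ι =>
      {p.2.2.1} ∪ (p.2.1.2.2 ∪ p.2.2.2.2) :=
    hu.comp (((hs.comp (by fun_prop : Measurable
      fun p : ℝ × NodeState ι × NodeState ι => p.2.2.1))).prodMk hF)
  have hthr : Measurable fun p : ℝ × NodeState ι × NodeState ι => thr p.2.1.2.1 p.2.2.2.1 := by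
    unfold thr
    exact Measurable.ite (measurableSet_le (by fun_prop) (by fun_prop)) (by fun_prop)
      (by fun_prop)
  have e : (fun p : ℝ × NodeState ι × NodeState ι => nodeOut p.1 p.2.1 p.2.2) = fun p =>
      if p.1 ≤ thr p.2.1.2.1 p.2.2.2.1 then
        (if p.2.1.2.1 + p.2.2.2.1 ≤ 1 then
          (p.2.1.1, p.2.1.2.1 + p.2.2.2.1, p.2.1.2.2 ∪ p.2.2.2.2)
        else (p.2.2.1, p.2.1.2.1 + p.2.2.2.1 - 1, {p.2.1.1} ∪ (p.2.1.2.2 ∪ p.2.2.2.2)))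
      else
        (if p.2.1.2.1 + p.2.2.2.1 ≤ 1 then
          (p.2.2.1, p.2.1.2.1 + p.2.2.2.1, p.2.1.2.2 ∪ p.2.2.2.2)
        else (p.2.1.1, p.2.1.2.1 + p.2.2.2.1 - 1, {p.2.2.1} ∪ (p.2.1.2.2 ∪ p.2.2.2.2))) := by
    ext1 p
    unfold nodeOut
    rw [resolve_eq]
    split_ifs <;> simp
  rw [e]
  refine Measurable.ite (measurableSet_le (by fun_prop) hthr) ?_ ?_ <;>
    refine Measurable.ite (measurableSet_le (by fun_prop) (by fun_prop)) ?_ ?_ <;> fun_prop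

lemma measurable_treeRound (T : CoordTree ι) (x : ι → ℝ) :
    Measurable fun ω => (treeRound T).run ω x := by
  induction T with
  | leaf i => exact measurable_const
  | node l r ihl ihr =>
    change Measurable fun ω : ℝ × (treeRound l).Ω × (treeRound r).Ω =>
      nodeOut ω.1 ((treeRound l).run ω.2.1 x) ((treeRound r).run ω.2.2 x)
    have h : Measurable fun ω : ℝ × (treeRound l).Ω × (treeRound r).Ω =>
        (ω.1, (treeRound l).run ω.2.1 x, (treeRound r).run ω.2.2 x) := by fun_prop
    exact measurable_nodeOut.comp h

/-- Tree processing preserves the marginals. -/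
lemma lintegral_treeRound_weight (T : CoordTree ι) (hT : T.DistinctLeaves) {x : ι → ℝ}
    (hx : ∀ i, 0 ≤ x i ∧ x i ≤ 1) {c : ι} (hc : c ∈ T.leaves) :
    ∫⁻ ω, ENNReal.ofReal (weight ((treeRound T).run ω x) c) ∂(treeRound T).law
      = ENNReal.ofReal (x c) := by
  induction T with
  | leaf i =>
    obtain rfl : c = i := by simpa [CoordTree.leaves] using hc
    have h : weight ((c, x c, ∅) : NodeState ι) c = x c := by simp [weight, weightAt]
    change ∫⁻ _ : Unit, ENNReal.ofReal (weight ((c, x c, ∅) : NodeState ι) c)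
      ∂(Measure.dirac ()) = _
    rw [h]
    simp
  | node l r ihl ihr =>
    change ∫⁻ ω, ENNReal.ofReal (weight (nodeOut ω.1 ((treeRound l).run ω.2.1 x)
      ((treeRound r).run ω.2.2 x)) c)
      ∂(unifIcc 0 1).prod ((treeRound l).law.prod (treeRound r).law) = _
    have hm : Measurable fun ω : ℝ × (treeRound l).Ω × (treeRound r).Ω =>
        ENNReal.ofReal (weight (nodeOut ω.1 ((treeRound l).run ω.2.1 x)
      ((treeRound r).run ω.2.2 x)) c) :=
      ((measurable_weight c).comp (measurable_treeRound (.node l r) x)).ennreal_ofReal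
    rw [lintegral_prod_symm' _ hm]
    rcases Finset.mem_union.mp hc with hcl | hcr
    · have m : Measurable fun ω => ENNReal.ofReal (weight ((treeRound l).run ω x) c) :=
        ((measurable_weight c).comp (measurable_treeRound l x)).ennreal_ofReal
      rw [← ihl hT.2.1 hcl, ← (measurePreserving_fst (μ := (treeRound l).law)
        (ν := (treeRound r).law)).lintegral_comp m]
      refine lintegral_congr fun ω => ?_
      have hu := nodeInv_treeRound l hT.2.1 hx ω.1
      have hv := nodeInv_treeRound r hT.2.2 hx ω.2
      simp_rw [hv.weight_left hT.1 _ hcl]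
      exact lintegral_stepL hu.mem hv.mem (affineOnUnit_weightAt _ c)
    · have m : Measurable fun ω => ENNReal.ofReal (weight ((treeRound r).run ω x) c) :=
        ((measurable_weight c).comp (measurable_treeRound r x)).ennreal_ofReal
      rw [← ihr hT.2.2 hcr, ← (measurePreserving_snd (μ := (treeRound l).law)
        (ν := (treeRound r).law)).lintegral_comp m]
      refine lintegral_congr fun ω => ?_
      have hu := nodeInv_treeRound l hT.2.1 hx ω.1
      have hv := nodeInv_treeRound r hT.2.2 hx ω.2
      simp_rw [hu.weight_right hT.1 _ hcr]
      exact lintegral_stepR hu.mem hv.mem (affineOnUnit_weightAt _ c)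

lemma measurable_weightDist_treeRound (T : CoordTree ι) (s : Finset ι) (x y : ι → ℝ) :
    Measurable fun ω => weightDist s ((treeRound T).run ω x) ((treeRound T).run ω y) := by
  unfold weightDist
  refine Finset.measurable_sum _ fun c _ => ?_
  have h (z : ι → ℝ) : Measurable fun ω => weight ((treeRound T).run ω z) c :=
    (measurable_weight c).comp (measurable_treeRound T z)
  exact ((h x).sub (h y)).abs

/-- Tree processing increases distances by at most a constant factor per level. -/
lemma lintegral_treeRound_weightDist_le (T : CoordTree ι) (hT : T.DistinctLeaves) {x y : ι → ℝ}
    (hx : ∀ i, 0 ≤ x i ∧ x i ≤ 1) (hy : ∀ i, 0 ≤ y i ∧ y i ≤ 1) :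
    ∫⁻ ω, ENNReal.ofReal (weightDist T.leaves ((treeRound T).run ω x) ((treeRound T).run ω y))
      ∂(treeRound T).law
      ≤ ENNReal.ofReal ((1 + 6 * T.depth) * ∑ i ∈ T.leaves, |x i - y i|) := by
  induction T with
  | leaf i =>
    change ∫⁻ _, ENNReal.ofReal (weightDist _ (i, x i, ∅) (i, y i, ∅)) ∂(Measure.dirac ()) ≤ _
    simp [weightDist, weight, weightAt, CoordTree.leaves, CoordTree.depth]
  | node l r ihl ihr =>
    set δl := ∑ i ∈ l.leaves, |x i - y i| with hδl
    set δr := ∑ i ∈ r.leaves, |x i - y i| with hδr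
    have hl0 : 0 ≤ δl := Finset.sum_nonneg fun _ _ => abs_nonneg _
    have hr0 : 0 ≤ δr := Finset.sum_nonneg fun _ _ => abs_nonneg _
    change ∫⁻ ω, ENNReal.ofReal (weightDist (CoordTree.node l r).leaves
      (nodeOut ω.1 ((treeRound l).run ω.2.1 x) ((treeRound r).run ω.2.2 x))
      (nodeOut ω.1 ((treeRound l).run ω.2.1 y) ((treeRound r).run ω.2.2 y)))
      ∂(unifIcc 0 1).prod ((treeRound l).law.prod (treeRound r).law) ≤ _
    have hm : Measurable fun ω : ℝ × (treeRound l).Ω × (treeRound r).Ω =>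
        ENNReal.ofReal (weightDist (CoordTree.node l r).leaves
      (nodeOut ω.1 ((treeRound l).run ω.2.1 x) ((treeRound r).run ω.2.2 x))
      (nodeOut ω.1 ((treeRound l).run ω.2.1 y) ((treeRound r).run ω.2.2 y))) :=
      (measurable_weightDist_treeRound (.node l r) _ x y).ennreal_ofReal
    -- The threshold of the node itself is integrated first, with the states of both children
    -- frozen.
    rw [lintegral_prod_symm' _ hm]
    have ml := (measurable_weightDist_treeRound l l.leaves x y).ennreal_ofReal
    have mr := (measurable_weightDist_treeRound r r.leaves x y).ennreal_ofReal
    calc _ ≤ ∫⁻ ω, (ENNReal.ofReal (weightDist l.leaves ((treeRound l).run ω.1 x)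
            ((treeRound l).run ω.1 y)) + (ENNReal.ofReal (weightDist r.leaves
            ((treeRound r).run ω.2 x) ((treeRound r).run ω.2 y)) +
            ENNReal.ofReal (6 * (δl + δr)))) ∂(treeRound l).law.prod (treeRound r).law := by
          refine lintegral_mono fun ω => ?_
          have hu := nodeInv_treeRound l hT.2.1 hx ω.1
          have hv := nodeInv_treeRound r hT.2.2 hx ω.2
          have hu' := nodeInv_treeRound l hT.2.1 hy ω.1
          have hv' := nodeInv_treeRound r hT.2.2 hy ω.2
          simp_rw [weightDist_nodeOut hT.1 hu hu' hv hv']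
          refine (lintegral_step_dist_le _ _ _ _ _ _ hu.mem hu'.mem hv.mem hv'.mem
            (hu.abs_sub_le hu') (hv.abs_sub_le hv')).trans ?_
          rw [← ENNReal.ofReal_add (weightDist_nonneg _ _ _) (by positivity),
            ← ENNReal.ofReal_add (weightDist_nonneg _ _ _)
              (add_nonneg (weightDist_nonneg _ _ _) (by positivity)), ← add_assoc]
          exact le_rfl
      _ = ∫⁻ ω, ENNReal.ofReal (weightDist l.leaves ((treeRound l).run ω x)
            ((treeRound l).run ω y)) ∂(treeRound l).law + (∫⁻ ω, ENNReal.ofReal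
            (weightDist r.leaves ((treeRound r).run ω x) ((treeRound r).run ω y))
              ∂(treeRound r).law + ENNReal.ofReal (6 * (δl + δr))) := by
          have ml' : Measurable fun ω : (treeRound l).Ω × (treeRound r).Ω =>
              ENNReal.ofReal (weightDist l.leaves ((treeRound l).run ω.1 x)
                ((treeRound l).run ω.1 y)) := ml.comp measurable_fst
          have mr' : Measurable fun ω : (treeRound l).Ω × (treeRound r).Ω =>
              ENNReal.ofReal (weightDist r.leaves ((treeRound r).run ω.2 x)
                ((treeRound r).run ω.2 y)) := mr.comp measurable_snd
          rw [lintegral_add_left ml', lintegral_add_left mr',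
            (measurePreserving_fst (μ := (treeRound l).law) (ν := (treeRound r).law)).lintegral_comp
              ml, (measurePreserving_snd (μ := (treeRound l).law)
              (ν := (treeRound r).law)).lintegral_comp mr]
          simp
      _ ≤ ENNReal.ofReal ((1 + 6 * l.depth) * δl) + (ENNReal.ofReal ((1 + 6 * r.depth) * δr)
            + ENNReal.ofReal (6 * (δl + δr))) := by
          gcongr
          · exact ihl hT.2.1
          · exact ihr hT.2.2
      _ ≤ _ := by
          rw [← ENNReal.ofReal_add (by positivity) (by positivity),
            ← ENNReal.ofReal_add (by positivity) (by positivity)]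
          refine ENNReal.ofReal_le_ofReal ?_
          rw [CoordTree.leaves, Finset.sum_union hT.1, ← hδl, ← hδr, CoordTree.depth]
          have h1 : (l.depth : ℝ) ≤ (max l.depth r.depth : ℕ) := by exact_mod_cast le_max_left _ _
          have h2 : (r.depth : ℝ) ≤ (max l.depth r.depth : ℕ) := by exact_mod_cast le_max_right _ _
          push_cast at *
          nlinarith [mul_le_mul_of_nonneg_right h1 hl0, mul_le_mul_of_nonneg_right h2 hr0]

end Meas

end Tree

end CorrSampling
end

noncomputable section
namespace CorrSampling

/-! ### Tree rounding on the balanced tree -/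

lemma leaves_balancedTree {ι : Type} [DecidableEq ι] (f : ℕ → ι) (lo len : ℕ) (h : 1 ≤ len) :
    (balancedTree f lo len).leaves = (Finset.Ico lo (lo + len)).image f := by
  induction lo, len using balancedTree.induct with
  | case1 lo => omega
  | case2 lo => simp [balancedTree, CoordTree.leaves]
  | case3 lo len ih1 ih2 =>
    rw [balancedTree, CoordTree.leaves, ih1 (by omega), ih2 (by omega), ← Finset.image_union]
    congr 1
    rw [show lo + (len + 3) / 2 + (len + 2) / 2 = lo + (len + 2) by omega]
    exact Finset.Ico_union_Ico_eq_Ico (by omega) (by omega)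

lemma distinctLeaves_balancedTree {ι : Type} [DecidableEq ι] (f : ℕ → ι) (lo len : ℕ)
    (h : 1 ≤ len) (hf : Set.InjOn f (Set.Ico lo (lo + len))) :
    (balancedTree f lo len).DistinctLeaves := by
  induction lo, len using balancedTree.induct with
  | case1 lo => omega
  | case2 lo => simp [balancedTree, CoordTree.DistinctLeaves]
  | case3 lo len ih1 ih2 =>
    rw [balancedTree]
    refine ⟨?_, ih1 (by omega) (hf.mono (Set.Ico_subset_Ico le_rfl (by omega))),
      ih2 (by omega) (hf.mono (Set.Ico_subset_Ico (by omega) (by omega)))⟩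
    rw [leaves_balancedTree _ _ _ (by omega), leaves_balancedTree _ _ _ (by omega)]
    simp only [Finset.disjoint_left, Finset.mem_image, Finset.mem_Ico]
    rintro _ ⟨a, ha, rfl⟩ ⟨b, hb, hab⟩
    have := hf (x₁ := b) (x₂ := a) ⟨by omega, by omega⟩ ⟨by omega, by omega⟩ hab
    omega

lemma depth_balancedTree_le {ι : Type} (f : ℕ → ι) (lo len : ℕ) :
    (balancedTree f lo len).depth ≤ Nat.clog 2 len := by
  induction lo, len using balancedTree.induct with
  | case1 lo => simp [balancedTree, CoordTree.depth]
  | case2 lo => simp [balancedTree, CoordTree.depth]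
  | case3 lo len ih1 ih2 =>
    rw [balancedTree, CoordTree.depth, Nat.clog_of_two_le (by norm_num) (by omega)]
    have : Nat.clog 2 ((len + 2) / 2) ≤ Nat.clog 2 ((len + 3) / 2) :=
      Nat.clog_mono_right _ (by omega)
    rw [show (len + 2 + 2 - 1) / 2 = (len + 3) / 2 by omega]
    omega

/-- The coordinate tree of `treeAlg (d + 1)`. -/
def algTree (d : ℕ) : CoordTree (Fin (d + 1)) := balancedTree (Fin.ofNat (d + 1)) 0 (d + 1)

lemma leaves_algTree (d : ℕ) : (algTree d).leaves = Finset.univ := by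
  rw [algTree, leaves_balancedTree _ _ _ (by omega)]
  ext i
  simp only [Finset.mem_image, Finset.mem_Ico, Finset.mem_univ, iff_true]
  exact ⟨i, by omega, by simp⟩

lemma distinctLeaves_algTree (d : ℕ) : (algTree d).DistinctLeaves := by
  refine distinctLeaves_balancedTree _ _ _ (by omega) ?_
  intro a ha b hb hab
  have := congrArg Fin.val hab
  simp only [Fin.ofNat] at this
  rwa [Nat.mod_eq_of_lt (by have := ha.2; omega), Nat.mod_eq_of_lt (by have := hb.2; omega)] at this

lemma treeAlg_run (d : ℕ) (ω : ℝ × (treeRound (algTree d)).Ω) (x : Fin (d + 1) → ℝ) :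
    (treeAlg (d + 1)).run ω x =
      if ω.1 ≤ ((treeRound (algTree d)).run ω.2 x).2.1 then
        insert ((treeRound (algTree d)).run ω.2 x).1 ((treeRound (algTree d)).run ω.2 x).2.2
      else ((treeRound (algTree d)).run ω.2 x).2.2 := by
  change (if _ then _ else _) = _
  split_ifs <;> first | rfl | contradiction

/-- For 0 < θ ≤ 1 the last decision is a threshold rounding of the whole weight vector: weights 1
always pass and weights 0 never do. -/
lemma mem_treeAlg_run {d : ℕ} {ω : ℝ × (treeRound (algTree d)).Ω} (h0 : 0 < ω.1) (h1 : ω.1 ≤ 1)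
    (x : Fin (d + 1) → ℝ) (c : Fin (d + 1)) :
    c ∈ (treeAlg (d + 1)).run ω x ↔ ω.1 ≤ weight ((treeRound (algTree d)).run ω.2 x) c := by
  rw [treeAlg_run]
  unfold weight weightAt
  generalize (treeRound (algTree d)).run ω.2 x = u
  have := h0.not_ge
  split_ifs <;> simp_all

instance isProbabilityMeasure_treeAlg (N : ℕ) : IsProbabilityMeasure (treeAlg N).law := by
  cases N with
  | zero => exact Measure.dirac.isProbabilityMeasure
  | succ d =>
    change IsProbabilityMeasure ((unifIcc 0 1).prod (treeRound (algTree d)).law)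
    infer_instance

lemma measurable_treeAlg (N : ℕ) (x : Fin N → ℝ) : Measurable fun ω => (treeAlg N).run ω x := by
  cases N with
  | zero => exact measurable_const
  | succ d =>
    have hr : Measurable fun ω : ℝ × (treeRound (algTree d)).Ω =>
        (treeRound (algTree d)).run ω.2 x := (measurable_treeRound _ x).comp measurable_snd
    have hi : Measurable fun q : Fin (d + 1) × Finset (Fin (d + 1)) => insert q.1 q.2 :=
      .of_discrete
    have e : (fun ω => (treeAlg (d + 1)).run ω x) = fun ω : ℝ × (treeRound (algTree d)).Ω =>
        if ω.1 ≤ ((treeRound (algTree d)).run ω.2 x).2.1 then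
          insert ((treeRound (algTree d)).run ω.2 x).1 ((treeRound (algTree d)).run ω.2 x).2.2
        else ((treeRound (algTree d)).run ω.2 x).2.2 := funext fun ω => treeAlg_run d ω x
    rw [e]
    change Measurable fun ω : ℝ × (treeRound (algTree d)).Ω => _
    refine Measurable.ite (measurableSet_le measurable_fst (by fun_prop)) ?_ (by fun_prop)
    exact hi.comp ((by fun_prop : Measurable fun ω : ℝ × (treeRound (algTree d)).Ω =>
      ((treeRound (algTree d)).run ω.2 x).1).prodMk (by fun_prop))

lemma l1_of_nonneg {n : ℕ} {x : Fin n → ℝ} (hx : ∀ i, 0 ≤ x i) : l1 x = ∑ i, x i :=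
  Finset.sum_congr rfl fun i _ => abs_of_nonneg (hx i)

/-- The number of fixed ones and the last marginal sum to `l1 x`, so rounding the last marginal
gives floor or ceiling. That no coordinate with x i = 0 is selected is needed later: a selected
position of x̂ must contain something. -/
lemma ae_treeAlg {N : ℕ} (hN : 0 < N) : ∀ᵐ ω ∂(treeAlg N).law, ∀ x : Fin N → ℝ,
    (∀ i, 0 ≤ x i ∧ x i ≤ 1) →
      (((treeAlg N).run ω x).card = ⌊l1 x⌋₊ ∨ ((treeAlg N).run ω x).card = ⌈l1 x⌉₊) ∧
      ∀ i ∈ (treeAlg N).run ω x, 0 < x i := by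
  obtain ⟨d, rfl⟩ := Nat.exists_eq_succ_of_ne_zero hN.ne'
  change ∀ᵐ ω ∂(unifIcc 0 1).prod (treeRound (algTree d)).law, _
  have h1 : ∀ᵐ ω ∂(unifIcc 0 1).prod (treeRound (algTree d)).law, 0 < ω.1 ∧ ω.1 ≤ 1 :=
    Measure.quasiMeasurePreserving_fst.ae ae_unifIcc
  have h2 := (Measure.quasiMeasurePreserving_snd (μ := unifIcc 0 1)
      (ν := (treeRound (algTree d)).law)).ae
      (ae_treeRound_pos (algTree d) (distinctLeaves_algTree d))
  filter_upwards [h1, h2] with ω h1 h2 x hx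
  refine ⟨?_, fun i hi => h2 x hx i (h1.1.trans_le ((mem_treeAlg_run h1.1 h1.2 x i).mp hi))⟩
  have hinv := nodeInv_treeRound (algTree d) (distinctLeaves_algTree d) hx ω.2
  have hmass := hinv.mass
  rw [leaves_algTree, ← l1_of_nonneg fun i => (hx i).1] at hmass
  rw [treeAlg_run]
  obtain ⟨ha0, ha1⟩ := hinv.mem
  split_ifs with h
  · right
    rw [Finset.card_insert_of_notMem hinv.notMem, eq_comm, Nat.ceil_eq_iff (by omega)]
    push_cast
    rw [← hmass]
    constructor <;> linarith [h1.1]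
  · left
    rw [eq_comm, Nat.floor_eq_iff (by rw [← hmass]; positivity), ← hmass]
    constructor <;> linarith [h1.2]

lemma treeAlg_marginal {N : ℕ} {x : Fin N → ℝ} (hx : ∀ i, 0 ≤ x i ∧ x i ≤ 1) (c : Fin N) :
    (treeAlg N).law {ω | c ∈ (treeAlg N).run ω x} = ENNReal.ofReal (x c) := by
  obtain ⟨d, rfl⟩ := Nat.exists_eq_succ_of_ne_zero (Nat.ne_of_gt (Fin.pos c))
  have h1 : ∀ᵐ ω ∂(unifIcc 0 1).prod (treeRound (algTree d)).law, 0 < ω.1 ∧ ω.1 ≤ 1 :=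
    Measure.quasiMeasurePreserving_fst.ae ae_unifIcc
  have hw : Measurable fun ω => weight ((treeRound (algTree d)).run ω x) c :=
    (measurable_weight c).comp (measurable_treeRound _ x)
  have e : {ω | c ∈ (treeAlg (d + 1)).run ω x}
      =ᵐ[(unifIcc 0 1).prod (treeRound (algTree d)).law]
      {ω | ω.1 ≤ weight ((treeRound (algTree d)).run ω.2 x) c} := by
    filter_upwards [h1] with ω h1
    exact propext (mem_treeAlg_run h1.1 h1.2 x c)
  refine (measure_congr e).trans ?_
  have hs : MeasurableSet {ω : ℝ × (treeRound (algTree d)).Ω |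
      ω.1 ≤ weight ((treeRound (algTree d)).run ω.2 x) c} :=
    measurableSet_le measurable_fst (hw.comp measurable_snd)
  rw [Measure.prod_apply_symm hs,
    ← lintegral_treeRound_weight (algTree d) (distinctLeaves_algTree d) hx
      (by rw [leaves_algTree]; exact Finset.mem_univ c)]
  refine lintegral_congr fun ω => ?_
  have hinv := nodeInv_treeRound (algTree d) (distinctLeaves_algTree d) hx ω
  change unifIcc 0 1 (Set.Iic (weight ((treeRound (algTree d)).run ω x) c)) = _
  refine unifIcc_Iic ?_
  unfold weight weightAt
  split_ifs
  exacts [le_rfl, hinv.mem.2, zero_le_one]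

lemma card_symmDiff_eq_sum {κ : Type*} [Fintype κ] [DecidableEq κ] (s t : Finset κ) :
    ((symmDiff s t).card : ENNReal) = ∑ c, if c ∈ symmDiff s t then 1 else 0 := by
  simp

/-- For fixed tree thresholds, c is in exactly one output only if the root threshold separates its
two weights, so the expected symmetric difference is at most the ℓ₁ distance of the weights. -/
lemma treeAlg_stretch {N : ℕ} {x y : Fin N → ℝ} (hx : ∀ i, 0 ≤ x i ∧ x i ≤ 1)
    (hy : ∀ i, 0 ≤ y i ∧ y i ≤ 1) :
    ∫⁻ ω, ((symmDiff ((treeAlg N).run ω x) ((treeAlg N).run ω y)).card : ENNReal)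
      ∂(treeAlg N).law ≤ ENNReal.ofReal ((1 + 6 * Nat.clog 2 N) * l1 (x - y)) := by
  have hl : 0 ≤ l1 (x - y) := Finset.sum_nonneg fun _ _ => abs_nonneg _
  cases N with
  | zero => simp [Subsingleton.elim x y]
  | succ d =>
    change ∫⁻ ω, _ ∂(unifIcc 0 1).prod (treeRound (algTree d)).law ≤ _
    rw [← lintegral_prod_swap]
    refine (lintegral_prod_le _).trans ?_
    calc _ ≤ ∫⁻ ω, ENNReal.ofReal (weightDist (algTree d).leaves
            ((treeRound (algTree d)).run ω x) ((treeRound (algTree d)).run ω y))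
              ∂(treeRound (algTree d)).law := by
          refine lintegral_mono fun ω => ?_
          set w := weight ((treeRound (algTree d)).run ω x) with hw
          set w' := weight ((treeRound (algTree d)).run ω y) with hw'
          calc _ ≤ ∫⁻ θ, ∑ c, (Set.Ioc (min (w c) (w' c)) (max (w c) (w' c))).indicator
                  (fun _ => (1 : ENNReal)) θ ∂unifIcc 0 1 := by
                refine lintegral_mono_ae ?_
                filter_upwards [ae_unifIcc] with θ hθ
                rw [card_symmDiff_eq_sum]
                refine Finset.sum_le_sum fun c _ => ?_
                have e1 := mem_treeAlg_run (ω := (θ, ω)) hθ.1 hθ.2 x c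
                have e2 := mem_treeAlg_run (ω := (θ, ω)) hθ.1 hθ.2 y c
                simp only [Prod.swap_prod_mk, Finset.mem_symmDiff, e1, e2, ← hw, ← hw']
                split_ifs with h
                · rw [Set.indicator_of_mem]
                  simp only [Set.mem_Ioc, min_lt_iff, le_max_iff]
                  grind
                · exact zero_le
            _ ≤ ∑ c, ENNReal.ofReal |w c - w' c| := by
                rw [lintegral_finsetSum _ fun c _ =>
                  measurable_const.indicator measurableSet_Ioc]
                refine Finset.sum_le_sum fun c _ => ?_
                rw [lintegral_indicator_const measurableSet_Ioc, one_mul]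
                refine (unifIcc_Ioc_le one_pos _ _).trans (ENNReal.ofReal_le_ofReal ?_)
                rw [sub_zero, div_one, max_sub_min_eq_abs, abs_sub_comm]
            _ = _ := by
                rw [← ENNReal.ofReal_sum_of_nonneg fun _ _ => abs_nonneg _, leaves_algTree]
                rfl
      _ ≤ _ := by
          refine (lintegral_treeRound_weightDist_le (algTree d) (distinctLeaves_algTree d)
            hx hy).trans (ENNReal.ofReal_le_ofReal ?_)
          rw [leaves_algTree]
          have : ((algTree d).depth : ℝ) ≤ Nat.clog 2 (d + 1) := by
            exact_mod_cast depth_balancedTree_le _ _ _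
          exact mul_le_mul_of_nonneg_right (by linarith) hl

end CorrSampling
end

noncomputable section
namespace CorrSampling

/-! ### Exponential clocks -/

instance : IsProbabilityMeasure (ProbabilityTheory.expMeasure 1) :=
  ProbabilityTheory.isProbabilityMeasure_expMeasure one_pos

lemma expMeasure_Iic (s : ℝ) : ProbabilityTheory.expMeasure 1 (Set.Iic s) =
    ENNReal.ofReal (if 0 ≤ s then 1 - Real.exp (-s) else 0) := by
  have h := ProbabilityTheory.cdf_expMeasure_eq one_pos s
  rw [ProbabilityTheory.cdf_eq_real] at h
  rw [← ofReal_measureReal, h, one_mul]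

lemma ae_expMeasure_pos : ∀ᵐ t ∂ProbabilityTheory.expMeasure 1, 0 < t := by
  rw [ae_iff]
  have : {t : ℝ | ¬ 0 < t} = Set.Iic 0 := by ext; simp
  rw [this, expMeasure_Iic]
  simp

lemma expMeasure_Ioi {s : ℝ} (hs : 0 ≤ s) :
    ProbabilityTheory.expMeasure 1 (Set.Ioi s) = ENNReal.ofReal (Real.exp (-s)) := by
  rw [← Set.compl_Iic, prob_compl_eq_one_sub measurableSet_Iic, expMeasure_Iic, if_pos hs,
    ← ENNReal.ofReal_one, ← ENNReal.ofReal_sub _ (by simpa using hs)]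
  congr 1
  ring

lemma expMeasure_Ici {s : ℝ} (hs : 0 ≤ s) :
    ProbabilityTheory.expMeasure 1 (Set.Ici s) = ENNReal.ofReal (Real.exp (-s)) := by
  rw [← expMeasure_Ioi hs]
  refine measure_congr ?_
  have hac : ProbabilityTheory.expMeasure 1 ≪ volume := withDensity_absolutelyContinuous _ _
  exact hac.ae_eq Ioi_ae_eq_Ici.symm

/-- Up to the factor 1/(1 + s), the integrand times the density of Exp(1) is the density of Exp(1 +
s). -/
lemma lintegral_exp_neg_mul {s : ℝ} (hs : 0 ≤ s) :
    ∫⁻ t, ENNReal.ofReal (Real.exp (-(t * s))) ∂ProbabilityTheory.expMeasure 1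
      = ENNReal.ofReal (1 / (1 + s)) := by
  have hm : Measurable (ProbabilityTheory.exponentialPDF 1) :=
    (ProbabilityTheory.measurable_exponentialPDFReal 1).ennreal_ofReal
  have e : ProbabilityTheory.expMeasure 1
      = volume.withDensity (ProbabilityTheory.exponentialPDF 1) := rfl
  rw [e, lintegral_withDensity_eq_lintegral_mul _ hm (by fun_prop)]
  have h : ∀ t, (ProbabilityTheory.exponentialPDF 1 *
      fun t => ENNReal.ofReal (Real.exp (-(t * s)))) t =
      ENNReal.ofReal (1 / (1 + s)) * ProbabilityTheory.exponentialPDF (1 + s) t := by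
    intro t
    rw [Pi.mul_apply]
    rcases lt_or_ge t 0 with ht | ht
    · simp [ProbabilityTheory.exponentialPDF_of_neg ht]
    · rw [ProbabilityTheory.exponentialPDF_of_nonneg ht,
        ProbabilityTheory.exponentialPDF_of_nonneg ht,
        ← ENNReal.ofReal_mul (by positivity), ← ENNReal.ofReal_mul (by positivity)]
      congr 1
      rw [one_mul, one_mul, ← Real.exp_add, ← mul_assoc, one_div_mul_cancel (by positivity),
        one_mul]
      congr 1
      ring
  simp_rw [h]
  have hm' : Measurable (ProbabilityTheory.exponentialPDF (1 + s)) :=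
    (ProbabilityTheory.measurable_exponentialPDFReal _).ennreal_ofReal
  rw [lintegral_const_mul _ hm', ProbabilityTheory.lintegral_exponentialPDF_eq_one (by positivity), mul_one]

lemma measurable_of_mem {Ω : Type*} [MeasurableSpace Ω] {n : ℕ} {f : Ω → Finset (Fin n)}
    (h : ∀ i, MeasurableSet {ω | i ∈ f ω}) : Measurable f := by
  refine measurable_to_countable' fun s => ?_
  have : f ⁻¹' {s} = ⋂ i, {ω | i ∈ f ω ↔ i ∈ s} := by
    ext ω
    simp [Finset.ext_iff]
  rw [this]
  refine MeasurableSet.iInter fun i => ?_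
  by_cases hi : i ∈ s
  · simpa [hi] using h i
  · simp only [hi, iff_false]
    exact (h i).compl

variable {n : ℕ}

lemma mem_clockRound {R x : Fin n → ℝ} {i : Fin n} : i ∈ clockRound R x ↔ 0 < x i ∧
    ∀ j, 0 < x j → R i / x i < R j / x j ∨ (R i / x i = R j / x j ∧ i ≤ j) := by
  simp [clockRound]

lemma measurableSet_mem_clockRound (x : Fin n → ℝ) (i : Fin n) :
    MeasurableSet {R : Fin n → ℝ | i ∈ clockRound R x} := by
  simp only [mem_clockRound, Set.ofPred_and, Set.ofPred_forall]
  refine (MeasurableSet.const _).inter (MeasurableSet.iInter fun j => MeasurableSet.iInter fun _ =>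
    ?_)
  have h (j : Fin n) : Measurable fun R : Fin n → ℝ => R j / x j := by fun_prop
  exact (measurableSet_lt (h i) (h j)).union
    ((measurableSet_eq_fun (h i) (h j)).inter (MeasurableSet.const _))

lemma clockRound_unique {R x : Fin n → ℝ} {i j : Fin n} (hi : i ∈ clockRound R x)
    (hj : j ∈ clockRound R x) : i = j := by
  rw [mem_clockRound] at hi hj
  have h1 := hi.2 j hj.1
  have h2 := hj.2 i hi.1
  rcases h1 with h1 | ⟨h1, h1'⟩ <;> rcases h2 with h2 | ⟨h2, h2'⟩
  · exact absurd h2 h1.not_gt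
  · exact absurd h2 h1.ne'
  · exact absurd h1 h2.ne'
  · exact le_antisymm h1' h2'

lemma exists_mem_clockRound (R : Fin n → ℝ) {x : Fin n → ℝ} (h : ∃ i, 0 < x i) :
    ∃ i, i ∈ clockRound R x := by
  classical
  obtain ⟨i₀, h0⟩ := h
  obtain ⟨i, hi, hmin⟩ := Finset.exists_min_image (Finset.univ.filter fun i => 0 < x i)
    (fun i => toLex (R i / x i, i)) ⟨i₀, by simpa using h0⟩
  refine ⟨i, mem_clockRound.mpr ⟨by simpa using hi, fun j hj => ?_⟩⟩
  have := hmin j (by simpa using hj)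
  rwa [Prod.Lex.toLex_le_toLex] at this

lemma clockRound_eq_singleton {R x : Fin n → ℝ} {i : Fin n} (hi : i ∈ clockRound R x) :
    clockRound R x = {i} :=
  Finset.eq_singleton_iff_unique_mem.mpr ⟨hi, fun _ hj => clockRound_unique hj hi⟩

/-- Scale invariance lets the normalisation in `rep` be dropped, so that the mass of a bucket can
change along with x. -/
lemma clockRound_smul (R x : Fin n → ℝ) {c : ℝ} (hc : 0 < c) :
    (clockRound R fun i => x i / c) = clockRound R x := by
  ext i
  simp only [mem_clockRound, div_pos_iff_of_pos_right hc, div_div_eq_mul_div, mul_div_right_comm,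
    mul_lt_mul_iff_left₀ hc, mul_left_inj' hc.ne']

/-- Raising `x p` lowers only the ratio of p, so it cannot help any other coordinate to win. -/
lemma clockRound_of_mem_update {R x : Fin n → ℝ} {p w : Fin n} {t : ℝ} (hR : 0 ≤ R p)
    (ht : x p ≤ t) (hw : w ∈ clockRound R (Function.update x p t)) (hwp : w ≠ p) :
    w ∈ clockRound R x := by
  rw [mem_clockRound] at hw ⊢
  rw [Function.update_of_ne hwp] at hw
  refine ⟨hw.1, fun j hj => ?_⟩
  by_cases hjp : j = p
  · subst hjp
    have h := hw.2 j (by rw [Function.update_self]; linarith)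
    rw [Function.update_self] at h
    have hle : R j / t ≤ R j / x j := div_le_div_of_nonneg_left hR hj ht
    rcases h with h | ⟨h, h'⟩
    · exact Or.inl (h.trans_le hle)
    · rcases hle.eq_or_lt with h2 | h2
      · exact Or.inr ⟨h.trans h2, h'⟩
      · exact Or.inl (h.trans_lt h2)
  · have h := hw.2 j (by rwa [Function.update_of_ne hjp])
    rwa [Function.update_of_ne hjp] at h

/-- The distribution of the clocks. -/
def clockLaw (n : ℕ) : Measure (Fin n → ℝ) := Measure.pi fun _ => ProbabilityTheory.expMeasure 1

instance : IsProbabilityMeasure (clockLaw n) :=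
  inferInstanceAs (IsProbabilityMeasure (Measure.pi fun _ => ProbabilityTheory.expMeasure 1))

/-- The marginals of exponential clocks. -/
lemma clockLaw_marginal {x : Fin n → ℝ} (hx : ∀ i, 0 ≤ x i) (i : Fin n) :
    clockLaw n {R | i ∈ clockRound R x} = ENNReal.ofReal (x i / ∑ j, x j) := by
  rcases (hx i).eq_or_lt with hi | hi
  · have : {R | i ∈ clockRound R x} = ∅ := by
      ext R; simp [mem_clockRound, ← hi]
    rw [this, ← hi]
    simp
  obtain ⟨d, rfl⟩ := Nat.exists_eq_succ_of_ne_zero (Nat.ne_of_gt (Fin.pos i))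
  have hmp := (measurePreserving_piFinSuccAbove
    (fun _ : Fin (d + 1) => ProbabilityTheory.expMeasure 1) i).symm
  have hS := measurableSet_mem_clockRound x i
  change (Measure.pi fun _ => ProbabilityTheory.expMeasure 1) _ = _
  rw [← hmp.measure_preimage hS.nullMeasurableSet,
    Measure.prod_apply (hmp.measurable hS)]
  -- Given R i = t, coordinate i wins if each other clock independently passes t · x j / x i; the
  -- tie rule only decides between `Ici` and `Ioi`, which have equal measure.
  have key : ∀ t, 0 < t → (Measure.pi fun _ : Fin d => ProbabilityTheory.expMeasure 1)
      (Prod.mk t ⁻¹' ((MeasurableEquiv.piFinSuccAbove (fun _ : Fin (d + 1) => ℝ) i).symm ⁻¹'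
        {R | i ∈ clockRound R x}))
      = ENNReal.ofReal (Real.exp (-(t * ((∑ j : Fin d, x (i.succAbove j)) / x i)))) := by
    intro t ht
    have e : (Prod.mk t ⁻¹' ((MeasurableEquiv.piFinSuccAbove (fun _ : Fin (d + 1) => ℝ) i).symm ⁻¹'
        {R | i ∈ clockRound R x})) = Set.univ.pi fun j : Fin d =>
          {r : ℝ | 0 < x (i.succAbove j) → t / x i < r / x (i.succAbove j) ∨
            (t / x i = r / x (i.succAbove j) ∧ i ≤ i.succAbove j)} := by
      ext R
      simp [mem_clockRound, MeasurableEquiv.piFinSuccAbove, Fin.forall_iff_succAbove i, hi,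
        Fin.insertNthEquiv]
    rw [e, Measure.pi_pi]
    have h1 : ∀ j : Fin d, ProbabilityTheory.expMeasure 1
        {r : ℝ | 0 < x (i.succAbove j) → t / x i < r / x (i.succAbove j) ∨
            (t / x i = r / x (i.succAbove j) ∧ i ≤ i.succAbove j)}
        = ENNReal.ofReal (Real.exp (-(t * (x (i.succAbove j) / x i)))) := by
      intro j
      rcases (hx (i.succAbove j)).eq_or_lt with hj | hj
      · simp [← hj]
      · have hs : 0 ≤ t * (x (i.succAbove j) / x i) := by positivity
        have hlt : ∀ r, t / x i < r / x (i.succAbove j) ↔ t * (x (i.succAbove j) / x i) < r := by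
          intro r
          rw [lt_div_iff₀ hj, ← mul_div_assoc, mul_div_right_comm]
        have heq : ∀ r, t / x i = r / x (i.succAbove j) ↔ t * (x (i.succAbove j) / x i) = r := by
          intro r
          rw [eq_div_iff hj.ne', ← mul_div_assoc, mul_div_right_comm]
        simp only [hj, true_imp_iff, hlt, heq]
        by_cases hij : i ≤ i.succAbove j
        · rw [← expMeasure_Ici hs]
          congr 1
          ext r
          simp [hij, le_iff_lt_or_eq]
        · rw [← expMeasure_Ioi hs]
          congr 1
          ext r
          simp [hij]
    simp_rw [h1]
    rw [← ENNReal.ofReal_prod_of_nonneg fun _ _ => (Real.exp_pos _).le, ← Real.exp_sum]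
    congr 2
    rw [Finset.sum_neg_distrib, ← Finset.mul_sum, Finset.sum_div]
  have hs0 : 0 ≤ ∑ j : Fin d, x (i.succAbove j) := Finset.sum_nonneg fun _ _ => hx _
  rw [lintegral_congr_ae (ae_expMeasure_pos.mono key),
    lintegral_exp_neg_mul (by positivity), Fin.sum_univ_succAbove _ i]
  congr 1
  field_simp

/-- Raising one coordinate by `δ` changes the winner with probability at most `δ / (M + δ)`, where
`M` is the total mass. -/
lemma clockLaw_change {x : Fin n → ℝ} (hx : ∀ i, 0 ≤ x i) (p : Fin n) {δ : ℝ} (hδ : 0 < δ) :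
    clockLaw n {R | clockRound R x ≠ clockRound R (Function.update x p (x p + δ))}
      ≤ ENNReal.ofReal (δ / (∑ j, x j + δ)) := by
  set y := Function.update x p (x p + δ) with hy
  have hM0 : 0 ≤ ∑ j, x j := Finset.sum_nonneg fun _ _ => hx _
  rcases hM0.eq_or_lt with hM | hM
  · rw [← hM, zero_add, div_self hδ.ne', ENNReal.ofReal_one]
    exact prob_le_one
  have hy0 : ∀ i, 0 ≤ y i := fun i => by
    by_cases h : i = p
    · subst h; simp only [hy, Function.update_self]; linarith [hx i]
    · simp only [hy, Function.update_of_ne h]; exact hx i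
  have hysum : ∑ j, y j = ∑ j, x j + δ := by
    rw [hy, Finset.sum_update_of_mem (Finset.mem_univ p),
      ← Finset.add_sum_erase _ x (Finset.mem_univ p), Finset.sdiff_singleton_eq_erase]
    ring
  have hpos : ∀ᵐ R ∂clockLaw n, 0 ≤ R p :=
    ((Measure.quasiMeasurePreserving_eval (μ := fun _ : Fin n => ProbabilityTheory.expMeasure 1)
      p).ae ae_expMeasure_pos).mono fun _ h => le_of_lt h
  have hex : ∃ i, 0 < x i := by
    by_contra! hc
    exact absurd (Finset.sum_nonpos fun i _ => hc i) hM.not_ge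
  have hey : ∃ i, 0 < y i := by
    by_contra! hc
    have := Finset.sum_nonpos fun i (_ : i ∈ Finset.univ) => hc i
    linarith
  -- The winner can change only in favour of p, and p never loses by the increase. Hence the
  -- probability of a change is at most the difference of the two marginals of p.
  have hdet : ∀ R : Fin n → ℝ, 0 ≤ R p → (p ∈ clockRound R x → p ∈ clockRound R y) ∧
      (clockRound R x ≠ clockRound R y → p ∈ clockRound R y ∧ p ∉ clockRound R x) := by
    intro R hR
    obtain ⟨w, hw⟩ := exists_mem_clockRound R hey
    have hmain : w ≠ p → w ∈ clockRound R x :=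
      clockRound_of_mem_update hR (by linarith) hw
    by_cases hwp : w = p
    · subst hwp
      refine ⟨fun _ => hw, fun hne => ⟨hw, fun hx' => hne ?_⟩⟩
      rw [clockRound_eq_singleton hw, clockRound_eq_singleton hx']
    · have hwx := hmain hwp
      refine ⟨fun hp => absurd (clockRound_unique hwx hp) hwp, fun hne => absurd ?_ hne⟩
      rw [clockRound_eq_singleton hw, clockRound_eq_singleton hwx]
  set A := {R | p ∈ clockRound R x} with hA
  set B := {R | p ∈ clockRound R y} with hB
  have hAm : MeasurableSet A := measurableSet_mem_clockRound x p
  have h1 : clockLaw n {R | clockRound R x ≠ clockRound R y} ≤ clockLaw n (B \ A) := by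
    refine measure_mono_ae ?_
    filter_upwards [hpos] with R hR hne
    exact (hdet R hR).2 hne
  have h2 : clockLaw n (B ∩ A) = clockLaw n A := by
    refine measure_congr ?_
    filter_upwards [hpos] with R hR
    exact propext ⟨fun h => h.2, fun h => ⟨(hdet R hR).1 h, h⟩⟩
  have h3 := measure_sdiff_add_inter (μ := clockLaw n) B hAm
  rw [h2] at h3
  have hAv : clockLaw n A = _ := clockLaw_marginal hx p
  have hBv : clockLaw n B = _ := clockLaw_marginal hy0 p
  refine h1.trans ?_
  rw [ENNReal.eq_sub_of_add_eq (measure_ne_top _ _) h3, hAv, hBv, hysum,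
    ← ENNReal.ofReal_sub _ (div_nonneg (hx p) hM0)]
  refine ENNReal.ofReal_le_ofReal ?_
  have hyp : y p = x p + δ := by simp [hy]
  rw [hyp, sub_le_iff_le_add, add_div, add_comm]
  gcongr
  · exact hx p
  · linarith

end CorrSampling
end

noncomputable section
namespace CorrSampling

/-! ### Hashing -/

lemma unifFin_singleton (M : ℕ) (h : Fin M) :
    unifFin M {h} = ENNReal.ofReal (1 / M) := by
  have hM : 0 < M := Fin.pos h
  rw [unifFin, ProbabilityTheory.uniformOn_univ, Measure.count_singleton, Fintype.card_fin,
    ENNReal.ofReal_div_of_pos (by exact_mod_cast hM)]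
  simp

lemma isProbabilityMeasure_unifFin {M : ℕ} (hM : 0 < M) : IsProbabilityMeasure (unifFin M) :=
  ProbabilityTheory.isProbabilityMeasure_uniformOn Set.finite_univ ⟨⟨0, hM⟩, trivial⟩

lemma pi_unifFin_eq {M : ℕ} (hM : 0 < M) {N : ℕ} (i : Fin N) (h : Fin M) :
    (Measure.pi fun _ : Fin N => unifFin M) {C | C i = h} = ENNReal.ofReal (1 / M) := by
  have := isProbabilityMeasure_unifFin hM
  rw [← unifFin_singleton M h, ← (measurePreserving_eval (fun _ : Fin N => unifFin M)
    i).measure_preimage (MeasurableSet.singleton h).nullMeasurableSet]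
  rfl

lemma pi_unifFin_eq_eq {M : ℕ} (hM : 0 < M) {N : ℕ} {i j : Fin N} (hij : i ≠ j) (h : Fin M) :
    (Measure.pi fun _ : Fin N => unifFin M) {C | C i = h ∧ C j = h}
      = ENNReal.ofReal (1 / M) * ENNReal.ofReal (1 / M) := by
  have := isProbabilityMeasure_unifFin hM
  have e : {C : Fin N → Fin M | C i = h ∧ C j = h} =
      Set.univ.pi fun l => if l = i ∨ l = j then {h} else Set.univ := by
    ext C
    simp only [Set.mem_ofPred_eq, Set.mem_univ_pi]
    constructor
    · rintro ⟨h1, h2⟩ l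
      split_ifs with hl
      · rcases hl with rfl | rfl <;> assumption
      · trivial
    · intro H
      exact ⟨by simpa using H i, by simpa using H j⟩
  rw [e, Measure.pi_pi]
  have e2 : ∀ l : Fin N, unifFin M (if l = i ∨ l = j then {h} else Set.univ)
      = if l ∈ ({i, j} : Finset (Fin N)) then ENNReal.ofReal (1 / M) else 1 := by
    intro l
    by_cases hl : l = i ∨ l = j
    · simp [hl, unifFin_singleton]
    · simp [hl]
  simp_rw [e2]
  rw [Finset.prod_ite_mem, Finset.univ_inter, Finset.prod_pair hij]

lemma pi_unifFin_collision_le {M : ℕ} (hM : 0 < M) {N : ℕ} {i j : Fin N} (hij : i ≠ j) :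
    (Measure.pi fun _ : Fin N => unifFin M) {C | C i = C j} ≤ ENNReal.ofReal (1 / M) := by
  have e : {C : Fin N → Fin M | C i = C j} ⊆ ⋃ h ∈ (Finset.univ : Finset (Fin M)),
      {C | C i = h ∧ C j = h} := by
    intro C hC
    simp only [Finset.mem_univ, Set.iUnion_true, Set.mem_iUnion]
    exact ⟨C i, rfl, Eq.symm hC⟩
  refine (measure_mono e).trans ((measure_biUnion_finset_le _ _).trans ?_)
  simp_rw [pi_unifFin_eq_eq hM hij]
  rw [Finset.sum_const, Finset.card_univ, Fintype.card_fin, nsmul_eq_mul, ← mul_assoc,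
    ← ENNReal.ofReal_natCast, ← ENNReal.ofReal_mul (by positivity),
    mul_one_div_cancel (by exact_mod_cast hM.ne'), ENNReal.ofReal_one, one_mul]

/-- The hashes and the buckets. -/
abbrev HashFuns (n m : ℕ) : Type :=
  (Fin m → Fin (m ^ 3)) × (Fin n → Fin (m ^ 3)) × (Fin n → Fin m)

/-- The distribution of the hashes and the buckets. -/
def hashFunsLaw (n m : ℕ) : Measure (HashFuns n m) :=
  (Measure.pi fun _ => unifFin (m ^ 3)).prod <|
  (Measure.pi fun _ => unifFin (m ^ 3)).prod (Measure.pi fun _ => unifFin m)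

lemma isProbabilityMeasure_hashFunsLaw (n : ℕ) {m : ℕ} (hm : 0 < m) :
    IsProbabilityMeasure (hashFunsLaw n m) := by
  have := isProbabilityMeasure_unifFin hm
  have := isProbabilityMeasure_unifFin (pow_pos hm 3)
  unfold hashFunsLaw
  infer_instance

lemma isProbabilityMeasure_hashLaw (n : ℕ) {m : ℕ} (hm : 0 < m) :
    IsProbabilityMeasure (hashLaw n m) := by
  have := isProbabilityMeasure_unifFin hm
  have := isProbabilityMeasure_unifFin (pow_pos hm 3)
  unfold hashLaw
  infer_instance

/-- The discrete factors allow equality, but F is not assumed measurable in σ and τ, so only an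
inequality is available; it is the direction needed. -/
lemma lintegral_hashLaw_le (n : ℕ) {m : ℕ} (hm : 0 < m) (F : HashSeed n m → ENNReal) :
    ∫⁻ ρ, F ρ ∂hashLaw n m ≤ ∫⁻ φ, ∫⁻ σ, ∫⁻ τ, F (φ.1, φ.2.1, φ.2.2, σ, τ)
      ∂unifIcc 0 (1 / 10) ∂unifIcc 0 (1 / 10) ∂hashFunsLaw n m := by
  have := isProbabilityMeasure_unifFin hm
  have := isProbabilityMeasure_unifFin (pow_pos hm 3)
  unfold hashFunsLaw
  refine le_trans ?_ (lintegral_prod _ Measurable.of_discrete.aemeasurable).ge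
  refine (lintegral_prod_le _).trans (lintegral_mono fun R => ?_)
  refine le_trans ?_ (lintegral_prod _ Measurable.of_discrete.aemeasurable).ge
  refine (lintegral_prod_le _).trans (lintegral_mono fun C => ?_)
  refine (lintegral_prod_le _).trans (lintegral_mono fun B => ?_)
  exact lintegral_prod_le _

/-! ### Failure events that do not involve σ and τ, and their probabilities. -/

variable {n m : ℕ}

/-- A collision among the buckets and the coordinates above `1/10`. -/
def BadHash (x : Fin n → ℝ) (φ : HashFuns n m) : Prop :=
  (∃ b b', b ≠ b' ∧ φ.1 b = φ.1 b') ∨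
  (∃ i j, i ≠ j ∧ 1 / 10 < x i ∧ 1 / 10 < x j ∧ φ.2.1 i = φ.2.1 j) ∨
  (∃ i b, 1 / 10 < x i ∧ φ.2.1 i = φ.1 b)

/-- The total weight of the pairs of coordinates in `s` that share a bucket. -/
def pairWeight (s : Finset (Fin n)) (x : Fin n → ℝ) (B : Fin n → Fin m) : ℝ :=
  ∑ i ∈ s, ∑ j ∈ s.erase i, if B i = B j then x i * x j else 0

/-- The coordinates of weight at most `1/5`. -/
def lightSet (x : Fin n → ℝ) : Finset (Fin n) :=
  open Classical in Finset.univ.filter fun i => 0 < x i ∧ x i ≤ 1 / 5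

/-- The coordinates of weight more than `1/10`. -/
def weightySet (x : Fin n → ℝ) : Finset (Fin n) :=
  open Classical in Finset.univ.filter fun i => 1 / 10 < x i

/-- Some bucket contains light coordinates of large total weight. -/
def BadBuckets (x : Fin n → ℝ) (φ : HashFuns n m) : Prop :=
  63 / 100 ≤ pairWeight (lightSet x) x φ.2.2

lemma sum_light_le {k : ℕ} {x : Fin n → ℝ} (hx : x ∈ hypersimplex n k) (s : Finset (Fin n)) :
    ∑ i ∈ s, x i ≤ k := by
  refine le_trans ?_ hx.2
  rw [l1_of_nonneg fun i => (hx.1 i).1]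
  exact Finset.sum_le_sum_of_subset_of_nonneg (Finset.subset_univ _) fun i _ _ => (hx.1 i).1

lemma card_weightySet_le {k : ℕ} {x : Fin n → ℝ} (hx : x ∈ hypersimplex n k) :
    ((weightySet x).card : ℝ) ≤ 10 * k := by
  have h : ∑ i ∈ weightySet x, (1 / 10 : ℝ) ≤ ∑ i ∈ weightySet x, x i :=
    Finset.sum_le_sum fun i hi => by
      simp only [weightySet, Finset.mem_filter] at hi
      exact hi.2.le
  have := h.trans (sum_light_le hx _)
  rw [Finset.sum_const, nsmul_eq_mul] at this
  linarith

/-- Markov's inequality for the pair weight: two coordinates share a bucket with probability at most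
1/m, so the mean is at most (∑ x)²/m ≤ k²/m, and 100/63 ≤ 2. -/
lemma hashFunsLaw_badBuckets_le (hm : 0 < m) {k : ℕ} {x : Fin n → ℝ} (hx : x ∈ hypersimplex n k) :
    hashFunsLaw n m {φ | BadBuckets x φ} ≤ ENNReal.ofReal (2 * k ^ 2 / m) := by
  have := isProbabilityMeasure_unifFin hm
  have := isProbabilityMeasure_unifFin (pow_pos hm 3)
  set s := lightSet x with hs
  have h0 := fun i => (hx.1 i).1
  have e : {φ : HashFuns n m | BadBuckets x φ} = Prod.snd ⁻¹' (Prod.snd ⁻¹'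
      {B | 63 / 100 ≤ pairWeight s x B}) := rfl
  rw [e, hashFunsLaw, measurePreserving_snd.measure_preimage
    MeasurableSet.of_discrete.nullMeasurableSet, measurePreserving_snd.measure_preimage
    MeasurableSet.of_discrete.nullMeasurableSet]
  set π := Measure.pi fun _ : Fin n => unifFin m
  have hsub : {B : Fin n → Fin m | 63 / 100 ≤ pairWeight s x B} ⊆
      {B | ENNReal.ofReal (63 / 100) ≤ ENNReal.ofReal (pairWeight s x B)} :=
    fun B hB => ENNReal.ofReal_le_ofReal hB
  have hmarkov := mul_meas_ge_le_lintegral (μ := π)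
    (f := fun B => ENNReal.ofReal (pairWeight s x B)) Measurable.of_discrete
    (ENNReal.ofReal (63 / 100))
  have hint : ∫⁻ B, ENNReal.ofReal (pairWeight s x B) ∂π ≤ ENNReal.ofReal (k ^ 2 / m) := by
    have e1 : ∀ B, ENNReal.ofReal (pairWeight s x B) = ∑ i ∈ s, ∑ j ∈ s.erase i,
        ENNReal.ofReal (x i * x j) * {B : Fin n → Fin m | B i = B j}.indicator 1 B := by
      intro B
      unfold pairWeight
      rw [ENNReal.ofReal_sum_of_nonneg fun i _ => Finset.sum_nonneg fun j _ => by
        split_ifs <;> first | exact le_rfl | exact mul_nonneg (h0 _) (h0 _)]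
      refine Finset.sum_congr rfl fun i _ => ?_
      rw [ENNReal.ofReal_sum_of_nonneg fun j _ => by
        split_ifs <;> first | exact le_rfl | exact mul_nonneg (h0 _) (h0 _)]
      refine Finset.sum_congr rfl fun j _ => ?_
      by_cases h : B i = B j <;> simp [h]
    simp_rw [e1]
    rw [lintegral_finsetSum _ fun _ _ => Measurable.of_discrete]
    calc _ ≤ ∑ i ∈ s, ∑ j ∈ s.erase i, ENNReal.ofReal (x i * x j * (1 / m)) := by
          refine Finset.sum_le_sum fun i _ => ?_
          rw [lintegral_finsetSum _ fun _ _ => Measurable.of_discrete]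
          refine Finset.sum_le_sum fun j hj => ?_
          rw [lintegral_const_mul _ Measurable.of_discrete,
            lintegral_indicator_one MeasurableSet.of_discrete,
            ENNReal.ofReal_mul (mul_nonneg (h0 i) (h0 j))]
          gcongr
          exact pi_unifFin_collision_le hm (Finset.ne_of_mem_erase hj).symm
      _ = ENNReal.ofReal (∑ i ∈ s, ∑ j ∈ s.erase i, x i * x j * (1 / m)) := by
          have hn : ∀ i j, 0 ≤ x i * x j * (1 / m) := fun i j =>
            mul_nonneg (mul_nonneg (h0 i) (h0 j)) (by positivity)
          rw [ENNReal.ofReal_sum_of_nonneg fun i _ => Finset.sum_nonneg fun j _ => hn i j]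
          exact Finset.sum_congr rfl fun i _ =>
            (ENNReal.ofReal_sum_of_nonneg fun j _ => hn i j).symm
      _ ≤ ENNReal.ofReal (k ^ 2 / m) := by
          refine ENNReal.ofReal_le_ofReal ?_
          calc _ ≤ ∑ i ∈ s, ∑ j ∈ s, x i * x j * (1 / m) := by
                refine Finset.sum_le_sum fun i _ =>
                  Finset.sum_le_sum_of_subset_of_nonneg (Finset.erase_subset _ _) fun j _ _ => ?_
                exact mul_nonneg (mul_nonneg (h0 i) (h0 j)) (by positivity)
            _ = (∑ i ∈ s, x i) ^ 2 / m := by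
                simp_rw [← Finset.sum_mul, ← Finset.mul_sum]
                rw [← Finset.sum_mul]
                ring
            _ ≤ k ^ 2 / m := by
                gcongr
                · exact Finset.sum_nonneg fun i _ => h0 i
                · exact sum_light_le hx s
  calc π {B | 63 / 100 ≤ pairWeight s x B}
      ≤ ENNReal.ofReal (100 / 63) * (ENNReal.ofReal (63 / 100) *
          π {B | ENNReal.ofReal (63 / 100) ≤ ENNReal.ofReal (pairWeight s x B)}) := by
        rw [← mul_assoc, ← ENNReal.ofReal_mul (by norm_num)]
        norm_num
        exact measure_mono (by simpa using hsub)
    _ ≤ ENNReal.ofReal (100 / 63) * ENNReal.ofReal (k ^ 2 / m) := by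
        gcongr
        exact hmarkov.trans hint
    _ ≤ _ := by
        rw [← ENNReal.ofReal_mul (by norm_num)]
        refine ENNReal.ofReal_le_ofReal ?_
        rw [mul_div_assoc]
        gcongr
        norm_num

/-- A union bound: at most 10k ≤ m coordinates exceed 1/10, so each of the three kinds of pairs has
at most m² members, each colliding with probability at most 1/m³. -/
lemma hashFunsLaw_badHash_le (hm : 0 < m) {k : ℕ} (hkm : 10 * k ≤ m) {x : Fin n → ℝ}
    (hx : x ∈ hypersimplex n k) :
    hashFunsLaw n m {φ | BadHash x φ} ≤ ENNReal.ofReal (4 / m) := by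
  have := isProbabilityMeasure_unifFin hm
  have hM := pow_pos hm 3
  have := isProbabilityMeasure_unifFin hM
  have := isProbabilityMeasure_hashFunsLaw n hm
  set s := weightySet x with hs
  set ε := ENNReal.ofReal (1 / (m ^ 3 : ℕ)) with hε
  have h1 : ∀ b b' : Fin m, b ≠ b' → hashFunsLaw n m {φ | φ.1 b = φ.1 b'} ≤ ε := by
    intro b b' hb
    have e : {φ : HashFuns n m | φ.1 b = φ.1 b'} = Prod.fst ⁻¹' {R | R b = R b'} := rfl
    rw [e, hashFunsLaw, measurePreserving_fst.measure_preimage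
      MeasurableSet.of_discrete.nullMeasurableSet]
    exact pi_unifFin_collision_le hM hb
  have h2 : ∀ i j : Fin n, i ≠ j → hashFunsLaw n m {φ | φ.2.1 i = φ.2.1 j} ≤ ε := by
    intro i j hij
    have e : {φ : HashFuns n m | φ.2.1 i = φ.2.1 j} = Prod.snd ⁻¹' (Prod.fst ⁻¹'
      {C | C i = C j}) := rfl
    rw [e, hashFunsLaw, measurePreserving_snd.measure_preimage
      MeasurableSet.of_discrete.nullMeasurableSet, measurePreserving_fst.measure_preimage
      MeasurableSet.of_discrete.nullMeasurableSet]
    exact pi_unifFin_collision_le hM hij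
  have h3 : ∀ (i : Fin n) (b : Fin m), hashFunsLaw n m {φ | φ.2.1 i = φ.1 b} ≤ ε := by
    intro i b
    rw [hashFunsLaw, Measure.prod_apply MeasurableSet.of_discrete]
    have e : ∀ R : Fin m → Fin (m ^ 3), (Prod.mk R ⁻¹' {φ : HashFuns n m | φ.2.1 i = φ.1 b})
        = Prod.fst ⁻¹' {C | C i = R b} := fun R => rfl
    simp_rw [e]
    have e2 : ∀ R : Fin m → Fin (m ^ 3), ((Measure.pi fun _ : Fin n => unifFin (m ^ 3)).prod
        (Measure.pi fun _ : Fin n => unifFin m)) (Prod.fst ⁻¹' {C | C i = R b}) = ε := by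
      intro R
      rw [measurePreserving_fst.measure_preimage MeasurableSet.of_discrete.nullMeasurableSet]
      exact pi_unifFin_eq hM i (R b)
    simp_rw [e2]
    simp
  have hsub : {φ : HashFuns n m | BadHash x φ} ⊆
      (⋃ q ∈ (Finset.univ : Finset (Fin m × Fin m)).filter (fun q => q.1 ≠ q.2),
        {φ | φ.1 q.1 = φ.1 q.2}) ∪
      ((⋃ q ∈ (s ×ˢ s).filter (fun q => q.1 ≠ q.2), {φ | φ.2.1 q.1 = φ.2.1 q.2}) ∪
      (⋃ q ∈ s ×ˢ (Finset.univ : Finset (Fin m)), {φ | φ.2.1 q.1 = φ.1 q.2})) := by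
    rintro φ (⟨b, b', hb, h⟩ | ⟨i, j, hij, hi, hj, h⟩ | ⟨i, b, hi, h⟩)
    · left
      simp only [Set.mem_iUnion]
      exact ⟨(b, b'), by simpa using hb, h⟩
    · right; left
      simp only [Set.mem_iUnion]
      exact ⟨(i, j), by simp [hs, weightySet, hij]; exact ⟨by simpa using hi, by simpa using hj⟩, h⟩
    · right; right
      simp only [Set.mem_iUnion]
      exact ⟨(i, b), by simp [hs, weightySet]; simpa using hi, h⟩
  have hb1 : hashFunsLaw n m (⋃ q ∈ (Finset.univ : Finset (Fin m × Fin m)).filter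
      (fun q => q.1 ≠ q.2), {φ | φ.1 q.1 = φ.1 q.2}) ≤ (m * m : ℕ) * ε := by
    refine (measure_biUnion_finset_le _ _).trans ((Finset.sum_le_card_nsmul _ _ ε
      fun q hq => h1 _ _ (Finset.mem_filter.mp hq).2).trans ?_)
    rw [nsmul_eq_mul]
    gcongr
    exact (Finset.card_filter_le _ _).trans (by simp)
  have hb2 : hashFunsLaw n m (⋃ q ∈ (s ×ˢ s).filter (fun q => q.1 ≠ q.2),
      {φ | φ.2.1 q.1 = φ.2.1 q.2}) ≤ (s.card * s.card : ℕ) * ε := by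
    refine (measure_biUnion_finset_le _ _).trans ((Finset.sum_le_card_nsmul _ _ ε
      fun q hq => h2 _ _ (Finset.mem_filter.mp hq).2).trans ?_)
    rw [nsmul_eq_mul]
    gcongr
    exact (Finset.card_filter_le _ _).trans (by simp)
  have hb3 : hashFunsLaw n m (⋃ q ∈ s ×ˢ (Finset.univ : Finset (Fin m)),
      {φ | φ.2.1 q.1 = φ.1 q.2}) ≤ (s.card * m : ℕ) * ε := by
    refine (measure_biUnion_finset_le _ _).trans ((Finset.sum_le_card_nsmul _ _ ε
      fun q _ => h3 _ _).trans ?_)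
    rw [nsmul_eq_mul]
    gcongr
    simp
  have hsc : s.card ≤ m := by
    have := card_weightySet_le hx
    have h10 : s.card ≤ 10 * k := by exact_mod_cast this
    exact h10.trans hkm
  calc _ ≤ (m * m : ℕ) * ε + ((s.card * s.card : ℕ) * ε + (s.card * m : ℕ) * ε) :=
        (measure_mono hsub).trans ((measure_union_le _ _).trans (add_le_add hb1
          ((measure_union_le _ _).trans (add_le_add hb2 hb3))))
    _ ≤ (m * m : ℕ) * ε + ((m * m : ℕ) * ε + (m * m : ℕ) * ε) := by gcongr
    _ ≤ (4 * (m * m) : ℕ) * ε := by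
        rw [← add_mul, ← add_mul]
        gcongr
        norm_cast
        omega
    _ = _ := by
        rw [hε, ← ENNReal.ofReal_natCast, ← ENNReal.ofReal_mul (by positivity)]
        congr 1
        have : (m : ℝ) ≠ 0 := by exact_mod_cast hm.ne'
        push_cast
        field_simp

lemma hashFunsLaw_bad_le (hm : 0 < m) {k : ℕ} (hk : 2 ≤ k) (hkm : 10 * k ≤ m) {x : Fin n → ℝ}
    (hx : x ∈ hypersimplex n k) :
    hashFunsLaw n m {φ | BadHash x φ ∨ BadBuckets x φ} ≤ ENNReal.ofReal (3 * k ^ 2 / m) := by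
  refine (measure_union_le _ _).trans ((add_le_add (hashFunsLaw_badHash_le hm hkm hx)
    (hashFunsLaw_badBuckets_le hm hx)).trans ?_)
  rw [← ENNReal.ofReal_add (by positivity) (by positivity), ← add_div]
  refine ENNReal.ofReal_le_ofReal ?_
  have : (2 : ℝ) ≤ k := by exact_mod_cast hk
  gcongr
  nlinarith

end CorrSampling
end

noncomputable section
namespace CorrSampling

/-! ### The composed algorithm for fixed seeds -/

variable {n m : ℕ}

lemma mem_smallSet {σ : ℝ} {x : Fin n → ℝ} {i : Fin n} :
    i ∈ smallSet σ x ↔ 0 < x i ∧ x i ≤ 1 / 10 + σ := by simp [smallSet]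

lemma mem_largeSet {σ : ℝ} {x : Fin n → ℝ} {i : Fin n} :
    i ∈ largeSet σ x ↔ 1 / 10 + σ < x i := by simp [largeSet]

lemma mem_smallIn {B : Fin n → Fin m} {σ : ℝ} {x : Fin n → ℝ} {b : Fin m} {i : Fin n} :
    i ∈ smallIn B σ x b ↔ (0 < x i ∧ x i ≤ 1 / 10 + σ) ∧ B i = b := by
  simp [smallIn, mem_smallSet]

/-- The restriction of `x` to `s`. -/
def mask (s : Finset (Fin n)) (x : Fin n → ℝ) : Fin n → ℝ := fun i => if i ∈ s then x i else 0

/-- The mass of the small coordinates of a bucket. -/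
def bucketMass (B : Fin n → Fin m) (σ : ℝ) (x : Fin n → ℝ) (b : Fin m) : ℝ :=
  ∑ i ∈ smallIn B σ x b, x i

/-- The representative of a bucket, for given clocks. -/
abbrev repOf (r : Fin n → ℝ) (B : Fin n → Fin m) (σ : ℝ) (x : Fin n → ℝ) (b : Fin m) :
    Finset (Fin n) := rep (clockRound r) B σ x b

lemma bucketMass_nonneg (B : Fin n → Fin m) (σ : ℝ) (x : Fin n → ℝ) (b : Fin m) :
    0 ≤ bucketMass B σ x b :=
  Finset.sum_nonneg fun _ hi => (mem_smallIn.mp hi).1.1.le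

lemma sum_mask_smallIn (B : Fin n → Fin m) (σ : ℝ) (x : Fin n → ℝ) (b : Fin m) :
    ∑ i, mask (smallIn B σ x b) x i = bucketMass B σ x b := by
  simp [mask, bucketMass, Finset.sum_ite_mem]

lemma mask_nonneg (B : Fin n → Fin m) (σ : ℝ) (x : Fin n → ℝ) (b : Fin m) (i : Fin n) :
    0 ≤ mask (smallIn B σ x b) x i := by
  unfold mask
  split_ifs with h
  exacts [(mem_smallIn.mp h).1.1.le, le_rfl]

/-- The empty bucket needs no separate treatment, since `clockRound` selects positive entries only.
-/
lemma repOf_eq (r : Fin n → ℝ) (B : Fin n → Fin m) (σ : ℝ) (x : Fin n → ℝ) (b : Fin m) :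
    repOf r B σ x b = clockRound r (mask (smallIn B σ x b) x) := by
  unfold repOf rep
  split_ifs with h
  · rw [← clockRound_smul r (mask (smallIn B σ x b) x) h]
    congr 1
    ext i
    unfold mask
    split_ifs <;> simp
  · symm
    rw [Finset.eq_empty_iff_forall_notMem]
    intro i hi
    have h1 := (mem_clockRound.mp hi).1
    have := (Finset.single_le_sum (fun i _ => mask_nonneg B σ x b i) (Finset.mem_univ i)).trans_eq
      (sum_mask_smallIn B σ x b)
    exact h (h1.trans_le this)

lemma repOf_subset (r : Fin n → ℝ) (B : Fin n → Fin m) (σ : ℝ) (x : Fin n → ℝ) (b : Fin m) :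
    repOf r B σ x b ⊆ smallIn B σ x b := by
  intro i hi
  rw [repOf_eq] at hi
  have h := (mem_clockRound.mp hi).1
  unfold mask at h
  split_ifs at h with h'
  exacts [h', absurd h (lt_irrefl _)]

lemma card_repOf_le (r : Fin n → ℝ) (B : Fin n → Fin m) (σ : ℝ) (x : Fin n → ℝ) (b : Fin m) :
    (repOf r B σ x b).card ≤ 1 := by
  rw [repOf_eq]
  exact Finset.card_le_one.mpr fun i hi j hj => clockRound_unique hi hj

lemma card_repOf_of_pos (r : Fin n → ℝ) (B : Fin n → Fin m) (σ : ℝ) (x : Fin n → ℝ) (b : Fin m)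
    (h : 0 < bucketMass B σ x b) : (repOf r B σ x b).card = 1 := by
  refine le_antisymm (card_repOf_le r B σ x b) (Finset.card_pos.mpr ?_)
  rw [repOf_eq]
  refine exists_mem_clockRound r ?_
  by_contra! hc
  rw [← sum_mask_smallIn] at h
  exact absurd (Finset.sum_nonpos fun i _ => hc i) h.not_ge

/-- The large entries of `x`. -/
def largePart (σ : ℝ) (x : Fin n → ℝ) : Fin n → ℝ := fun i => if 1 / 10 + σ < x i then x i else 0

/-- The small entries of `x`. -/
def smallPart (σ : ℝ) (x : Fin n → ℝ) : Fin n → ℝ := fun i => if 1 / 10 + σ < x i then 0 else x i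

/-- The sum of `ℓ` over the preimage of `h` under `C` and of `s` over its preimage under
`R ∘ B`. -/
def hatOf (φ : HashFuns n m) (ℓ s : Fin n → ℝ) (h : Fin (m ^ 3)) : ℝ :=
  ∑ i, ((if φ.2.1 i = h then ℓ i else 0) + if φ.1 (φ.2.2 i) = h then s i else 0)

/-- `x̂` without reference to representatives. -/
def hat (φ : HashFuns n m) (σ : ℝ) (x : Fin n → ℝ) : Fin (m ^ 3) → ℝ :=
  hatOf φ (largePart σ x) (smallPart σ x)

lemma bucketMass_eq_sum {σ : ℝ} {x : Fin n → ℝ} (hx : ∀ i, 0 ≤ x i)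
    (B : Fin n → Fin m) (b : Fin m) :
    bucketMass B σ x b = ∑ i, if B i = b then smallPart σ x i else 0 := by
  rw [← sum_mask_smallIn]
  refine Finset.sum_congr rfl fun i _ => ?_
  simp only [mask, mem_smallIn, smallPart]
  have := hx i
  split_ifs <;> grind

lemma hat_eq {σ : ℝ} {x : Fin n → ℝ} (hx : ∀ i, 0 ≤ x i) (φ : HashFuns n m)
    (h : Fin (m ^ 3)) :
    hat φ σ x h = ∑ i ∈ (largeSet σ x).filter (fun i => φ.2.1 i = h), x i +
      ∑ b ∈ Finset.univ.filter (fun b => φ.1 b = h), bucketMass φ.2.2 σ x b := by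
  unfold hat hatOf
  rw [Finset.sum_add_distrib]
  congr 1
  · rw [Finset.sum_filter, largeSet, Finset.sum_filter]
    refine Finset.sum_congr rfl fun i _ => ?_
    unfold largePart
    split_ifs <;> simp_all
  · simp_rw [bucketMass_eq_sum hx]
    rw [Finset.sum_comm]
    refine Finset.sum_congr rfl fun i _ => ?_
    rw [Finset.sum_ite_eq]
    simp

/-- A bucket with positive mass has exactly one representative, which carries all of that mass to
R_b. Hence x̂ does not depend on the clocks, so tree rounding of x̂ is independent of the choice of
representatives. -/
lemma hatVec_eq {σ : ℝ} {x : Fin n → ℝ} (hx : ∀ i, 0 ≤ x i) (r : Fin n → ℝ)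
    (φ : HashFuns n m) (τ : ℝ) :
    hatVec (clockRound r) ((φ.1, φ.2.1, φ.2.2, σ, τ) : HashSeed n m) x = hat φ σ x := by
  obtain ⟨R, C, B⟩ := φ
  ext h
  rw [hat_eq hx]
  simp only [hatVec]
  have hrep : ∀ i b, i ∈ rep (clockRound r) B σ x b → i ∈ smallIn B σ x b :=
    fun i b hi => repOf_subset r B σ x b hi
  have key : ∀ i, (if 0 < compressed (clockRound r) B σ x i ∧
        (if i ∈ rep (clockRound r) B σ x (B i) then R (B i) else C i) = h then
          compressed (clockRound r) B σ x i else 0)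
      = (if i ∈ largeSet σ x then (if C i = h then x i else 0) else 0) +
        if i ∈ rep (clockRound r) B σ x (B i) then
          (if R (B i) = h then bucketMass B σ x (B i) else 0) else 0 := by
    intro i
    have h0 := hx i
    have hm := bucketMass_nonneg B σ x (B i)
    unfold compressed
    simp only [mem_smallSet, mem_largeSet]
    change (if 0 < (if 0 < x i ∧ x i ≤ 1 / 10 + σ then
      if i ∈ rep (clockRound r) B σ x (B i) then bucketMass B σ x (B i) else 0 else x i) ∧ _ then
        (if 0 < x i ∧ x i ≤ 1 / 10 + σ then
      if i ∈ rep (clockRound r) B σ x (B i) then bucketMass B σ x (B i) else 0 else x i) else 0) = _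
    by_cases hr : i ∈ rep (clockRound r) B σ x (B i)
    · have hs := mem_smallIn.mp (hrep i _ hr)
      simp only [hr, hs.1, and_self, if_true, hs.1.2.not_gt, if_false, zero_add]
      split_ifs <;> grind
    · simp only [hr, if_false, add_zero]
      split_ifs <;> grind
  rw [Finset.sum_filter, Finset.sum_congr rfl fun i _ => key i, Finset.sum_add_distrib]
  congr 1
  · rw [Finset.sum_ite_mem, Finset.univ_inter, Finset.sum_filter]
  · rw [← Finset.sum_fiberwise (g := B), Finset.sum_filter]
    refine Finset.sum_congr rfl fun b _ => ?_
    have e : ∑ i ∈ Finset.univ.filter (fun i => B i = b), (if i ∈ rep (clockRound r) B σ x (B i) then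
          (if R (B i) = h then bucketMass B σ x (B i) else 0) else 0)
        = ∑ i ∈ repOf r B σ x b, if R b = h then bucketMass B σ x b else 0 := by
      rw [Finset.sum_filter, ← Finset.univ_inter (repOf r B σ x b), ← Finset.sum_ite_mem]
      refine Finset.sum_congr rfl fun i _ => ?_
      by_cases hib : B i = b
      · subst hib
        simp [repOf]
      · have : i ∉ repOf r B σ x b := fun hi => hib (mem_smallIn.mp (hrep i b hi)).2
        simp [hib, this]
    rw [e, Finset.sum_const]
    rcases (bucketMass_nonneg B σ x b).eq_or_lt with h0 | h0
    · simp [← h0]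
    · rw [card_repOf_of_pos r B σ x b h0, one_nsmul]

lemma sum_hatOf (φ : HashFuns n m) (ℓ s : Fin n → ℝ) :
    ∑ h, hatOf φ ℓ s h = ∑ i, (ℓ i + s i) := by
  unfold hatOf
  rw [Finset.sum_comm]
  refine Finset.sum_congr rfl fun i _ => ?_
  rw [Finset.sum_add_distrib]
  simp

lemma largePart_add_smallPart (σ : ℝ) (x : Fin n → ℝ) (i : Fin n) :
    largePart σ x i + smallPart σ x i = x i := by
  unfold largePart smallPart
  split_ifs <;> simp

lemma sum_hat (φ : HashFuns n m) (σ : ℝ) (x : Fin n → ℝ) : ∑ h, hat φ σ x h = ∑ i, x i := by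
  simp_rw [hat, sum_hatOf, largePart_add_smallPart]

lemma hat_nonneg (φ : HashFuns n m) (σ : ℝ) {x : Fin n → ℝ} (hx : ∀ i, 0 ≤ x i)
    (h : Fin (m ^ 3)) : 0 ≤ hat φ σ x h := by
  unfold hat hatOf
  refine Finset.sum_nonneg fun i _ => ?_
  have := hx i
  unfold largePart smallPart
  split_ifs <;> simp [this]

/-- `hatOf` is linear and sends every entry to a single position, so it cannot increase the ℓ₁ norm.
-/
lemma l1_hatOf_sub_le (φ : HashFuns n m) (ℓ s ℓ' s' : Fin n → ℝ) :
    l1 (hatOf φ ℓ s - hatOf φ ℓ' s') ≤ l1 (ℓ - ℓ') + l1 (s - s') := by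
  have h1 : ∀ h, |(hatOf φ ℓ s - hatOf φ ℓ' s') h| ≤
      hatOf φ (fun i => |ℓ i - ℓ' i|) (fun i => |s i - s' i|) h := by
    intro h
    rw [Pi.sub_apply, hatOf, hatOf, ← Finset.sum_sub_distrib]
    refine (Finset.abs_sum_le_sum_abs _ _).trans (Finset.sum_le_sum fun i _ => ?_)
    split_ifs
    · rw [add_sub_add_comm]; exact abs_add_le _ _
    · simp
    · simp
    · simp
  refine (Finset.sum_le_sum (s := Finset.univ) fun h _ => h1 h).trans_eq ?_
  rw [sum_hatOf, Finset.sum_add_distrib]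
  rfl

/-- The coordinates and representatives that are sent to position `h`. -/
def posSet (r : Fin n → ℝ) (φ : HashFuns n m) (σ : ℝ) (x : Fin n → ℝ) (h : Fin (m ^ 3)) :
    Finset (Fin n) :=
  (largeSet σ x).filter (fun i => φ.2.1 i = h) ∪
    (Finset.univ.filter fun b => φ.1 b = h).biUnion (repOf r φ.2.2 σ x)

/-! ### Failing runs, good runs, and the contents of the positions of x̂. -/

lemma composedRun_of_fail {A₁ A : (Fin n → ℝ) → Finset (Fin n)}
    {Aₖ : (Fin (m ^ 3) → ℝ) → Finset (Fin (m ^ 3))} {ρ : HashSeed n m} {x : Fin n → ℝ}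
    (h : Collision ρ x ∨ Heavy ρ x) : composedRun A₁ A Aₖ ρ x = A x := by
  simp [composedRun, h]

lemma composedRun_of_not_fail {r : Fin n → ℝ} {A : (Fin n → ℝ) → Finset (Fin n)}
    {Aₖ : (Fin (m ^ 3) → ℝ) → Finset (Fin (m ^ 3))} {φ : HashFuns n m} {σ τ : ℝ} {x : Fin n → ℝ}
    (hx : ∀ i, 0 ≤ x i)
    (h : ¬ (Collision (φ.1, φ.2.1, φ.2.2, σ, τ) x ∨ Heavy (φ.1, φ.2.1, φ.2.2, σ, τ) x)) :
    composedRun (clockRound r) A Aₖ (φ.1, φ.2.1, φ.2.2, σ, τ) x =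
      (Aₖ (hat φ σ x)).biUnion (posSet r φ σ x) := by
  rw [composedRun, if_neg h]
  simp only [hatVec_eq hx]
  ext i
  simp only [Finset.mem_union, Finset.mem_filter, Finset.mem_biUnion, Finset.mem_univ, true_and,
    posSet]
  constructor
  · rintro (⟨h1, h2⟩ | ⟨b, h1, h2⟩)
    · exact ⟨_, h2, Or.inl ⟨h1, rfl⟩⟩
    · exact ⟨_, h1, Or.inr ⟨b, rfl, h2⟩⟩
  · rintro ⟨_, h1, ⟨h2, rfl⟩ | ⟨b, rfl, h2⟩⟩
    · exact Or.inl ⟨h2, h1⟩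
    · exact Or.inr ⟨b, h1, h2⟩

/-- Neither a hash collision nor a heavy bucket. -/
def Good (φ : HashFuns n m) (σ τ : ℝ) (x : Fin n → ℝ) : Prop :=
  ¬ (Collision ((φ.1, φ.2.1, φ.2.2, σ, τ) : HashSeed n m) x ∨
    Heavy ((φ.1, φ.2.1, φ.2.2, σ, τ) : HashSeed n m) x)

lemma Good.card_le {φ : HashFuns n m} {σ τ : ℝ} {x : Fin n → ℝ} (hg : Good φ σ τ x)
    (h : Fin (m ^ 3)) : ((largeSet σ x).filter fun i => φ.2.1 i = h).card
      + (Finset.univ.filter fun b : Fin m => φ.1 b = h).card ≤ 1 := by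
  have := (not_or.mp hg).1
  simp only [Collision, not_exists, not_lt] at this
  exact this h

lemma Good.bucketMass_le {φ : HashFuns n m} {σ τ : ℝ} {x : Fin n → ℝ} (hg : Good φ σ τ x)
    (b : Fin m) : bucketMass φ.2.2 σ x b ≤ 1 - τ := by
  have := (not_or.mp hg).2
  simp only [Heavy, not_exists, not_lt] at this
  exact this b

lemma Good.hat_mem {φ : HashFuns n m} {σ τ : ℝ} {x : Fin n → ℝ} (hg : Good φ σ τ x)
    (hτ : 0 ≤ τ) (hx : ∀ i, 0 ≤ x i ∧ x i ≤ 1) (h : Fin (m ^ 3)) :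
    0 ≤ hat φ σ x h ∧ hat φ σ x h ≤ 1 := by
  refine ⟨hat_nonneg φ σ (fun i => (hx i).1) h, ?_⟩
  rw [hat_eq fun i => (hx i).1]
  have h1 := Finset.sum_le_card_nsmul ((largeSet σ x).filter fun i => φ.2.1 i = h) x 1
    fun i _ => (hx i).2
  have h2 := Finset.sum_le_card_nsmul (Finset.univ.filter fun b : Fin m => φ.1 b = h)
    (bucketMass φ.2.2 σ x) 1 fun b _ => (hg.bucketMass_le b).trans (by linarith)
  rw [nsmul_one] at h1 h2
  have h3 : ((((largeSet σ x).filter fun i => φ.2.1 i = h).card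
      + (Finset.univ.filter fun b : Fin m => φ.1 b = h).card : ℕ) : ℝ) ≤ 1 := by
    exact_mod_cast hg.card_le h
  push_cast at h3
  linarith

lemma Good.hat_large {φ : HashFuns n m} {σ τ : ℝ} {x : Fin n → ℝ} (hg : Good φ σ τ x)
    (hx : ∀ i, 0 ≤ x i) {i : Fin n} (hi : i ∈ largeSet σ x) : hat φ σ x (φ.2.1 i) = x i := by
  rw [hat_eq hx]
  have hc := hg.card_le (φ.2.1 i)
  have hmem : i ∈ (largeSet σ x).filter fun j => φ.2.1 j = φ.2.1 i := by simp [hi]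
  have h1 : 0 < ((largeSet σ x).filter fun j => φ.2.1 j = φ.2.1 i).card :=
    Finset.card_pos.mpr ⟨i, hmem⟩
  have h2 : (largeSet σ x).filter (fun j => φ.2.1 j = φ.2.1 i) = {i} :=
    Finset.eq_singleton_iff_unique_mem.mpr ⟨hmem, fun j hj =>
      Finset.card_le_one.mp (by omega) j hj i hmem⟩
  have h3 : (Finset.univ.filter fun b : Fin m => φ.1 b = φ.2.1 i) = ∅ :=
    Finset.card_eq_zero.mp (by omega)
  rw [h2, h3]
  simp

lemma Good.hat_bucket {φ : HashFuns n m} {σ τ : ℝ} {x : Fin n → ℝ} (hg : Good φ σ τ x)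
    (hx : ∀ i, 0 ≤ x i) (b : Fin m) : hat φ σ x (φ.1 b) = bucketMass φ.2.2 σ x b := by
  rw [hat_eq hx]
  have hc := hg.card_le (φ.1 b)
  have hmem : b ∈ Finset.univ.filter fun b' : Fin m => φ.1 b' = φ.1 b := by simp
  have h1 : 0 < (Finset.univ.filter fun b' : Fin m => φ.1 b' = φ.1 b).card :=
    Finset.card_pos.mpr ⟨b, hmem⟩
  have h2 : (Finset.univ.filter fun b' : Fin m => φ.1 b' = φ.1 b) = {b} :=
    Finset.eq_singleton_iff_unique_mem.mpr ⟨hmem, fun j hj =>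
      Finset.card_le_one.mp (by omega) j hj b hmem⟩
  have h3 : (largeSet σ x).filter (fun j => φ.2.1 j = φ.1 b) = ∅ :=
    Finset.card_eq_zero.mp (by omega)
  rw [h2, h3]
  simp

lemma card_biUnion_repOf_le (r : Fin n → ℝ) (φ : HashFuns n m) (σ : ℝ) (x : Fin n → ℝ)
    (s : Finset (Fin m)) : (s.biUnion (repOf r φ.2.2 σ x)).card ≤ s.card :=
  Finset.card_biUnion_le.trans ((Finset.sum_le_card_nsmul _ _ 1 fun b _ =>
    card_repOf_le r φ.2.2 σ x b).trans (by simp))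

lemma Good.card_posSet_le {φ : HashFuns n m} {σ τ : ℝ} {x : Fin n → ℝ} (hg : Good φ σ τ x)
    (r : Fin n → ℝ) (h : Fin (m ^ 3)) : (posSet r φ σ x h).card ≤ 1 :=
  (Finset.card_union_le _ _).trans ((add_le_add_right (card_biUnion_repOf_le r φ σ x _) _).trans
    (hg.card_le h))

lemma mem_posSet {r : Fin n → ℝ} {φ : HashFuns n m} {σ : ℝ} {x : Fin n → ℝ} {h : Fin (m ^ 3)}
    {i : Fin n} : i ∈ posSet r φ σ x h ↔ (i ∈ largeSet σ x ∧ φ.2.1 i = h) ∨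
      (i ∈ repOf r φ.2.2 σ x (φ.2.2 i) ∧ φ.1 (φ.2.2 i) = h) := by
  simp only [posSet, Finset.mem_union, Finset.mem_filter, Finset.mem_biUnion, Finset.mem_univ,
    true_and]
  refine or_congr_right ⟨?_, fun ⟨h1, h2⟩ => ⟨_, h2, h1⟩⟩
  rintro ⟨b, h1, h2⟩
  have := (mem_smallIn.mp (repOf_subset r φ.2.2 σ x b h2)).2
  subst this
  exact ⟨h2, h1⟩

lemma notMem_largeSet_of_mem_repOf {r : Fin n → ℝ} {B : Fin n → Fin m} {σ : ℝ} {x : Fin n → ℝ}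
    {b : Fin m} {i : Fin n} (h : i ∈ repOf r B σ x b) : i ∉ largeSet σ x := fun hl =>
  (mem_largeSet.mp hl).not_ge (mem_smallIn.mp (repOf_subset r B σ x b h)).1.2

lemma posSet_disjoint (r : Fin n → ℝ) (φ : HashFuns n m) (σ : ℝ) (x : Fin n → ℝ)
    {h h' : Fin (m ^ 3)} (hh : h ≠ h') : Disjoint (posSet r φ σ x h) (posSet r φ σ x h') := by
  rw [Finset.disjoint_left]
  intro i h1 h2
  rw [mem_posSet] at h1 h2
  rcases h1 with ⟨h1, rfl⟩ | ⟨h1, rfl⟩ <;> rcases h2 with ⟨h2, rfl⟩ | ⟨h2, rfl⟩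
  · exact hh rfl
  · exact notMem_largeSet_of_mem_repOf h2 h1
  · exact notMem_largeSet_of_mem_repOf h1 h2
  · exact hh rfl

lemma posSet_nonempty {r : Fin n → ℝ} {φ : HashFuns n m} {σ : ℝ} {x : Fin n → ℝ}
    (hx : ∀ i, 0 ≤ x i) {h : Fin (m ^ 3)} (hpos : 0 < hat φ σ x h) :
    (posSet r φ σ x h).Nonempty := by
  rw [hat_eq hx] at hpos
  by_contra hne
  rw [Finset.not_nonempty_iff_eq_empty, posSet, Finset.union_eq_empty] at hne
  rw [hne.1, Finset.sum_empty, zero_add] at hpos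
  obtain ⟨b, hb, hb'⟩ := Finset.exists_lt_of_sum_lt (f := fun _ => (0 : ℝ))
    (by simpa using hpos)
  have h1 := card_repOf_of_pos r φ.2.2 σ x b hb'
  have h2 : repOf r φ.2.2 σ x b ⊆ ∅ := by
    rw [← hne.2]
    exact Finset.subset_biUnion_of_mem _ hb
  rw [Finset.subset_empty.mp h2] at h1
  simp at h1

/-- A good run has as many elements as the output of the rounding in dimension `m³`. -/
lemma Good.card_biUnion {φ : HashFuns n m} {σ τ : ℝ} {x : Fin n → ℝ} (hg : Good φ σ τ x)
    (hx : ∀ i, 0 ≤ x i) (r : Fin n → ℝ) {T : Finset (Fin (m ^ 3))}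
    (hT : ∀ h ∈ T, 0 < hat φ σ x h) : (T.biUnion (posSet r φ σ x)).card = T.card := by
  rw [Finset.card_biUnion fun h _ h' _ hh => posSet_disjoint r φ σ x hh, Finset.card_eq_sum_ones]
  refine Finset.sum_congr rfl fun h hh => le_antisymm (hg.card_posSet_le r h) ?_
  exact Finset.card_pos.mpr (posSet_nonempty hx (hT h hh))

/-- An element of only one union lies in `f h` for some h in the symmetric difference of T and T',
or in the difference of `f h` and `g h` for some h in T'. Charging changed contents to T' alone is
what later brings in the selection probability under y. -/
lemma card_symmDiff_biUnion_le {κ ι : Type*} [DecidableEq κ] [DecidableEq ι] (T T' : Finset κ)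
    (f g : κ → Finset ι) (hf : ∀ h, (f h).card ≤ 1) :
    (symmDiff (T.biUnion f) (T'.biUnion g)).card ≤
      (symmDiff T T').card + ∑ h ∈ T', (symmDiff (f h) (g h)).card := by
  have hsub : symmDiff (T.biUnion f) (T'.biUnion g) ⊆
      (symmDiff T T').biUnion f ∪ T'.biUnion fun h => symmDiff (f h) (g h) := by
    intro i
    simp only [Finset.mem_symmDiff, Finset.mem_biUnion, Finset.mem_union]
    grind
  refine (Finset.card_le_card hsub).trans ((Finset.card_union_le _ _).trans
    (add_le_add ?_ Finset.card_biUnion_le))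
  exact Finset.card_biUnion_le.trans ((Finset.sum_le_card_nsmul _ _ 1 fun h _ => hf h).trans
    (by simp))

end CorrSampling
end

noncomputable section
namespace CorrSampling

/-! ### Measurability and Tonelli for the composed algorithm -/

lemma measurable_of_factors {α β δ : Type*} [MeasurableSpace α] [MeasurableSpace β]
    [MeasurableSpace δ] [DiscreteMeasurableSpace δ] {D : α → δ} (hD : Measurable D) {f : α → β}
    (h : ∀ a a', D a = D a' → f a = f a') : Measurable f := by
  intro s _
  have : f ⁻¹' s = D ⁻¹' (D '' (f ⁻¹' s)) := by
    ext a
    refine ⟨fun ha => ⟨a, ha, rfl⟩, ?_⟩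
    rintro ⟨a', ha', e⟩
    rw [Set.mem_preimage, ← h a' a e]
    exact ha'
  rw [this]
  exact hD MeasurableSet.of_discrete

/-- A good run reads σ only through the finite set of large coordinates. Joint measurability thus
reduces to a countable union over the values of discrete data. -/
lemma measurable_prod_of_factors {α β γ δ : Type*} [MeasurableSpace α] [MeasurableSpace β]
    [MeasurableSpace γ] [MeasurableSpace δ] [DiscreteMeasurableSpace δ] [Countable δ] {D : α → δ}
    (hD : Measurable D) {F : α × β → γ} (h : ∀ a a' b, D a = D a' → F (a, b) = F (a', b))
    (hF : ∀ a, Measurable fun b => F (a, b)) : Measurable F := by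
  intro s hs
  have : F ⁻¹' s = ⋃ d : δ, (D ⁻¹' {d}) ×ˢ {b | ∃ a, D a = d ∧ F (a, b) ∈ s} := by
    ext ⟨a, b⟩
    simp only [Set.mem_preimage, Set.mem_iUnion, Set.mem_prod, Set.mem_singleton_iff,
      Set.mem_ofPred_eq]
    constructor
    · exact fun ha => ⟨D a, rfl, a, rfl, ha⟩
    · rintro ⟨d, rfl, a', e, ha'⟩
      rwa [← h a' a b e]
  rw [this]
  refine MeasurableSet.iUnion fun d => (hD (MeasurableSet.singleton d)).prod ?_
  by_cases hd : ∃ a, D a = d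
  · obtain ⟨a, rfl⟩ := hd
    have : {b | ∃ a', D a' = D a ∧ F (a', b) ∈ s} = (fun b => F (a, b)) ⁻¹' s := by
      ext b
      refine ⟨?_, fun hb => ⟨a, rfl, hb⟩⟩
      rintro ⟨a', e, ha'⟩
      rw [Set.mem_preimage, ← h a' a b e]
      exact ha'
    rw [this]
    exact hF a hs
  · have : {b | ∃ a, D a = d ∧ F (a, b) ∈ s} = ∅ := by
      ext b
      simp only [Set.mem_ofPred_eq, Set.mem_empty_iff_false, iff_false]
      rintro ⟨a, e, -⟩
      exact hd ⟨a, e⟩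
    rw [this]
    exact MeasurableSet.empty

lemma lintegral_prod₃ {α β γ : Type*} [MeasurableSpace α] [MeasurableSpace β] [MeasurableSpace γ]
    (a : Measure α) (b : Measure β) (c : Measure γ) [SFinite a] [SFinite b] [SFinite c]
    {F : α × β × γ → ENNReal} (hF : Measurable F) :
    ∫⁻ z, F z ∂a.prod (b.prod c) = ∫⁻ w, ∫⁻ x, ∫⁻ y, F (x, y, w) ∂b ∂a ∂c := by
  rw [lintegral_prod _ hF.aemeasurable]
  have h : ∀ x, ∫⁻ y, F (x, y) ∂b.prod c = ∫⁻ w, ∫⁻ y, F (x, y, w) ∂b ∂c := fun x =>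
    lintegral_prod_symm' _ (hF.comp measurable_prodMk_left)
  simp_rw [h]
  refine lintegral_lintegral_swap (Measurable.aemeasurable ?_)
  have h2 : Measurable fun q : (α × γ) × β => F (q.1.1, q.2, q.1.2) := by fun_prop
  exact h2.lintegral_prod_right'

/-- The last factor, the hash seed, becomes the outermost variable, because it alone decides whether
a run is good. -/
lemma lintegral_prod₄ {α β γ δ : Type*} [MeasurableSpace α] [MeasurableSpace β]
    [MeasurableSpace γ] [MeasurableSpace δ] (a : Measure α) (b : Measure β) (c : Measure γ)
    (d : Measure δ) [SFinite a] [SFinite b] [SFinite c] [SFinite d]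
    {F : α × β × γ × δ → ENNReal} (hF : Measurable F) :
    ∫⁻ z, F z ∂a.prod (b.prod (c.prod d))
      = ∫⁻ w, ∫⁻ x, ∫⁻ y, ∫⁻ z, F (x, y, z, w) ∂c ∂b ∂a ∂d := by
  rw [lintegral_prod _ hF.aemeasurable]
  have h : ∀ x, ∫⁻ y, F (x, y) ∂b.prod (c.prod d)
      = ∫⁻ w, ∫⁻ y, ∫⁻ z, F (x, y, z, w) ∂c ∂b ∂d := fun x =>
    lintegral_prod₃ b c d (hF.comp measurable_prodMk_left)
  simp_rw [h]
  refine lintegral_lintegral_swap (Measurable.aemeasurable ?_)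
  have h2 : Measurable fun q : ((α × δ) × β) × γ => F (q.1.1.1, q.1.2, q.2, q.1.1.2) := by
    fun_prop
  exact h2.lintegral_prod_right'.lintegral_prod_right'

variable {n : ℕ}

/-- The composition with `m` buckets, for an arbitrary algorithm `K` in dimension `m³`. -/
def composedWith {m : ℕ} (A : RandAlg n) (K : RandAlg (m ^ 3)) : RandAlg n where
  Ω := (Fin n → ℝ) × A.Ω × K.Ω × HashSeed n m
  law := (clockLaw n).prod (A.law.prod (K.law.prod (hashLaw n m)))
  run := fun ω => composedRun (clockRound ω.1) (A.run ω.2.1) (K.run ω.2.2.1) ω.2.2.2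

lemma composedAlg_eq (k : ℕ) (A : RandAlg n) :
    composedAlg k A = composedWith A (treeAlg (numBuckets k (stretch k A) ^ 3)) := rfl

/-- An algorithm that rounds all points of the cube, with stretch `S`. -/
structure IsRounding {N : ℕ} (K : RandAlg N) (S : ℝ) : Prop where
  prob : IsProbabilityMeasure K.law
  meas : ∀ z, Measurable fun ω => K.run ω z
  ae : ∀ᵐ ω ∂K.law, ∀ z : Fin N → ℝ, (∀ i, 0 ≤ z i ∧ z i ≤ 1) →
    ((K.run ω z).card = ⌊l1 z⌋₊ ∨ (K.run ω z).card = ⌈l1 z⌉₊) ∧ ∀ i ∈ K.run ω z, 0 < z i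
  marginal : ∀ z : Fin N → ℝ, (∀ i, 0 ≤ z i ∧ z i ≤ 1) → ∀ i,
    K.law {ω | i ∈ K.run ω z} = ENNReal.ofReal (z i)
  stretch_le : ∀ z z' : Fin N → ℝ, (∀ i, 0 ≤ z i ∧ z i ≤ 1) → (∀ i, 0 ≤ z' i ∧ z' i ≤ 1) →
    ∫⁻ ω, ((symmDiff (K.run ω z) (K.run ω z')).card : ENNReal) ∂K.law
      ≤ ENNReal.ofReal (S * l1 (z - z'))

lemma isRounding_treeAlg {N : ℕ} (hN : 0 < N) : IsRounding (treeAlg N) (1 + 6 * Nat.clog 2 N) where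
  prob := inferInstance
  meas := measurable_treeAlg N
  ae := ae_treeAlg hN
  marginal _ hz := treeAlg_marginal hz
  stretch_le _ _ hz hz' := treeAlg_stretch hz hz'

variable {m : ℕ}

/-- The hashes and buckets of a hash seed. -/
def funsOf (ρ : HashSeed n m) : HashFuns n m := (ρ.1, ρ.2.1, ρ.2.2.1)

/-- No failure for the hash seed `ρ`. -/
def GoodSeed (ρ : HashSeed n m) (x : Fin n → ℝ) : Prop :=
  Good (funsOf ρ) ρ.2.2.2.1 ρ.2.2.2.2 x

lemma composedRun_of_not_goodSeed {A₁ A : (Fin n → ℝ) → Finset (Fin n)}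
    {Aₖ : (Fin (m ^ 3) → ℝ) → Finset (Fin (m ^ 3))} {ρ : HashSeed n m} {x : Fin n → ℝ}
    (h : ¬ GoodSeed ρ x) : composedRun A₁ A Aₖ ρ x = A x :=
  composedRun_of_fail (not_not.mp h)

/-- The output of a good run. -/
def goodOut (r : Fin n → ℝ) (φ : HashFuns n m) (σ : ℝ) (x : Fin n → ℝ) (T : Finset (Fin (m ^ 3))) :
    Finset (Fin n) := T.biUnion (posSet r φ σ x)

lemma composedRun_of_goodSeed {r : Fin n → ℝ} {A : (Fin n → ℝ) → Finset (Fin n)}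
    {Aₖ : (Fin (m ^ 3) → ℝ) → Finset (Fin (m ^ 3))} {ρ : HashSeed n m} {x : Fin n → ℝ}
    (hx : ∀ i, 0 ≤ x i) (h : GoodSeed ρ x) : composedRun (clockRound r) A Aₖ ρ x =
      goodOut r (funsOf ρ) ρ.2.2.2.1 x (Aₖ (hat (funsOf ρ) ρ.2.2.2.1 x)) :=
  composedRun_of_not_fail hx h

lemma mem_goodOut {r : Fin n → ℝ} {φ : HashFuns n m} {σ : ℝ} {x : Fin n → ℝ}
    {T : Finset (Fin (m ^ 3))} {i : Fin n} : i ∈ goodOut r φ σ x T ↔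
      (i ∈ largeSet σ x ∧ φ.2.1 i ∈ T) ∨
      (i ∈ repOf r φ.2.2 σ x (φ.2.2 i) ∧ φ.1 (φ.2.2 i) ∈ T) := by
  simp only [goodOut, Finset.mem_biUnion, mem_posSet]
  constructor
  · rintro ⟨h, hT, ⟨h1, rfl⟩ | ⟨h1, rfl⟩⟩
    exacts [Or.inl ⟨h1, hT⟩, Or.inr ⟨h1, hT⟩]
  · rintro (⟨h1, hT⟩ | ⟨h1, hT⟩)
    exacts [⟨_, hT, Or.inl ⟨h1, rfl⟩⟩, ⟨_, hT, Or.inr ⟨h1, rfl⟩⟩]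

lemma measurable_largeSet (x : Fin n → ℝ) : Measurable fun σ => largeSet σ x := by
  refine measurable_of_mem fun i => ?_
  simp only [mem_largeSet]
  exact measurableSet_lt (by fun_prop) (by fun_prop)

lemma lt_iff_of_largeSet_eq {σ σ' : ℝ} {x : Fin n → ℝ} (h : largeSet σ x = largeSet σ' x)
    (i : Fin n) : 1 / 10 + σ < x i ↔ 1 / 10 + σ' < x i := by
  rw [← mem_largeSet, ← mem_largeSet, h]

lemma smallIn_congr {σ σ' : ℝ} {x : Fin n → ℝ} (h : largeSet σ x = largeSet σ' x)
    (B : Fin n → Fin m) (b : Fin m) : smallIn B σ x b = smallIn B σ' x b := by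
  ext i
  simp only [mem_smallIn, ← not_lt, lt_iff_of_largeSet_eq h i]

lemma hat_congr {σ σ' : ℝ} {x : Fin n → ℝ} (h : largeSet σ x = largeSet σ' x)
    (φ : HashFuns n m) : hat φ σ x = hat φ σ' x := by
  have h1 : largePart σ x = largePart σ' x := by
    ext i; simp only [largePart, lt_iff_of_largeSet_eq h i]
  have h2 : smallPart σ x = smallPart σ' x := by
    ext i; simp only [smallPart, lt_iff_of_largeSet_eq h i]
  rw [hat, hat, h1, h2]

lemma repOf_congr {σ σ' : ℝ} {x : Fin n → ℝ} (h : largeSet σ x = largeSet σ' x)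
    (r : Fin n → ℝ) (B : Fin n → Fin m) (b : Fin m) : repOf r B σ x b = repOf r B σ' x b := by
  rw [repOf_eq, repOf_eq, smallIn_congr h]

/-- The discrete data on which the run on `x` depends. -/
def discreteData (x : Fin n → ℝ) (ρ : HashSeed n m) : HashFuns n m × Finset (Fin n) :=
  (funsOf ρ, largeSet ρ.2.2.2.1 x)

lemma measurable_discreteData (x : Fin n → ℝ) :
    Measurable (discreteData x : HashSeed n m → _) := by
  have h : Measurable fun ρ : HashSeed n m => largeSet ρ.2.2.2.1 x :=
    (measurable_largeSet x).comp (by fun_prop)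
  unfold discreteData funsOf
  fun_prop

lemma measurableSet_goodSeed (x : Fin n → ℝ) :
    MeasurableSet {ρ : HashSeed n m | GoodSeed ρ x} := by
  have hD := measurable_discreteData (m := m) x
  have e : {ρ : HashSeed n m | GoodSeed ρ x} =
      ({ρ | Collision ρ x} ∪ ⋃ b : Fin m,
        {ρ | 1 - ρ.2.2.2.2 < bucketMass ρ.2.2.1 ρ.2.2.2.1 x b})ᶜ := by
    ext ρ
    simp only [Set.mem_compl_iff, Set.mem_union, Set.mem_iUnion]
    rfl
  rw [e]
  refine (MeasurableSet.union ?_ (MeasurableSet.iUnion fun b => ?_)).compl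
  · have hc : Measurable fun ρ : HashSeed n m => Collision ρ x := by
      refine measurable_of_factors hD fun ρ ρ' h => ?_
      obtain ⟨R, C, B, σ, τ⟩ := ρ
      obtain ⟨R', C', B', σ', τ'⟩ := ρ'
      simp only [discreteData, funsOf, Prod.mk.injEq] at h
      obtain ⟨⟨rfl, rfl, rfl⟩, h⟩ := h
      simp only [Collision, h]
    exact measurableSet_setOfPred.mpr hc
  · refine measurableSet_lt (by fun_prop) ?_
    refine measurable_of_factors hD fun ρ ρ' h => ?_
    obtain ⟨R, C, B, σ, τ⟩ := ρ
    obtain ⟨R', C', B', σ', τ'⟩ := ρ'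
    simp only [discreteData, funsOf, Prod.mk.injEq] at h
    obtain ⟨⟨rfl, rfl, rfl⟩, h⟩ := h
    simp only [bucketMass, smallIn_congr h]

lemma measurableSet_mem_repOf (B : Fin n → Fin m) (σ : ℝ) (x : Fin n → ℝ) (b : Fin m) (i : Fin n) :
    MeasurableSet {r : Fin n → ℝ | i ∈ repOf r B σ x b} := by
  simp_rw [repOf_eq]
  exact measurableSet_mem_clockRound _ i

lemma measurableSet_mem_run {N : ℕ} {K : RandAlg N} {z : Fin N → ℝ}
    (hK : Measurable fun ω => K.run ω z) (h : Fin N) : MeasurableSet {ω | h ∈ K.run ω z} :=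
  hK (MeasurableSet.of_discrete (s := {T | h ∈ T}))

/-- The good run, as a function of the part of the seed it uses. -/
def goodRun (K : RandAlg (m ^ 3)) (x : Fin n → ℝ) (q : HashSeed n m × (Fin n → ℝ) × K.Ω) :
    Finset (Fin n) :=
  goodOut q.2.1 (funsOf q.1) q.1.2.2.2.1 x (K.run q.2.2 (hat (funsOf q.1) q.1.2.2.2.1 x))

lemma measurable_goodRun {K : RandAlg (m ^ 3)} (hK : ∀ z, Measurable fun ω => K.run ω z)
    (x : Fin n → ℝ) : Measurable (goodRun K x) := by
  refine measurable_prod_of_factors (measurable_discreteData (m := m) x) ?_ fun ρ => ?_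
  · rintro ⟨R, C, B, σ, τ⟩ ⟨R', C', B', σ', τ'⟩ ⟨r, ω⟩ h
    simp only [discreteData, funsOf, Prod.mk.injEq] at h
    obtain ⟨⟨rfl, rfl, rfl⟩, h⟩ := h
    ext i
    simp only [goodRun, mem_goodOut, funsOf, h, repOf_congr h, hat_congr h]
  · refine measurable_of_mem fun i => ?_
    simp only [goodRun, mem_goodOut]
    refine MeasurableSet.union ((MeasurableSet.const _).inter ?_) (MeasurableSet.inter ?_ ?_)
    · exact measurable_snd (measurableSet_mem_run (hK _) _)
    · exact measurable_fst (measurableSet_mem_repOf _ _ _ _ _)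
    · exact measurable_snd (measurableSet_mem_run (hK _) _)

lemma composedWith_run_of_good {A : RandAlg n} {K : RandAlg (m ^ 3)} {x : Fin n → ℝ}
    (hx : ∀ i, 0 ≤ x i) {r : Fin n → ℝ} {a : A.Ω} {κ : K.Ω} {ρ : HashSeed n m}
    (h : GoodSeed ρ x) : (composedWith A K).run (r, a, κ, ρ) x = goodRun K x (ρ, r, κ) :=
  composedRun_of_goodSeed hx h

lemma composedWith_run_of_not_good {A : RandAlg n} {K : RandAlg (m ^ 3)} {x : Fin n → ℝ}
    {r : Fin n → ℝ} {a : A.Ω} {κ : K.Ω} {ρ : HashSeed n m}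
    (h : ¬ GoodSeed ρ x) : (composedWith A K).run (r, a, κ, ρ) x = A.run a x :=
  composedRun_of_not_goodSeed h

lemma measurable_composedWith {K : RandAlg (m ^ 3)}
    (hK : ∀ z, Measurable fun ω => K.run ω z) {A : RandAlg n} {x : Fin n → ℝ} (hx : ∀ i, 0 ≤ x i)
    (hA : Measurable fun ω => A.run ω x) :
    Measurable fun ω => (composedWith A K).run ω x := by
  classical
  have e : (fun ω => (composedWith A K).run ω x) =
      fun ω : (Fin n → ℝ) × A.Ω × K.Ω × HashSeed n m =>
      if ω.2.2.2 ∈ {ρ | GoodSeed ρ x} then goodRun K x (ω.2.2.2, ω.1, ω.2.2.1)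
      else A.run ω.2.1 x := by
    ext1 ω
    split_ifs with h
    · exact composedWith_run_of_good hx h
    · exact composedWith_run_of_not_good h
  rw [e]
  have h2 : Measurable fun ω : (Fin n → ℝ) × A.Ω × K.Ω × HashSeed n m => ω.2.2.2 :=
    measurable_snd.comp (measurable_snd.comp measurable_snd)
  have hp : Measurable fun ω : (Fin n → ℝ) × A.Ω × K.Ω × HashSeed n m =>
        (ω.2.2.2, ω.1, ω.2.2.1) :=
    h2.prodMk (measurable_fst.prodMk (measurable_fst.comp (measurable_snd.comp measurable_snd)))
  have h1 := (measurable_goodRun hK x).comp hp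
  have h3 : Measurable fun ω : (Fin n → ℝ) × A.Ω × K.Ω × HashSeed n m => A.run ω.2.1 x :=
    hA.comp (measurable_fst.comp measurable_snd)
  have h4 := h2 (measurableSet_goodSeed (m := m) x)
  exact Measurable.ite h4 h1 h3

lemma ae_hashLaw (n : ℕ) {m : ℕ} (hm : 0 < m) : ∀ᵐ ρ ∂hashLaw n m,
    (0 < ρ.2.2.2.1 ∧ ρ.2.2.2.1 ≤ 1 / 10) ∧ 0 < ρ.2.2.2.2 ∧ ρ.2.2.2.2 ≤ 1 / 10 := by
  have := isProbabilityMeasure_unifFin hm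
  have := isProbabilityMeasure_unifFin (pow_pos hm 3)
  have h : ∀ᵐ q : ℝ × ℝ ∂(unifIcc 0 (1 / 10)).prod (unifIcc 0 (1 / 10)),
      (0 < q.1 ∧ q.1 ≤ 1 / 10) ∧ 0 < q.2 ∧ q.2 ≤ 1 / 10 := by
    filter_upwards [Measure.quasiMeasurePreserving_fst.ae (ae_unifIcc (a := 0) (b := 1 / 10)),
      Measure.quasiMeasurePreserving_snd.ae (ae_unifIcc (a := 0) (b := 1 / 10))] with q h1 h2
    exact ⟨h1, h2⟩
  exact Measure.quasiMeasurePreserving_snd.ae (Measure.quasiMeasurePreserving_snd.ae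
    (Measure.quasiMeasurePreserving_snd.ae h))

end CorrSampling
end

noncomputable section
namespace CorrSampling

/-! ### The composed algorithm preserves cardinalities and marginals -/

variable {n m : ℕ}

lemma IsCorrelatedSampling.measurable {k : ℕ} {A : RandAlg n} {α : ℝ}
    (hA : IsCorrelatedSampling k A α) {x : Fin n → ℝ} (hx : x ∈ hypersimplex n k) :
    Measurable fun ω => A.run ω x :=
  measurable_to_countable' fun s => hA.meas x hx s

variable {K : RandAlg (m ^ 3)} {S : ℝ}

lemma isProbabilityMeasure_composedWith (hm : 0 < m) (A : RandAlg n)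
    [IsProbabilityMeasure A.law] [IsProbabilityMeasure K.law] :
    IsProbabilityMeasure (composedWith A K).law := by
  have := isProbabilityMeasure_hashLaw n hm
  unfold composedWith
  infer_instance

/-- The output of the composed algorithm, as a function of the components of the seed. -/
def compOut (A : RandAlg n) (K : RandAlg (m ^ 3)) (x : Fin n → ℝ) (r : Fin n → ℝ) (a : A.Ω)
    (κ : K.Ω) (ρ : HashSeed n m) : Finset (Fin n) :=
  composedRun (clockRound r) (A.run a) (K.run κ) ρ x

lemma compOut_of_good {A : RandAlg n} {x : Fin n → ℝ} (hx : ∀ i, 0 ≤ x i) {ρ : HashSeed n m}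
    (h : GoodSeed ρ x) (r : Fin n → ℝ) (a : A.Ω) (κ : K.Ω) :
    compOut A K x r a κ ρ = goodRun K x (ρ, r, κ) :=
  composedRun_of_goodSeed hx h

lemma compOut_of_not_good {A : RandAlg n} {x : Fin n → ℝ} {ρ : HashSeed n m}
    (h : ¬ GoodSeed ρ x) (r : Fin n → ℝ) (a : A.Ω) (κ : K.Ω) :
    compOut A K x r a κ ρ = A.run a x :=
  composedRun_of_not_goodSeed h

lemma lintegral_composedWith (hm : 0 < m) {A : RandAlg n} [IsProbabilityMeasure A.law]
    (hK : IsRounding K S) {x y : Fin n → ℝ} (hx : ∀ i, 0 ≤ x i) (hy : ∀ i, 0 ≤ y i)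
    (hAx : Measurable fun ω => A.run ω x) (hAy : Measurable fun ω => A.run ω y)
    (G : Finset (Fin n) → Finset (Fin n) → ENNReal) :
    ∫⁻ ω, G ((composedWith A K).run ω x) ((composedWith A K).run ω y) ∂(composedWith A K).law =
      ∫⁻ ρ, ∫⁻ r, ∫⁻ a, ∫⁻ κ, G (compOut A K x r a κ ρ) (compOut A K y r a κ ρ)
        ∂K.law ∂A.law ∂clockLaw n ∂hashLaw n m := by
  have := hK.prob
  have := isProbabilityMeasure_hashLaw n hm
  have hG : Measurable fun p : Finset (Fin n) × Finset (Fin n) => G p.1 p.2 :=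
    Measurable.of_discrete
  exact lintegral_prod₄ (clockLaw n) A.law K.law (hashLaw n m)
    (hG.comp ((measurable_composedWith hK.meas hx hAx).prodMk
      (measurable_composedWith hK.meas hy hAy)))

/-- Hashing preserves the total mass, and each selected position holds exactly one element. The
exceptional set of κ is fixed before x, r and ρ, as an almost sure statement about all x requires.
-/
lemma card_goodRun (n : ℕ) (hK : IsRounding K S) :
    ∀ᵐ κ ∂K.law, ∀ x : Fin n → ℝ, (∀ i, 0 ≤ x i ∧ x i ≤ 1) → ∀ (r : Fin n → ℝ) (ρ : HashSeed n m),
      GoodSeed ρ x → 0 < ρ.2.2.2.2 → (goodRun K x (ρ, r, κ)).card = ⌊l1 x⌋₊ ∨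
        (goodRun K x (ρ, r, κ)).card = ⌈l1 x⌉₊ := by
  filter_upwards [hK.ae] with κ h x hx r ρ hg hτ
  have hx0 := fun i => (hx i).1
  obtain ⟨h1, h2⟩ := h (hat (funsOf ρ) ρ.2.2.2.1 x) (hg.hat_mem hτ.le hx)
  have hl : l1 (hat (funsOf ρ) ρ.2.2.2.1 x) = l1 x := by
    rw [l1_of_nonneg (hat_nonneg _ _ hx0), l1_of_nonneg hx0, sum_hat]
  rw [hl] at h1
  rwa [goodRun, goodOut, hg.card_biUnion hx0 r h2]

lemma cardinality_composedWith (hm : 0 < m) (hK : IsRounding K S) {A : RandAlg n} {k : ℕ} {α : ℝ}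
    (hA : IsCorrelatedSampling k A α) : ∀ᵐ ω ∂(composedWith A K).law, ∀ x ∈ hypersimplex n k,
      ((composedWith A K).run ω x).card = ⌊l1 x⌋₊ ∨
        ((composedWith A K).run ω x).card = ⌈l1 x⌉₊ := by
  have := hA.prob
  have := hK.prob
  have := isProbabilityMeasure_hashLaw n hm
  have h1 : ∀ᵐ ω ∂(clockLaw n).prod (A.law.prod (K.law.prod (hashLaw n m))), _ :=
    Measure.quasiMeasurePreserving_snd.ae (Measure.quasiMeasurePreserving_fst.ae hA.cardinality)
  have h2 : ∀ᵐ ω ∂(clockLaw n).prod (A.law.prod (K.law.prod (hashLaw n m))), _ :=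
    Measure.quasiMeasurePreserving_snd.ae (Measure.quasiMeasurePreserving_snd.ae
      (Measure.quasiMeasurePreserving_fst.ae (card_goodRun n hK)))
  have h3 : ∀ᵐ ω ∂(clockLaw n).prod (A.law.prod (K.law.prod (hashLaw n m))), _ :=
    Measure.quasiMeasurePreserving_snd.ae (Measure.quasiMeasurePreserving_snd.ae
      (Measure.quasiMeasurePreserving_snd.ae (ae_hashLaw n hm)))
  change ∀ᵐ ω ∂(clockLaw n).prod (A.law.prod (K.law.prod (hashLaw n m))), _
  filter_upwards [h1, h2, h3] with ⟨r, a, κ, ρ⟩ h1 h2 h3 x hx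
  by_cases hg : GoodSeed ρ x
  · rw [composedWith_run_of_good (fun i => (hx.1 i).1) hg]
    exact h2 x hx.1 r ρ hg h3.2.1
  · rw [composedWith_run_of_not_good hg]
    exact h1 x hx

lemma mask_smallIn_of_notMem_largeSet {B : Fin n → Fin m} {σ : ℝ} {x : Fin n → ℝ}
    (hx : ∀ i, 0 ≤ x i) {i : Fin n} (hi : i ∉ largeSet σ x) :
    mask (smallIn B σ x (B i)) x i = x i := by
  rw [mem_largeSet, not_lt] at hi
  rcases (hx i).eq_or_lt with h0 | h0
  · simp [mask, ← h0]
  · exact if_pos (mem_smallIn.mpr ⟨⟨h0, hi⟩, rfl⟩)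

/-- For a large coordinate, x̂ has the entry x i at its hash. For a small one, being the
representative has probability x i / M and selection of its bucket has probability M, independently,
where M is the mass of the bucket. -/
lemma marginal_goodRun (hK : IsRounding K S) {x : Fin n → ℝ} (hx : ∀ i, 0 ≤ x i ∧ x i ≤ 1)
    {ρ : HashSeed n m} (hg : GoodSeed ρ x) (hτ : 0 < ρ.2.2.2.2) (i : Fin n) :
    ∫⁻ r, ∫⁻ κ, Set.indicator {κ | i ∈ goodRun K x (ρ, r, κ)} 1 κ ∂K.law ∂clockLaw n
      = ENNReal.ofReal (x i) := by
  obtain ⟨R, C, B, σ, τ⟩ := ρ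
  have := hK.prob
  have hx0 := fun i => (hx i).1
  replace hg : Good (R, C, B) σ τ x := hg
  have hmar := hK.marginal _ (hg.hat_mem hτ.le hx)
  have hset := measurableSet_mem_run (hK.meas (hat (R, C, B) σ x))
  simp only [goodRun, funsOf, mem_goodOut]
  by_cases hi : i ∈ largeSet σ x
  · have : ∀ r b, i ∉ repOf r B σ x b := fun r b h => notMem_largeSet_of_mem_repOf h hi
    simp only [hi, true_and, this, false_and, or_false]
    rw [lintegral_indicator_one (hset _), hmar, hg.hat_large hx0 hi]
    simp
  · simp only [hi, false_and, false_or]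
    have e : ∀ r, ∫⁻ κ, Set.indicator {κ | i ∈ repOf r B σ x (B i) ∧
        R (B i) ∈ K.run κ (hat (R, C, B) σ x)} 1 κ ∂K.law =
        Set.indicator {r | i ∈ repOf r B σ x (B i)}
          (fun _ => ENNReal.ofReal (bucketMass B σ x (B i))) r := by
      intro r
      by_cases hr : i ∈ repOf r B σ x (B i)
      · simp only [hr, true_and]
        rw [lintegral_indicator_one (hset _), hmar, hg.hat_bucket hx0 (B i),
          Set.indicator_of_mem (by exact hr)]
      · simp [hr]
    simp_rw [e]
    rw [lintegral_indicator_const (measurableSet_mem_repOf _ _ _ _ _)]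
    simp_rw [repOf_eq]
    rw [clockLaw_marginal (mask_nonneg B σ x (B i)), sum_mask_smallIn,
      mask_smallIn_of_notMem_largeSet hx0 hi, ← ENNReal.ofReal_mul (bucketMass_nonneg _ _ _ _)]
    congr 1
    rcases eq_or_ne (bucketMass B σ x (B i)) 0 with h0 | h0
    · have := Finset.single_le_sum (fun j _ => mask_nonneg B σ x (B i) j) (Finset.mem_univ i)
      rw [sum_mask_smallIn, h0, mask_smallIn_of_notMem_largeSet hx0 hi] at this
      rw [h0, le_antisymm this (hx0 i)]
      simp
    · field_simp

lemma marginals_composedWith (hm : 0 < m) (hK : IsRounding K S) {A : RandAlg n} {k : ℕ} {α : ℝ}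
    (hA : IsCorrelatedSampling k A α) {x : Fin n → ℝ} (hx : x ∈ hypersimplex n k) (i : Fin n) :
    (composedWith A K).law {ω | i ∈ (composedWith A K).run ω x} = ENNReal.ofReal (x i) := by
  have := hA.prob
  have := hK.prob
  have := isProbabilityMeasure_hashLaw n hm
  have hms : MeasurableSet {ω | i ∈ (composedWith A K).run ω x} :=
    measurable_composedWith hK.meas (fun i => (hx.1 i).1) (hA.measurable hx)
      (MeasurableSet.of_discrete (s := {T | i ∈ T}))
  have e : (composedWith A K).law {ω | i ∈ (composedWith A K).run ω x} =
      ∫⁻ ω, (fun T _ => if i ∈ T then 1 else 0) ((composedWith A K).run ω x)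
        ((composedWith A K).run ω x) ∂(composedWith A K).law := by
    rw [← lintegral_indicator_one hms]
    simp [Set.indicator]
  rw [e, lintegral_composedWith hm hK (fun i => (hx.1 i).1) (fun i => (hx.1 i).1)
    (hA.measurable hx) (hA.measurable hx) fun T _ => if i ∈ T then 1 else 0]
  have h : ∀ᵐ ρ ∂hashLaw n m, ∫⁻ r, ∫⁻ a, ∫⁻ κ, (if i ∈ compOut A K x r a κ ρ then 1 else 0)
      ∂K.law ∂A.law ∂clockLaw n = ENNReal.ofReal (x i) := by
    filter_upwards [ae_hashLaw n hm] with ρ hρ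
    by_cases hg : GoodSeed ρ x
    · simp only [compOut_of_good (fun i => (hx.1 i).1) hg, lintegral_const, measure_univ, mul_one]
      rw [← marginal_goodRun hK hx.1 hg hρ.2.1 i]
      simp [Set.indicator]
    · simp only [compOut_of_not_good hg, lintegral_const, measure_univ, mul_one]
      rw [← hA.marginals x hx i,
        ← lintegral_indicator_one (measurableSet_mem_run (hA.measurable hx) i)]
      simp [Set.indicator]
  rw [lintegral_congr_ae h]
  simp

end CorrSampling
end

noncomputable section
namespace CorrSampling

/-! ### Changing a single coordinate in good runs -/

variable {n m : ℕ}

lemma l1_of_single {v : Fin n → ℝ} {p : Fin n} (h : ∀ i, i ≠ p → v i = 0) : l1 v = |v p| :=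
  Finset.sum_eq_single p (fun i _ hi => by rw [h i hi, abs_zero]) (by simp)

section SingleCoordinate

variable {x y : Fin n → ℝ} {p : Fin n}

lemma mask_smallIn_congr_of_ne (hxy : ∀ i, i ≠ p → x i = y i) {B : Fin n → Fin m} {b : Fin m}
    (hb : B p ≠ b) (σ : ℝ) : mask (smallIn B σ x b) x = mask (smallIn B σ y b) y := by
  ext i
  simp only [mask, mem_smallIn]
  rcases eq_or_ne i p with rfl | hi
  · simp [hb]
  · rw [hxy i hi]

lemma repOf_congr_of_ne (hxy : ∀ i, i ≠ p → x i = y i) {B : Fin n → Fin m} {b : Fin m}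
    (hb : B p ≠ b) (r : Fin n → ℝ) (σ : ℝ) : repOf r B σ x b = repOf r B σ y b := by
  rw [repOf_eq, repOf_eq, mask_smallIn_congr_of_ne hxy hb]

lemma l1_hat_sub_le (hxy : ∀ i, i ≠ p → x i = y i)
    (φ : HashFuns n m) (σ : ℝ) : l1 (hat φ σ x - hat φ σ y) ≤
    |largePart σ x p - largePart σ y p| + |smallPart σ x p - smallPart σ y p| := by
  refine (l1_hatOf_sub_le φ _ _ _ _).trans_eq ?_
  rw [l1_of_single (p := p), l1_of_single (p := p)]
  · rfl
  · intro i hi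
    simp [smallPart, hxy i hi]
  · intro i hi
    simp [largePart, hxy i hi]

/-- A crude bound for the case that p crosses between small and large, when its mass jumps from one
position to another. -/
lemma l1_hat_sub_le_two (hxy : ∀ i, i ≠ p → x i = y i)
    (hx : ∀ i, 0 ≤ x i ∧ x i ≤ 1) (hy : ∀ i, 0 ≤ y i ∧ y i ≤ 1)
    (φ : HashFuns n m) (σ : ℝ) : l1 (hat φ σ x - hat φ σ y) ≤ 2 := by
  refine (l1_hat_sub_le hxy φ σ).trans ?_
  obtain ⟨h1, h2⟩ := hx p
  obtain ⟨h3, h4⟩ := hy p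
  unfold largePart smallPart
  split_ifs <;> rw [← le_sub_iff_add_le, abs_le] <;> constructor <;>
    simp only [sub_self, sub_zero, zero_sub, abs_zero, abs_neg, abs_of_nonneg h1,
      abs_of_nonneg h3] <;> first | linarith | (rw [← sub_nonneg]; grind)

lemma l1_hat_sub_le_abs (hxy : ∀ i, i ≠ p → x i = y i)
    {σ : ℝ} (hL : 1 / 10 + σ < x p ↔ 1 / 10 + σ < y p)
    (φ : HashFuns n m) : l1 (hat φ σ x - hat φ σ y) ≤ |x p - y p| := by
  refine (l1_hat_sub_le hxy φ σ).trans_eq ?_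
  unfold largePart smallPart
  split_ifs <;> first | tauto | simp

lemma posSet_congr_of_ne (hxy : ∀ i, i ≠ p → x i = y i)
    {φ : HashFuns n m} {h : Fin (m ^ 3)} (h1 : φ.2.1 p ≠ h)
    (h2 : φ.1 (φ.2.2 p) ≠ h) (r : Fin n → ℝ) (σ : ℝ) : posSet r φ σ x h = posSet r φ σ y h := by
  ext i
  simp only [mem_posSet, mem_largeSet]
  refine or_congr ?_ ?_
  · rcases eq_or_ne i p with rfl | hi
    · simp [h1]
    · rw [hxy i hi]
  · by_cases hb : φ.2.2 p = φ.2.2 i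
    · simp [← hb, h2]
    · rw [repOf_congr_of_ne hxy hb]

lemma posSet_congr_of_largeSet (hxy : ∀ i, i ≠ p → x i = y i)
    {σ : ℝ} (hL : largeSet σ x = largeSet σ y) {φ : HashFuns n m}
    {r : Fin n → ℝ} {h : Fin (m ^ 3)}
    (hr : φ.1 (φ.2.2 p) = h → repOf r φ.2.2 σ x (φ.2.2 p) = repOf r φ.2.2 σ y (φ.2.2 p)) :
    posSet r φ σ x h = posSet r φ σ y h := by
  ext i
  simp only [mem_posSet, hL]
  refine or_congr_right ?_
  by_cases hb : φ.2.2 p = φ.2.2 i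
  · rw [← hb]
    exact and_congr_left fun e => by rw [hr e]
  · rw [repOf_congr_of_ne hxy hb]

/-- Only the hash of p and the hash of its bucket can change their contents, and each position holds
at most one element in either run. -/
lemma sum_symmDiff_posSet_le_four (hxy : ∀ i, i ≠ p → x i = y i)
    {φ : HashFuns n m} {σ τ : ℝ} (hgx : Good φ σ τ x)
    (hgy : Good φ σ τ y) (r : Fin n → ℝ) (T : Finset (Fin (m ^ 3))) :
    ∑ h ∈ T, (symmDiff (posSet r φ σ x h) (posSet r φ σ y h)).card ≤ 4 := by
  have h2 : ∀ h, (symmDiff (posSet r φ σ x h) (posSet r φ σ y h)).card ≤ 2 := fun h =>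
    (Finset.card_le_card Finset.symmDiff_subset_union).trans ((Finset.card_union_le _ _).trans
      (add_le_add (hgx.card_posSet_le r h) (hgy.card_posSet_le r h)))
  calc _ ≤ ∑ h ∈ {φ.2.1 p, φ.1 (φ.2.2 p)},
        (symmDiff (posSet r φ σ x h) (posSet r φ σ y h)).card := by
        refine Finset.sum_le_sum_of_ne_zero fun h _ hne => ?_
        contrapose! hne
        simp only [Finset.mem_insert, Finset.mem_singleton, not_or] at hne
        rw [posSet_congr_of_ne hxy (Ne.symm hne.1) (Ne.symm hne.2)]
        simp
    _ ≤ _ := (Finset.sum_le_card_nsmul _ _ 2 fun h _ => h2 h).trans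
        (Nat.mul_le_mul_right 2 Finset.card_le_two)

-- Without a crossing, the only content that may change is that of the bucket of p. It counts only
-- when the representative changes and the position is selected; keeping both conditions is
-- essential for the cancellation that follows.
open Classical in
lemma sum_symmDiff_posSet_le_ite (hxy : ∀ i, i ≠ p → x i = y i)
    {φ : HashFuns n m} {σ τ : ℝ} (hgx : Good φ σ τ x)
    (hgy : Good φ σ τ y) (hL : largeSet σ x = largeSet σ y) (r : Fin n → ℝ)
    (T : Finset (Fin (m ^ 3))) :
    ∑ h ∈ T, (symmDiff (posSet r φ σ x h) (posSet r φ σ y h)).card ≤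
      if repOf r φ.2.2 σ x (φ.2.2 p) ≠ repOf r φ.2.2 σ y (φ.2.2 p) then
        (if φ.1 (φ.2.2 p) ∈ T then 2 else 0) else 0 := by
  have h0 : ∀ h, posSet r φ σ x h = posSet r φ σ y h →
      (symmDiff (posSet r φ σ x h) (posSet r φ σ y h)).card = 0 := fun h e => by rw [e]; simp
  split_ifs with hr hT
  · have h2 := (Finset.card_le_card (Finset.symmDiff_subset_union
      (s := posSet r φ σ x (φ.1 (φ.2.2 p))) (t := posSet r φ σ y (φ.1 (φ.2.2 p))))).trans
      ((Finset.card_union_le _ _).trans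
      (add_le_add (hgx.card_posSet_le r _) (hgy.card_posSet_le r _)))
    refine le_trans (Finset.sum_le_sum_of_ne_zero (t := {φ.1 (φ.2.2 p)}) fun h _ hne => ?_)
      (by rw [Finset.sum_singleton]; exact h2)
    contrapose! hne
    rw [Finset.mem_singleton] at hne
    exact h0 h (posSet_congr_of_largeSet hxy hL fun e => absurd e.symm hne)
  · refine (Finset.sum_eq_zero fun h hh => h0 h ?_).le
    exact posSet_congr_of_largeSet hxy hL fun e => absurd (e ▸ hh) hT
  · rw [not_not] at hr
    exact (Finset.sum_eq_zero fun h _ => h0 h (posSet_congr_of_largeSet hxy hL fun _ => hr)).le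

end SingleCoordinate

end CorrSampling
end

noncomputable section
namespace CorrSampling

/-! ### Expected change of good runs -/

variable {n m : ℕ} {K : RandAlg (m ^ 3)} {S : ℝ} {x y : Fin n → ℝ} {p : Fin n}

lemma measurable_of_pair {Ω : Type*} [MeasurableSpace Ω] {N : ℕ} {f g : Ω → Finset (Fin N)}
    (hf : Measurable f) (hg : Measurable g) (G : Finset (Fin N) → Finset (Fin N) → ENNReal) :
    Measurable fun ω => G (f ω) (g ω) := by
  have h : Measurable fun p : Finset (Fin N) × Finset (Fin N) => G p.1 p.2 :=
    Measurable.of_discrete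
  exact h.comp (hf.prodMk hg)

lemma measurable_card_symmDiff {Ω : Type*} [MeasurableSpace Ω] {N : ℕ} {f g : Ω → Finset (Fin N)}
    (hf : Measurable f) (hg : Measurable g) :
    Measurable fun ω => ((symmDiff (f ω) (g ω)).card : ENNReal) :=
  measurable_of_pair hf hg fun s t => ((symmDiff s t).card : ENNReal)

lemma lintegral_goodRun_le (hK : IsRounding K S) (hx : ∀ i, 0 ≤ x i ∧ x i ≤ 1)
    (hy : ∀ i, 0 ≤ y i ∧ y i ≤ 1) {φ : HashFuns n m} {σ τ : ℝ} (hτ : 0 < τ)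
    (hgx : Good φ σ τ x) (hgy : Good φ σ τ y) (r : Fin n → ℝ) {d : ℝ} (hS : 0 ≤ S)
    (hd : l1 (hat φ σ x - hat φ σ y) ≤ d) :
    ∫⁻ κ, ((symmDiff (goodRun K x ((φ.1, φ.2.1, φ.2.2, σ, τ), r, κ))
      (goodRun K y ((φ.1, φ.2.1, φ.2.2, σ, τ), r, κ))).card : ENNReal) ∂K.law ≤
    ENNReal.ofReal (S * d) + ∫⁻ κ, ((∑ h ∈ K.run κ (hat φ σ y),
      (symmDiff (posSet r φ σ x h) (posSet r φ σ y h)).card : ℕ) : ENNReal) ∂K.law := by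
  have hm := measurable_card_symmDiff (hK.meas (hat φ σ x)) (hK.meas (hat φ σ y))
  refine le_trans ?_ (add_le_add_left ((hK.stretch_le _ _ (hgx.hat_mem hτ.le hx)
    (hgy.hat_mem hτ.le hy)).trans (ENNReal.ofReal_le_ofReal
      (mul_le_mul_of_nonneg_left hd hS))) _)
  rw [← lintegral_add_left hm]
  refine lintegral_mono fun κ => ?_
  have := card_symmDiff_biUnion_le (K.run κ (hat φ σ x)) (K.run κ (hat φ σ y)) (posSet r φ σ x)
    (posSet r φ σ y) (hgx.card_posSet_le r)
  exact (Nat.cast_le.mpr this).trans_eq (Nat.cast_add _ _)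

lemma lintegral_goodRun_le_of_good (hK : IsRounding K S) (hS : 0 ≤ S)
    (hxy : ∀ i, i ≠ p → x i = y i) (hx : ∀ i, 0 ≤ x i ∧ x i ≤ 1)
    (hy : ∀ i, 0 ≤ y i ∧ y i ≤ 1) {φ : HashFuns n m} {σ τ : ℝ} (hτ : 0 < τ)
    (hgx : Good φ σ τ x) (hgy : Good φ σ τ y) :
    ∫⁻ r, ∫⁻ κ, ((symmDiff (goodRun K x ((φ.1, φ.2.1, φ.2.2, σ, τ), r, κ))
      (goodRun K y ((φ.1, φ.2.1, φ.2.2, σ, τ), r, κ))).card : ENNReal) ∂K.law ∂clockLaw n ≤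
    ENNReal.ofReal (2 * S + 4) := by
  have := hK.prob
  have h : ∀ r, ∫⁻ κ, ((symmDiff (goodRun K x ((φ.1, φ.2.1, φ.2.2, σ, τ), r, κ))
      (goodRun K y ((φ.1, φ.2.1, φ.2.2, σ, τ), r, κ))).card : ENNReal) ∂K.law ≤
      ENNReal.ofReal (2 * S + 4) := by
    intro r
    refine (lintegral_goodRun_le hK hx hy hτ hgx hgy r hS
      (l1_hat_sub_le_two hxy hx hy φ σ)).trans ?_
    rw [mul_comm 2 S, ENNReal.ofReal_add (by positivity) (by norm_num)]
    refine add_le_add_right ?_ _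
    refine (lintegral_mono (g := fun _ => 4) fun κ => ?_).trans (by simp)
    exact (Nat.cast_le.mpr (sum_symmDiff_posSet_le_four hxy hgx hgy r _)).trans (by simp)
  exact (lintegral_mono h).trans (by simp)

lemma largeSet_eq_of_iff (hxy : ∀ i, i ≠ p → x i = y i) {σ : ℝ}
    (hL : 1 / 10 + σ < x p ↔ 1 / 10 + σ < y p) : largeSet σ x = largeSet σ y := by
  ext i
  rw [mem_largeSet, mem_largeSet]
  rcases eq_or_ne i p with rfl | hi
  · exact hL
  · rw [hxy i hi]

lemma mask_smallIn_update (B : Fin n → Fin m) {σ : ℝ} (hx : ∀ i, 0 ≤ x i) {δ : ℝ} (hδ : 0 < δ)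
    (hp : x p + δ ≤ 1 / 10 + σ) :
    mask (smallIn B σ (Function.update x p (x p + δ)) (B p)) (Function.update x p (x p + δ)) =
      Function.update (mask (smallIn B σ x (B p)) x) p
        (mask (smallIn B σ x (B p)) x p + δ) := by
  rw [mask_smallIn_of_notMem_largeSet hx (by rw [mem_largeSet]; linarith)]
  have := hx p
  ext i
  rcases eq_or_ne i p with rfl | hi
  · rw [Function.update_self, mask_smallIn_of_notMem_largeSet]
    · simp
    · intro j
      rcases eq_or_ne j i with rfl | hj
      · simp only [Function.update_self]; linarith
      · rw [Function.update_of_ne hj]; exact hx j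
    · simpa [mem_largeSet] using hp
  · simp [mask, mem_smallIn, hi]

lemma bucketMass_update (B : Fin n → Fin m) {σ : ℝ} (hx : ∀ i, 0 ≤ x i) {δ : ℝ} (hδ : 0 < δ)
    (hp : x p + δ ≤ 1 / 10 + σ) :
    bucketMass B σ (Function.update x p (x p + δ)) (B p) = bucketMass B σ x (B p) + δ := by
  rw [← sum_mask_smallIn, mask_smallIn_update B hx hδ hp, Finset.sum_update_of_mem
    (Finset.mem_univ p), ← sum_mask_smallIn, ← Finset.add_sum_erase _ _ (Finset.mem_univ p),
    Finset.sdiff_singleton_eq_erase]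
  ring

lemma mask_smallIn_congr_of_large (hxy : ∀ i, i ≠ p → x i = y i) {σ : ℝ} (hp : 1 / 10 + σ < x p)
    (hq : 1 / 10 + σ < y p) (B : Fin n → Fin m) (b : Fin m) :
    mask (smallIn B σ x b) x = mask (smallIn B σ y b) y := by
  ext i
  simp only [mask, mem_smallIn]
  rcases eq_or_ne i p with rfl | hi
  · rw [if_neg fun h => hp.not_ge h.1.2, if_neg fun h => hq.not_ge h.1.2]
  · rw [hxy i hi]

lemma repOf_congr_of_large (hxy : ∀ i, i ≠ p → x i = y i) {σ : ℝ} (hp : 1 / 10 + σ < x p)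
    (hq : 1 / 10 + σ < y p) (r : Fin n → ℝ) (B : Fin n → Fin m) (b : Fin m) :
    repOf r B σ x b = repOf r B σ y b := by
  rw [repOf_eq, repOf_eq, mask_smallIn_congr_of_large hxy hp hq]

-- Moving x̂ costs Sδ. The representative changes with probability at most δ/(M + δ), and the bucket
-- is selected on input y with probability M + δ, independently of the clocks; hence the remaining
-- 2δ, where M is the mass of the bucket before the increase.
open Classical in
lemma lintegral_goodRun_le_of_noncrossing (hK : IsRounding K S) (hS : 0 ≤ S)
    (hx : ∀ i, 0 ≤ x i ∧ x i ≤ 1) {δ : ℝ} (hδ : 0 < δ)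
    (hy : ∀ i, 0 ≤ Function.update x p (x p + δ) i ∧ Function.update x p (x p + δ) i ≤ 1)
    {φ : HashFuns n m} {σ τ : ℝ} (hτ : 0 < τ)
    (hL : 1 / 10 + σ < x p ↔ 1 / 10 + σ < x p + δ)
    (hgx : Good φ σ τ x) (hgy : Good φ σ τ (Function.update x p (x p + δ))) :
    ∫⁻ r, ∫⁻ κ, ((symmDiff (goodRun K x ((φ.1, φ.2.1, φ.2.2, σ, τ), r, κ))
      (goodRun K (Function.update x p (x p + δ))
        ((φ.1, φ.2.1, φ.2.2, σ, τ), r, κ))).card : ENNReal) ∂K.law ∂clockLaw n ≤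
    ENNReal.ofReal ((S + 2) * δ) := by
  have := hK.prob
  set y := Function.update x p (x p + δ) with hydef
  have hxy : ∀ i, i ≠ p → x i = y i := fun i hi => (Function.update_of_ne hi _ _).symm
  have hyp : y p = x p + δ := Function.update_self _ _ _
  have hx0 := fun i => (hx i).1
  have hy0 := fun i => (hy i).1
  rw [← hyp] at hL
  have hLs := largeSet_eq_of_iff hxy hL
  have hset := measurableSet_mem_run (hK.meas (hat φ σ y)) (φ.1 (φ.2.2 p))
  set E := {r : Fin n → ℝ | repOf r φ.2.2 σ x (φ.2.2 p) ≠ repOf r φ.2.2 σ y (φ.2.2 p)} with hE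
  have h : ∀ r, ∫⁻ κ, ((symmDiff (goodRun K x ((φ.1, φ.2.1, φ.2.2, σ, τ), r, κ))
      (goodRun K y ((φ.1, φ.2.1, φ.2.2, σ, τ), r, κ))).card : ENNReal) ∂K.law ≤
      ENNReal.ofReal (S * δ) +
        E.indicator (fun _ => 2 * ENNReal.ofReal (bucketMass φ.2.2 σ y (φ.2.2 p))) r := by
    intro r
    refine (lintegral_goodRun_le hK hx hy hτ hgx hgy r hS
      (l1_hat_sub_le_abs hxy hL φ)).trans ?_
    have e : |x p - y p| = δ := by rw [hyp, sub_add_cancel_left, abs_neg, abs_of_pos hδ]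
    rw [e]
    refine add_le_add_right ?_ _
    by_cases hr : r ∈ E
    · rw [Set.indicator_of_mem hr, ← hgy.hat_bucket hy0, ← hK.marginal _ (hgy.hat_mem hτ.le hy),
        ← lintegral_indicator_one hset, ← lintegral_const_mul _ (measurable_one.indicator hset)]
      refine lintegral_mono fun κ => ?_
      have := sum_symmDiff_posSet_le_ite hxy hgx hgy hLs r (K.run κ (hat φ σ y))
      rw [if_pos (by exact hr)] at this
      refine (Nat.cast_le.mpr this).trans ?_
      simp only [Set.indicator, Set.mem_ofPred_eq]
      split_ifs <;> simp
    · rw [Set.indicator_of_notMem hr]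
      refine (lintegral_mono (g := fun _ => 0) fun κ => ?_).trans (by simp)
      have := sum_symmDiff_posSet_le_ite hxy hgx hgy hLs r (K.run κ (hat φ σ y))
      rw [if_neg (by exact hr)] at this
      exact (Nat.cast_le.mpr this).trans (by simp)
  refine (lintegral_mono h).trans ?_
  rw [lintegral_add_left measurable_const]
  have hEle : clockLaw n E * ENNReal.ofReal (bucketMass φ.2.2 σ y (φ.2.2 p))
      ≤ ENNReal.ofReal δ := by
    by_cases hp : 1 / 10 + σ < x p
    · have : E = ∅ := by
        ext r
        simp only [hE, Set.mem_ofPred_eq, Set.mem_empty_iff_false, iff_false, not_not]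
        exact repOf_congr_of_large hxy hp (hL.mp hp) r _ _
      simp [this]
    · have hq : x p + δ ≤ 1 / 10 + σ := by
        rw [hL, not_lt, hyp] at hp
        exact hp
      have h1 := clockLaw_change (mask_nonneg φ.2.2 σ x (φ.2.2 p)) p hδ
      rw [← mask_smallIn_update φ.2.2 hx0 hδ hq, sum_mask_smallIn] at h1
      simp only [← repOf_eq] at h1
      rw [bucketMass_update φ.2.2 hx0 hδ hq]
      refine (mul_le_mul_left h1 _).trans ?_
      have h0 := bucketMass_nonneg φ.2.2 σ x (φ.2.2 p)
      rw [← ENNReal.ofReal_mul (by positivity), div_mul_cancel₀ _ (by positivity)]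
  have h2 : ∫⁻ r, E.indicator (fun _ => 2 * ENNReal.ofReal (bucketMass φ.2.2 σ y (φ.2.2 p))) r
      ∂clockLaw n ≤ 2 * ENNReal.ofReal δ := by
    refine (lintegral_indicator_const_le E _).trans ?_
    rw [mul_assoc]
    exact mul_le_mul_right (by rwa [mul_comm]) _
  rw [lintegral_const, measure_univ, mul_one, add_mul, ENNReal.ofReal_add (by positivity)
    (by positivity), ENNReal.ofReal_mul (p := 2) (by norm_num)]
  refine add_le_add_right (h2.trans (by simp)) _

end CorrSampling
end

noncomputable section
namespace CorrSampling

/-! ### Failures, and the expected change for a fixed hash seed -/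

variable {n m : ℕ}

lemma badHash_of_collision {φ : HashFuns n m} {σ τ : ℝ} (hσ : 0 ≤ σ) {x : Fin n → ℝ}
    (h : Collision ((φ.1, φ.2.1, φ.2.2, σ, τ) : HashSeed n m) x) : BadHash x φ := by
  simp only [Collision] at h
  obtain ⟨h, hc⟩ := h
  have hlarge : ∀ i ∈ largeSet σ x, 1 / 10 < x i := fun i hi => by
    have := mem_largeSet.mp hi
    linarith
  by_cases h1 : 1 < ((largeSet σ x).filter fun i => φ.2.1 i = h).card
  · obtain ⟨i, hi, j, hj, hij⟩ := Finset.one_lt_card.mp h1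
    rw [Finset.mem_filter] at hi hj
    exact Or.inr (Or.inl ⟨i, j, hij, hlarge i hi.1, hlarge j hj.1, hi.2.trans hj.2.symm⟩)
  by_cases h2 : 1 < (Finset.univ.filter fun b : Fin m => φ.1 b = h).card
  · obtain ⟨b, hb, b', hb', hbb⟩ := Finset.one_lt_card.mp h2
    rw [Finset.mem_filter] at hb hb'
    exact Or.inl ⟨b, b', hbb, hb.2.trans hb'.2.symm⟩
  obtain ⟨i, hi⟩ := Finset.card_pos.mp
    (show 0 < ((largeSet σ x).filter fun i => φ.2.1 i = h).card by omega)
  obtain ⟨b, hb⟩ := Finset.card_pos.mp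
    (show 0 < (Finset.univ.filter fun b : Fin m => φ.1 b = h).card by omega)
  rw [Finset.mem_filter] at hi hb
  exact Or.inr (Or.inr ⟨i, b, hlarge i hi.1, hi.2.trans hb.2.symm⟩)

/-- No small coordinate exceeds 1/5, so each one has partners of weight at least w - 1/5 in its
bucket of mass w. The pairs then weigh at least w(w - 1/5), which is at least 0.9 · 0.7 = 0.63. -/
lemma badBuckets_of_heavy {φ : HashFuns n m} {σ : ℝ} (hσ : σ ≤ 1 / 10) {x : Fin n → ℝ}
    (hx : ∀ i, 0 ≤ x i) {b : Fin m} (h : 9 / 10 ≤ bucketMass φ.2.2 σ x b) : BadBuckets x φ := by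
  set w := bucketMass φ.2.2 σ x b with hw
  set s := smallIn φ.2.2 σ x b with hs
  have hsub : s ⊆ lightSet x := fun i hi => by
    have := (mem_smallIn.mp hi).1
    simp only [lightSet, Finset.mem_filter, Finset.mem_univ, true_and]
    exact ⟨this.1, by linarith⟩
  have h1 : w * (w - 1 / 5) ≤ pairWeight s x φ.2.2 := by
    have e : w * (w - 1 / 5) = ∑ i ∈ s, x i * (w - 1 / 5) := by rw [← Finset.sum_mul]; rfl
    rw [e]
    refine Finset.sum_le_sum fun i hi => ?_
    have hi' := mem_smallIn.mp hi
    have e2 : ∑ j ∈ s.erase i, (if φ.2.2 i = φ.2.2 j then x i * x j else 0) =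
        x i * (w - x i) := by
      rw [hw, bucketMass, ← Finset.add_sum_erase _ _ hi, add_sub_cancel_left, Finset.mul_sum]
      refine Finset.sum_congr rfl fun j hj => if_pos ?_
      rw [hi'.2, (mem_smallIn.mp (Finset.mem_of_mem_erase hj)).2]
    rw [e2]
    exact mul_le_mul_of_nonneg_left (by linarith [hi'.1.2]) (hx i)
  have h2 : pairWeight s x φ.2.2 ≤ pairWeight (lightSet x) x φ.2.2 := by
    have h0 : ∀ i j, 0 ≤ if φ.2.2 i = φ.2.2 j then x i * x j else 0 := fun i j => by
      split_ifs
      exacts [mul_nonneg (hx i) (hx j), le_rfl]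
    refine (Finset.sum_le_sum fun i _ => Finset.sum_le_sum_of_subset_of_nonneg
      (Finset.erase_subset_erase i hsub) fun j _ _ => h0 i j).trans
      (Finset.sum_le_sum_of_subset_of_nonneg hsub fun i _ _ =>
        Finset.sum_nonneg fun j _ => h0 i j)
  have h3 : (63 / 100 : ℝ) ≤ w * (w - 1 / 5) := by nlinarith
  exact h3.trans (h1.trans h2)

/-- The failures that depend on the hashes and buckets only. -/
def Bad (x : Fin n → ℝ) (φ : HashFuns n m) : Prop := BadHash x φ ∨ BadBuckets x φ

lemma bad_of_not_good {φ : HashFuns n m} {σ τ : ℝ} (hσ0 : 0 ≤ σ) (hσ : σ ≤ 1 / 10)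
    (hτ : τ ≤ 1 / 10) {x : Fin n → ℝ} (hx : ∀ i, 0 ≤ x i) (h : ¬ Good φ σ τ x) : Bad x φ := by
  rcases not_not.mp h with h | h
  · exact Or.inl (badHash_of_collision hσ0 h)
  · simp only [Heavy] at h
    obtain ⟨b, hb⟩ := h
    refine Or.inr (badBuckets_of_heavy hσ hx (b := b) ?_)
    unfold bucketMass
    linarith

variable {x : Fin n → ℝ} {p : Fin n} {δ : ℝ}

/-- The values of `τ` that separate the mass of the bucket of `p` before and after an increase
by `δ`. -/
def tauWindow (x : Fin n → ℝ) (p : Fin n) (δ : ℝ) (φ : HashFuns n m) (σ : ℝ) : Set ℝ :=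
  Set.Ioc (1 - (bucketMass φ.2.2 σ x (φ.2.2 p) + δ)) (1 - bucketMass φ.2.2 σ x (φ.2.2 p))

/-- The values of `σ` for which `p` changes from small to large. -/
def sigmaWindow (x : Fin n → ℝ) (p : Fin n) (δ : ℝ) : Set ℝ :=
  Set.Ico (x p - 1 / 10) (x p + δ - 1 / 10)

lemma good_iff (φ : HashFuns n m) (σ τ : ℝ) (x : Fin n → ℝ) : Good φ σ τ x ↔
    (∀ h : Fin (m ^ 3), ((largeSet σ x).filter fun i => φ.2.1 i = h).card
      + (Finset.univ.filter fun b : Fin m => φ.1 b = h).card ≤ 1) ∧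
    ∀ b, bucketMass φ.2.2 σ x b ≤ 1 - τ := by
  simp only [Good, Collision, Heavy, not_or, not_exists, not_lt, bucketMass]

/-- Without a crossing of the threshold, an increase of one coordinate by `δ` changes whether the
run is good only for `τ` in a window of length `δ`. -/
lemma good_iff_of_noncrossing (hx : ∀ i, 0 ≤ x i) (hδ : 0 < δ) {φ : HashFuns n m} {σ τ : ℝ}
    (hσ : σ ∉ sigmaWindow x p δ) (hτ : τ ∉ tauWindow x p δ φ σ) :
    Good φ σ τ x ↔ Good φ σ τ (Function.update x p (x p + δ)) := by
  set y := Function.update x p (x p + δ) with hydef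
  have hxy : ∀ i, i ≠ p → x i = y i := fun i hi => (Function.update_of_ne hi _ _).symm
  have hyp : y p = x p + δ := Function.update_self _ _ _
  have hne : ∀ b, φ.2.2 p ≠ b → bucketMass φ.2.2 σ x b = bucketMass φ.2.2 σ y b := fun b hb => by
    rw [← sum_mask_smallIn, ← sum_mask_smallIn, mask_smallIn_congr_of_ne hxy hb]
  have hcase : (1 / 10 + σ < x p ∧ 1 / 10 + σ < y p) ∨
      (¬ 1 / 10 + σ < x p ∧ ¬ 1 / 10 + σ < y p) := by
    by_contra hcon
    refine hσ ?_
    simp only [sigmaWindow, Set.mem_Ico]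
    rw [hyp] at hcon
    grind
  have hL : largeSet σ x = largeSet σ y := largeSet_eq_of_iff hxy (by tauto)
  rw [good_iff, good_iff, hL]
  refine and_congr_right fun _ => forall_congr' fun b => ?_
  by_cases hb : φ.2.2 p = b
  · subst hb
    rcases hcase with ⟨h1, h2⟩ | ⟨-, h2⟩
    · rw [← sum_mask_smallIn, ← sum_mask_smallIn, mask_smallIn_congr_of_large hxy h1 h2]
    · rw [hydef, bucketMass_update φ.2.2 hx hδ (by rw [not_lt, hyp] at h2; exact h2)]
      simp only [tauWindow, Set.mem_Ioc] at hτ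
      constructor <;> intro h <;> grind
  · rw [hne b hb]

variable {K : RandAlg (m ^ 3)} {S : ℝ} {A : RandAlg n} {k : ℕ} {α : ℝ}

/-- The expected change of the output, for a fixed hash seed. -/
def runCost (A : RandAlg n) (K : RandAlg (m ^ 3)) (x y : Fin n → ℝ) (ρ : HashSeed n m) : ENNReal :=
  ∫⁻ r, ∫⁻ a, ∫⁻ κ, ((symmDiff (compOut A K x r a κ ρ) (compOut A K y r a κ ρ)).card : ENNReal)
    ∂K.law ∂A.law ∂clockLaw n

lemma card_le_of_floor_or_ceil {x : Fin n → ℝ} (hx : x ∈ hypersimplex n k) {T : Finset (Fin n)}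
    (h : T.card = ⌊l1 x⌋₊ ∨ T.card = ⌈l1 x⌉₊) : T.card ≤ k := by
  rcases h with h | h <;> rw [h]
  · exact (Nat.floor_le_ceil _).trans (Nat.ceil_le.mpr hx.2)
  · exact Nat.ceil_le.mpr hx.2

/-- The trivial bound, for the case that only one of the runs fails: almost surely both outputs have
at most k elements. -/
lemma runCost_le (hK : IsRounding K S) (hA : IsCorrelatedSampling k A α) {y : Fin n → ℝ}
    (hx : x ∈ hypersimplex n k) (hy : y ∈ hypersimplex n k) {ρ : HashSeed n m}
    (hτ : 0 < ρ.2.2.2.2) : runCost A K x y ρ ≤ 2 * k := by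
  have := hK.prob
  have := hA.prob
  have h : ∀ᵐ a ∂A.law, ∀ᵐ κ ∂K.law, ∀ r, ∀ z ∈ hypersimplex n k,
      (compOut A K z r a κ ρ).card ≤ k := by
    filter_upwards [hA.cardinality] with a ha
    filter_upwards [card_goodRun n hK] with κ hκ r z hz
    refine card_le_of_floor_or_ceil hz ?_
    by_cases hg : GoodSeed ρ z
    · rw [compOut_of_good (fun i => (hz.1 i).1) hg]
      exact hκ z hz.1 r ρ hg hτ
    · rw [compOut_of_not_good hg]
      exact ha z hz
  have h2 : ∀ r, ∫⁻ a, ∫⁻ κ, ((symmDiff (compOut A K x r a κ ρ)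
      (compOut A K y r a κ ρ)).card : ENNReal) ∂K.law ∂A.law ≤ 2 * k := by
    intro r
    refine (lintegral_mono_ae (g := fun _ => 2 * (k : ENNReal)) ?_).trans (by simp)
    filter_upwards [h] with a ha
    refine (lintegral_mono_ae (g := fun _ => 2 * (k : ENNReal)) ?_).trans (by simp)
    filter_upwards [ha] with κ hκ
    have := (Finset.card_le_card (Finset.symmDiff_subset_union (s := compOut A K x r a κ ρ)
      (t := compOut A K y r a κ ρ))).trans ((Finset.card_union_le _ _).trans
      (add_le_add (hκ r x hx) (hκ r y hy)))
    rw [← two_mul] at this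
    exact_mod_cast this
  exact (lintegral_mono h2).trans (by simp)

lemma runCost_le_of_not_good (hK : IsRounding K S) (hA : IsCorrelatedSampling k A α)
    {y : Fin n → ℝ} (hx : x ∈ hypersimplex n k) (hy : y ∈ hypersimplex n k) {ρ : HashSeed n m}
    (hgx : ¬ GoodSeed ρ x) (hgy : ¬ GoodSeed ρ y) :
    runCost A K x y ρ ≤ ENNReal.ofReal (α * l1 (x - y)) := by
  have := hK.prob
  have := hA.prob
  unfold runCost
  simp only [compOut_of_not_good hgx, compOut_of_not_good hgy, lintegral_const, measure_univ,
    mul_one]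
  exact hA.stretch_le x hx y hy

lemma runCost_of_good [IsProbabilityMeasure A.law] {y : Fin n → ℝ} (hx : ∀ i, 0 ≤ x i)
    (hy : ∀ i, 0 ≤ y i) {ρ : HashSeed n m} (hgx : GoodSeed ρ x) (hgy : GoodSeed ρ y) :
    runCost A K x y ρ = ∫⁻ r, ∫⁻ κ, ((symmDiff (goodRun K x (ρ, r, κ))
      (goodRun K y (ρ, r, κ))).card : ENNReal) ∂K.law ∂clockLaw n := by
  unfold runCost
  simp only [compOut_of_good hx hgx, compOut_of_good hy hgy, lintegral_const, measure_univ,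
    mul_one]

end CorrSampling
end

noncomputable section
namespace CorrSampling

/-! ### The stretch of the composed algorithm -/

variable {n m : ℕ}

lemma unifIcc_Ico_le {a b : ℝ} (hab : a < b) (c d : ℝ) :
    unifIcc a b (Set.Ico c d) ≤ ENNReal.ofReal ((d - c) / (b - a)) := by
  rw [unifIcc_eq, Measure.smul_apply, smul_eq_mul, ENNReal.ofReal_div_of_pos (by linarith),
    div_eq_mul_inv, mul_comm]
  gcongr
  exact (Measure.restrict_apply_le _ _).trans (by simp)

lemma lintegral_const_add_indicator_le {Ω : Type*} [MeasurableSpace Ω] (μ : Measure Ω)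
    [IsProbabilityMeasure μ] (c d : ENNReal) {s : Set Ω} {e : ENNReal} (h : μ s ≤ e) :
    ∫⁻ ω, (c + s.indicator (fun _ => d) ω) ∂μ ≤ c + d * e := by
  rw [lintegral_add_left measurable_const, lintegral_const, measure_univ, mul_one]
  exact add_le_add_right ((lintegral_indicator_const_le s d).trans (mul_le_mul_right h d)) _

variable {x : Fin n → ℝ} {p : Fin n} {δ : ℝ} {K : RandAlg (m ^ 3)} {S : ℝ} {A : RandAlg n} {k : ℕ}
  {α : ℝ}

/-- The number of bad events among those for `x` and `y`. -/
def badCount (x y : Fin n → ℝ) (φ : HashFuns n m) : ENNReal :=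
  Set.indicator {φ | Bad x φ} 1 φ + Set.indicator {φ | Bad y φ} 1 φ

lemma one_le_badCount {y : Fin n → ℝ} {φ : HashFuns n m} (h : Bad x φ ∨ Bad y φ) :
    1 ≤ badCount x y φ := by
  unfold badCount
  rcases h with h | h
  · rw [Set.indicator_of_mem (by exact h)]
    exact le_self_add
  · rw [Set.indicator_of_mem (s := {φ | Bad y φ}) (by exact h)]
    exact le_add_self

lemma lintegral_badCount_le (hm : 0 < m) (hk : 2 ≤ k) (hkm : 10 * k ≤ m) {y : Fin n → ℝ}
    (hx : x ∈ hypersimplex n k) (hy : y ∈ hypersimplex n k) :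
    ∫⁻ φ, badCount x y φ ∂hashFunsLaw n m ≤ ENNReal.ofReal (6 * k ^ 2 / m) := by
  have h1 : hashFunsLaw n m {φ | Bad x φ} ≤ _ := hashFunsLaw_bad_le hm hk hkm hx
  have h2 : hashFunsLaw n m {φ | Bad y φ} ≤ _ := hashFunsLaw_bad_le hm hk hkm hy
  unfold badCount
  rw [lintegral_add_left Measurable.of_discrete, lintegral_indicator_one MeasurableSet.of_discrete,
    lintegral_indicator_one MeasurableSet.of_discrete]
  refine (add_le_add h1 h2).trans_eq ?_
  rw [← ENNReal.ofReal_add (by positivity) (by positivity)]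
  congr 1
  ring

/-- The summands pay for two good runs without crossing, two failing runs, a crossing (good or not),
and a run that fails alone because τ separates the two bucket masses. As soon as a run fails,
`badCount` is at least 1 and may be used as a factor. -/
lemma runCost_le_sum (hK : IsRounding K S) (hS : 0 ≤ S) (hA : IsCorrelatedSampling k A α)
    (hδ : 0 < δ) (hx : x ∈ hypersimplex n k)
    (hy : Function.update x p (x p + δ) ∈ hypersimplex n k) {φ : HashFuns n m} {σ τ : ℝ}
    (hσ0 : 0 ≤ σ) (hσ1 : σ ≤ 1 / 10) (hτ0 : 0 < τ) (hτ1 : τ ≤ 1 / 10) :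
    runCost A K x (Function.update x p (x p + δ)) (φ.1, φ.2.1, φ.2.2, σ, τ) ≤
      ENNReal.ofReal ((S + 2) * δ) +
        ENNReal.ofReal (α * δ) * badCount x (Function.update x p (x p + δ)) φ +
        (sigmaWindow x p δ).indicator (fun _ => ENNReal.ofReal (2 * S + 4) +
          2 * k * badCount x (Function.update x p (x p + δ)) φ) σ +
        (tauWindow x p δ φ σ).indicator
          (fun _ => 2 * k * badCount x (Function.update x p (x p + δ)) φ) τ := by
  have := hA.prob
  set y := Function.update x p (x p + δ) with hydef
  have hxy : ∀ i, i ≠ p → x i = y i := fun i hi => (Function.update_of_ne hi _ _).symm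
  have hx0 := fun i => (hx.1 i).1
  have hy0 := fun i => (hy.1 i).1
  have hl1 : l1 (x - y) = δ := by
    rw [l1_of_single (p := p) fun i hi => by simp [hxy i hi], Pi.sub_apply, hydef,
      Function.update_self, sub_add_cancel_left, abs_neg, abs_of_pos hδ]
  have hmul : ∀ c : ENNReal, Bad x φ ∨ Bad y φ → c ≤ c * badCount x y φ := fun c h =>
    le_mul_of_one_le_right' (one_le_badCount h)
  have h2k : runCost A K x y (φ.1, φ.2.1, φ.2.2, σ, τ) ≤ 2 * k := runCost_le hK hA hx hy hτ0
  have hbx := bad_of_not_good (φ := φ) hσ0 hσ1 hτ1 hx0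
  have hby := bad_of_not_good (φ := φ) hσ0 hσ1 hτ1 hy0
  by_cases hg : Good φ σ τ x ∧ Good φ σ τ y
  · have e := runCost_of_good (K := K) (A := A) (ρ := (φ.1, φ.2.1, φ.2.2, σ, τ)) hx0 hy0
      hg.1 hg.2
    by_cases hc : σ ∈ sigmaWindow x p δ
    · rw [Set.indicator_of_mem hc, e]
      refine (lintegral_goodRun_le_of_good hK hS hxy hx.1 hy.1 hτ0 hg.1 hg.2).trans ?_
      exact le_self_add.trans (le_add_self.trans le_self_add)
    · rw [e]
      refine (lintegral_goodRun_le_of_noncrossing hK hS hx.1 hδ hy.1 hτ0 ?_ hg.1 hg.2).trans ?_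
      · simp only [sigmaWindow, Set.mem_Ico] at hc
        grind
      · exact le_self_add.trans (le_self_add.trans le_self_add)
  · have hb : Bad x φ ∨ Bad y φ := by
      rw [not_and_or] at hg
      exact hg.imp hbx hby
    by_cases hc : σ ∈ sigmaWindow x p δ
    · rw [Set.indicator_of_mem hc]
      exact (h2k.trans (hmul _ hb)).trans (le_add_self.trans (le_add_self.trans le_self_add))
    by_cases hw : τ ∈ tauWindow x p δ φ σ
    · rw [Set.indicator_of_mem hw]
      exact (h2k.trans (hmul _ hb)).trans le_add_self
    have hiff := good_iff_of_noncrossing hx0 hδ hc hw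
    have hnx : ¬ Good φ σ τ x := fun h => hg ⟨h, hiff.mp h⟩
    have hny : ¬ Good φ σ τ y := fun h => hg ⟨hiff.mpr h, h⟩
    refine (runCost_le_of_not_good (ρ := (φ.1, φ.2.1, φ.2.2, σ, τ)) hK hA hx hy hnx hny).trans ?_
    rw [hl1]
    exact (hmul _ hb).trans (le_add_self.trans (le_self_add.trans le_self_add))

/-- Both windows have length δ in an interval of length 1/10, hence probability at most 10δ. So 21S
+ 42 is (S + 2) + 10(2S + 4), and 40k is 2k · 10 for each of the two windows. The factor `badCount`
is independent of σ and τ. -/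
lemma lintegral_runCost_le (hm : 0 < m) (hk : 2 ≤ k) (hkm : 10 * k ≤ m) (hK : IsRounding K S)
    (hS : 0 ≤ S) (hα : 0 ≤ α) (hA : IsCorrelatedSampling k A α) (hδ : 0 < δ)
    (hx : x ∈ hypersimplex n k) (hy : Function.update x p (x p + δ) ∈ hypersimplex n k) :
    ∫⁻ ρ, runCost A K x (Function.update x p (x p + δ)) ρ ∂hashLaw n m ≤
      ENNReal.ofReal ((21 * S + 42 + (α + 40 * k) * (6 * k ^ 2 / m)) * δ) := by
  have := isProbabilityMeasure_hashFunsLaw n hm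
  set y := Function.update x p (x p + δ) with hydef
  set β := badCount (m := m) x y with hβ
  set e := ENNReal.ofReal (10 * δ) with he
  set s₁ := ENNReal.ofReal ((S + 2) * δ)
  set s₂ := ENNReal.ofReal (2 * S + 4)
  set F : HashSeed n m → ENNReal := fun ρ =>
    s₁ + ENNReal.ofReal (α * δ) * β (funsOf ρ) +
        (sigmaWindow x p δ).indicator (fun _ => s₂ + 2 * k * β (funsOf ρ)) ρ.2.2.2.1 +
        (tauWindow x p δ (funsOf ρ) ρ.2.2.2.1).indicator
          (fun _ => 2 * k * β (funsOf ρ)) ρ.2.2.2.2 with hF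
  have h1 : ∫⁻ ρ, runCost A K x y ρ ∂hashLaw n m ≤ ∫⁻ ρ, F ρ ∂hashLaw n m := by
    refine lintegral_mono_ae ?_
    filter_upwards [ae_hashLaw n hm] with ρ hρ
    obtain ⟨R, C, B, σ, τ⟩ := ρ
    exact runCost_le_sum (φ := (R, C, B)) hK hS hA hδ hx hy hρ.1.1.le hρ.1.2 hρ.2.1 hρ.2.2
  refine h1.trans ((lintegral_hashLaw_le n hm F).trans ?_)
  have hτ : ∀ (φ : HashFuns n m) σ, unifIcc 0 (1 / 10) (tauWindow x p δ φ σ : Set ℝ) ≤ e := fun φ σ =>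
    (unifIcc_Ioc_le (by norm_num) _ _).trans (ENNReal.ofReal_le_ofReal (le_of_eq (by ring)))
  have hσ : unifIcc 0 (1 / 10) (sigmaWindow x p δ) ≤ e :=
    (unifIcc_Ico_le (by norm_num) _ _).trans (ENNReal.ofReal_le_ofReal (le_of_eq (by ring)))
  have h2 : ∀ φ : HashFuns n m, ∫⁻ σ, ∫⁻ τ, F (φ.1, φ.2.1, φ.2.2, σ, τ)
      ∂unifIcc 0 (1 / 10) ∂unifIcc 0 (1 / 10) ≤
      s₁ + s₂ * e + (ENNReal.ofReal (α * δ) + 4 * k * e) * β φ := by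
    intro φ
    have h3 : ∀ σ, ∫⁻ τ, F (φ.1, φ.2.1, φ.2.2, σ, τ) ∂unifIcc 0 (1 / 10) ≤
        (s₁ + ENNReal.ofReal (α * δ) * β φ + 2 * k * β φ * e) +
        (sigmaWindow x p δ).indicator (fun _ => s₂ + 2 * k * β φ) σ := by
      intro σ
      have := lintegral_const_add_indicator_le (unifIcc 0 (1 / 10))
        (s₁ + ENNReal.ofReal (α * δ) * β φ + (sigmaWindow x p δ).indicator
          (fun _ => s₂ + 2 * k * β φ) σ) (2 * k * β φ) (hτ φ σ)
      exact this.trans_eq (add_right_comm _ _ _)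
    refine (lintegral_mono h3).trans ((lintegral_const_add_indicator_le (unifIcc 0 (1 / 10)) _ _
      hσ).trans_eq ?_)
    ring
  refine (lintegral_mono h2).trans ?_
  rw [lintegral_add_left measurable_const, lintegral_const_mul _ Measurable.of_discrete,
    lintegral_const, measure_univ, mul_one]
  refine (add_le_add_right (mul_le_mul_right (lintegral_badCount_le hm hk hkm hx hy) _) _).trans ?_
  have e4 : (4 * k : ENNReal) = ENNReal.ofReal (4 * k) := by
    rw [ENNReal.ofReal_mul (by norm_num)]; simp
  rw [e4, he, ← ENNReal.ofReal_mul (by positivity), ← ENNReal.ofReal_mul (by positivity),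
    ← ENNReal.ofReal_add (by positivity) (by positivity),
    ← ENNReal.ofReal_add (by positivity) (by positivity), ← ENNReal.ofReal_mul (by positivity),
    ← ENNReal.ofReal_add (by positivity) (by positivity)]
  exact ENNReal.ofReal_le_ofReal (le_of_eq (by ring))

/-! ### Reduction to changes of a single coordinate -/

lemma mem_hypersimplex_of_le {x y : Fin n → ℝ} (hy : y ∈ hypersimplex n k) (hx : ∀ i, 0 ≤ x i)
    (h : ∀ i, x i ≤ y i) : x ∈ hypersimplex n k := by
  refine ⟨fun i => ⟨hx i, (h i).trans (hy.1 i).2⟩, ?_⟩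
  refine le_trans ?_ hy.2
  rw [l1_of_nonneg hx, l1_of_nonneg fun i => (hy.1 i).1]
  exact Finset.sum_le_sum fun i _ => h i

lemma lintegral_symmDiff_triangle {A : RandAlg n}
    (hA : ∀ x ∈ hypersimplex n k, Measurable fun ω => A.run ω x) {x y z : Fin n → ℝ}
    (hx : x ∈ hypersimplex n k) (hy : y ∈ hypersimplex n k) :
    ∫⁻ ω, ((symmDiff (A.run ω x) (A.run ω z)).card : ENNReal) ∂A.law ≤
      ∫⁻ ω, ((symmDiff (A.run ω x) (A.run ω y)).card : ENNReal) ∂A.law +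
      ∫⁻ ω, ((symmDiff (A.run ω y) (A.run ω z)).card : ENNReal) ∂A.law := by
  rw [← lintegral_add_left (measurable_card_symmDiff (hA x hx) (hA y hy))]
  refine lintegral_mono fun ω => ?_
  have := (Finset.card_le_card (symmDiff_triangle (A.run ω x) (A.run ω y) (A.run ω z))).trans
    (Finset.card_union_le _ _)
  exact (Nat.cast_le.mpr this).trans_eq (Nat.cast_add _ _)

/-- The hypersimplex is closed downwards, so x and y can be joined through x ⊓ y, raising
coordinates one at a time without leaving it. The ℓ₁ lengths of this path add up to that of x - y.
-/
lemma hasStretch_of_single {A : RandAlg n} (hα : 0 ≤ α)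
    (hA : ∀ x ∈ hypersimplex n k, Measurable fun ω => A.run ω x)
    (h : ∀ x ∈ hypersimplex n k, ∀ p δ, 0 < δ →
      Function.update x p (x p + δ) ∈ hypersimplex n k →
      ∫⁻ ω, ((symmDiff (A.run ω x) (A.run ω (Function.update x p (x p + δ)))).card : ENNReal)
        ∂A.law ≤ ENNReal.ofReal (α * δ)) : HasStretch k A α := by
  classical
  have mono : ∀ x ∈ hypersimplex n k, ∀ y ∈ hypersimplex n k, (∀ i, x i ≤ y i) →
      ∫⁻ ω, ((symmDiff (A.run ω x) (A.run ω y)).card : ENNReal) ∂A.law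
        ≤ ENNReal.ofReal (α * l1 (x - y)) := by
    intro x hx y hy hxy
    have key : ∀ s : Finset (Fin n), ∫⁻ ω, ((symmDiff (A.run ω x)
        (A.run ω (s.piecewise y x))).card : ENNReal) ∂A.law
        ≤ ENNReal.ofReal (α * ∑ i ∈ s, (y i - x i)) := by
      intro s
      have hmem : ∀ s : Finset (Fin n), s.piecewise y x ∈ hypersimplex n k := fun s => by
        refine mem_hypersimplex_of_le hy (fun i => ?_) fun i => ?_
        · exact Finset.piecewise_cases s y x (fun t => 0 ≤ t) (hy.1 i).1 (hx.1 i).1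
        · exact Finset.piecewise_cases s y x (fun t => t ≤ y i) le_rfl (hxy i)
      induction s using Finset.induction_on with
      | empty => simp
      | insert p s hp ih =>
        rw [Finset.sum_insert hp, mul_add, add_comm, ENNReal.ofReal_add
          (mul_nonneg hα (Finset.sum_nonneg fun i _ => sub_nonneg.mpr (hxy i)))
          (mul_nonneg hα (sub_nonneg.mpr (hxy p)))]
        refine (lintegral_symmDiff_triangle hA hx (hmem s)).trans (add_le_add ih ?_)
        have e : (insert p s).piecewise y x = Function.update (s.piecewise y x) p
            (s.piecewise y x p + (y p - x p)) := by
          rw [Finset.piecewise_insert, Finset.piecewise_eq_of_notMem _ _ _ hp,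
            add_sub_cancel]
        rcases (hxy p).eq_or_lt with h0 | h0
        · rw [e, h0, sub_self, add_zero, Function.update_eq_self]
          simp
        · have := hmem (insert p s)
          rw [e] at this ⊢
          exact h _ (hmem s) p _ (sub_pos.mpr h0) this
    have := key Finset.univ
    rw [Finset.piecewise_univ] at this
    refine this.trans_eq ?_
    congr 2
    refine Finset.sum_congr rfl fun i _ => ?_
    rw [Pi.sub_apply, abs_sub_comm, abs_of_nonneg (sub_nonneg.mpr (hxy i))]
  intro x hx y hy
  have hz : x ⊓ y ∈ hypersimplex n k :=
    mem_hypersimplex_of_le hx (fun i => le_min (hx.1 i).1 (hy.1 i).1) fun i => min_le_left _ _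
  have h1 := mono _ hz x hx fun i => min_le_left _ _
  have h2 := mono _ hz y hy fun i => min_le_right _ _
  have e : l1 (x - y) = l1 (x ⊓ y - x) + l1 (x ⊓ y - y) := by
    unfold l1
    rw [← Finset.sum_add_distrib]
    refine Finset.sum_congr rfl fun i _ => ?_
    simp only [Pi.sub_apply, Pi.inf_apply]
    rcases le_total (x i) (y i) with h | h
    · simp [h]
    · simp [h, abs_sub_comm]
  have h0 : ∀ v : Fin n → ℝ, 0 ≤ α * l1 v := fun v =>
    mul_nonneg hα (Finset.sum_nonneg fun _ _ => abs_nonneg _)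
  rw [e, mul_add, ENNReal.ofReal_add (h0 _) (h0 _)]
  refine (lintegral_symmDiff_triangle hA hx hz).trans (add_le_add ?_ h2)
  simpa only [symmDiff_comm] using h1

/-- The number of buckets is large enough for failures to contribute at most 3, so α disappears from
the stretch and survives only through the dimension m³ of K. -/
lemma isCorrelatedSampling_composedWith (hk : 2 ≤ k) (hK : IsRounding K S) (hS : 0 ≤ S)
    (hα : 1 ≤ α) (hA : IsCorrelatedSampling k A α) (hm : (2 : ℝ) ^ 5 * k ^ 5 * α ^ 5 ≤ m) :
    IsCorrelatedSampling k (composedWith A K) (21 * S + 45) := by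
  have hk2 : (2 : ℝ) ≤ k := by exact_mod_cast hk
  have hα5 : α ≤ α ^ 5 := le_self_pow₀ hα (by norm_num)
  have hk4 : (16 : ℝ) ≤ k ^ 4 := by
    calc (16 : ℝ) = 2 ^ 4 := by norm_num
      _ ≤ k ^ 4 := pow_le_pow_left₀ (by norm_num) hk2 4
  have hmk : (32 : ℝ) * k ^ 5 ≤ m := by
    refine le_trans ?_ hm
    have : (1 : ℝ) ≤ α ^ 5 := hα.trans hα5
    have h0 : (0 : ℝ) ≤ 32 * k ^ 5 := by positivity
    nlinarith
  have hmα : (32 : ℝ) * k ^ 5 * α ≤ m := by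
    refine le_trans ?_ hm
    have h0 : (0 : ℝ) ≤ 32 * k ^ 5 := by positivity
    nlinarith
  have hm0 : (0 : ℝ) < m := lt_of_lt_of_le (by positivity) hmk
  have hm0' : 0 < m := by exact_mod_cast hm0
  have hkm : 10 * k ≤ m := by
    have : (10 * k : ℝ) ≤ m := by nlinarith
    exact_mod_cast this
  have hk3 : (8 : ℝ) ≤ k ^ 3 := by
    calc (8 : ℝ) = 2 ^ 3 := by norm_num
      _ ≤ k ^ 3 := pow_le_pow_left₀ (by norm_num) hk2 3
  have hsmall : (α + 40 * k) * (6 * k ^ 2 / m) ≤ 3 := by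
    rw [← mul_div_assoc, div_le_iff₀ hm0]
    have h1 : 6 * k ^ 2 * α ≤ 1 * m := by
      refine le_trans ?_ (hmα.trans_eq (one_mul _).symm)
      have : (0 : ℝ) ≤ k ^ 2 * α := by positivity
      nlinarith
    have h2 : 240 * (k : ℝ) ^ 3 ≤ 2 * m := by
      have : (0 : ℝ) ≤ k ^ 3 := by positivity
      have : (4 : ℝ) ≤ k ^ 2 := by nlinarith
      nlinarith
    nlinarith
  have := hA.prob
  have := hK.prob
  have hmeas : ∀ x ∈ hypersimplex n k, Measurable fun ω => (composedWith A K).run ω x :=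
    fun x hx => measurable_composedWith hK.meas (fun i => (hx.1 i).1) (hA.measurable hx)
  refine ⟨isProbabilityMeasure_composedWith hm0' A, fun x hx s => ?_,
    cardinality_composedWith hm0' hK hA, fun x hx i => marginals_composedWith hm0' hK hA hx i,
    hasStretch_of_single (by positivity) hmeas fun x hx p δ hδ hy => ?_⟩
  · exact hmeas x hx (MeasurableSet.singleton s)
  · have e := lintegral_composedWith hm0' hK (fun i => (hx.1 i).1) (fun i => (hy.1 i).1)
      (hA.measurable hx) (hA.measurable hy) fun s t => ((symmDiff s t).card : ENNReal)
    rw [e]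
    refine (lintegral_runCost_le hm0' hk hkm hK hS (by linarith) hA hδ hx hy).trans
      (ENNReal.ofReal_le_ofReal (mul_le_mul_of_nonneg_right (by linarith) hδ.le))

end CorrSampling
end

noncomputable section
namespace CorrSampling

/-! ### The stretch of an algorithm -/

variable {n k : ℕ} {A : RandAlg n} {α β : ℝ}

lemma l1_nonneg (v : Fin n → ℝ) : 0 ≤ l1 v := Finset.sum_nonneg fun _ _ => abs_nonneg _

lemma HasStretch.mono (h : HasStretch k A α) (hαβ : α ≤ β) : HasStretch k A β := fun x hx y hy =>
  (h x hx y hy).trans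
    (ENNReal.ofReal_le_ofReal (mul_le_mul_of_nonneg_right hαβ (l1_nonneg _)))

lemma IsCorrelatedSampling.mono (h : IsCorrelatedSampling k A α) (hαβ : α ≤ β) :
    IsCorrelatedSampling k A β :=
  ⟨h.prob, h.meas, h.cardinality, h.marginals, h.stretch_le.mono hαβ⟩

/-- The infimum is attained: each pair x, y gives a closed condition on α, vacuous in α when x and y
have distance 0. -/
lemma hasStretch_stretch (hα : 0 ≤ α) (h : HasStretch k A α) : HasStretch k A (stretch k A) := by
  intro x hx y hy
  have hne : {α : ℝ | 0 ≤ α ∧ HasStretch k A α}.Nonempty := ⟨α, hα, h⟩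
  set I := ∫⁻ ω, ((symmDiff (A.run ω x) (A.run ω y)).card : ENNReal) ∂A.law with hI
  have hfin : I ≠ ⊤ := ((h x hx y hy).trans_lt ENNReal.ofReal_lt_top).ne
  rcases (l1_nonneg (x - y)).eq_or_lt with h0 | h0
  · have := h x hx y hy
    rw [← h0, mul_zero] at this ⊢
    exact this
  · rw [stretch, ENNReal.le_ofReal_iff_toReal_le hfin
      (mul_nonneg (le_csInf hne fun a ha => ha.1) h0.le), ← div_le_iff₀ h0]
    refine le_csInf hne fun a ha => ?_
    rw [div_le_iff₀ h0]
    exact (ENNReal.le_ofReal_iff_toReal_le hfin (mul_nonneg ha.1 h0.le)).mp (ha.2 x hx y hy)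

/-- By the marginals, coordinate i is almost surely absent for input 0 and almost surely present for
the unit vector, at distance 1. -/
lemma one_le_of_isCorrelatedSampling (hn : 1 ≤ n) (hk : 1 ≤ k)
    (hA : IsCorrelatedSampling k A α) : 1 ≤ α := by
  set i : Fin n := ⟨0, hn⟩
  have hk1 : (1 : ℝ) ≤ k := by exact_mod_cast hk
  have hl : l1 (Pi.single i (1 : ℝ)) = 1 := by
    rw [l1_of_single (p := i) fun j hj => by simp [hj]]
    simp
  have hx : (0 : Fin n → ℝ) ∈ hypersimplex n k := ⟨by simp, by simp [l1]⟩
  have hy : Pi.single i (1 : ℝ) ∈ hypersimplex n k := by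
    refine ⟨fun j => ?_, hl.trans_le hk1⟩
    rcases eq_or_ne j i with rfl | hj
    · simp
    · simp [hj]
  have hsub : {ω | i ∈ A.run ω (Pi.single i (1 : ℝ))} ⊆
      {ω | i ∈ A.run ω 0} ∪ {ω | i ∈ symmDiff (A.run ω 0) (A.run ω (Pi.single i 1))} := by
    intro ω hω
    by_cases h : i ∈ A.run ω 0
    · exact Or.inl h
    · exact Or.inr (Finset.mem_symmDiff.mpr (Or.inr ⟨hω, h⟩))
  have h1 := (measure_mono hsub).trans (measure_union_le (μ := A.law) _ _)
  rw [hA.marginals _ hy, hA.marginals _ hx] at h1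
  simp only [Pi.single_eq_same, ENNReal.ofReal_one, Pi.zero_apply, ENNReal.ofReal_zero,
    zero_add] at h1
  have h2 : A.law {ω | i ∈ symmDiff (A.run ω 0) (A.run ω (Pi.single i 1))} ≤
      ∫⁻ ω, ((symmDiff (A.run ω 0) (A.run ω (Pi.single i 1))).card : ENNReal) ∂A.law := by
    have hm : MeasurableSet {ω | i ∈ symmDiff (A.run ω 0) (A.run ω (Pi.single i 1))} := by
      simp only [Finset.mem_symmDiff]
      have m1 := measurableSet_mem_run (hA.measurable hx) i
      have m2 := measurableSet_mem_run (hA.measurable hy) i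
      exact (m1.diff m2).union (m2.diff m1)
    rw [← lintegral_indicator_one hm]
    refine lintegral_mono fun ω => ?_
    simp only [Set.indicator, Set.mem_ofPred_eq]
    split_ifs with h
    · exact Nat.one_le_cast.mpr (Finset.card_pos.mpr ⟨i, h⟩)
    · exact zero_le
  have h3 := h1.trans (h2.trans (hA.stretch_le _ hx _ hy))
  rw [zero_sub, show l1 (-Pi.single i (1 : ℝ)) = 1 by simpa [l1] using hl, mul_one,
    ENNReal.one_le_ofReal] at h3
  exact h3

/-! ### Logarithms -/

lemma clog_two_le {N : ℕ} (hN : 1 ≤ N) : (Nat.clog 2 N : ℝ) ≤ Real.logb 2 N + 1 := by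
  have h : ⌈Real.logb 2 N⌉₊ = Nat.clog 2 N := by
    exact_mod_cast Real.natCeil_logb_natCast 2 N
  rw [← h]
  exact (Nat.ceil_lt_add_one (Real.logb_nonneg one_lt_two (by exact_mod_cast hN))).le

lemma logb_two_mul_log_two_le {t : ℝ} (ht : 0 < t) :
    Real.logb 2 t * Real.log 2 ≤ t / 2 - 1 + Real.log 2 := by
  have h2 : 0 < Real.log 2 := Real.log_pos one_lt_two
  have h := Real.log_le_sub_one_of_pos (half_pos ht)
  rw [Real.log_div ht.ne' two_ne_zero] at h
  rw [Real.logb, div_mul_cancel₀ _ h2.ne']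
  linarith

lemma logb_two_le_self {t : ℝ} (ht : 0 < t) : Real.logb 2 t ≤ t := by
  have h := logb_two_mul_log_two_le ht
  have h2 := Real.log_two_gt_d9
  have h3 := Real.log_two_lt_d9
  nlinarith

lemma logb_two_le_sub_half {t : ℝ} (ht : 2 ≤ t) : Real.logb 2 t ≤ t - 1 / 2 := by
  have h := logb_two_mul_log_two_le (t := t) (by linarith)
  have h2 := Real.log_two_gt_d9
  have h3 := Real.log_two_lt_d9
  nlinarith

lemma iterLog_succ (i : ℕ) (t : ℝ) : iterLog (i + 1) t = Real.logb 2 (iterLog i t) :=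
  Function.iterate_succ_apply' _ _ _

/-- Above 2, each logarithm lowers the value by at least 1/2. -/
lemma exists_iterLog_le_one (t : ℝ) : ∃ i, iterLog i t ≤ 1 := by
  have key : ∀ N : ℕ, ∀ t : ℝ, t ≤ 2 + N / 2 → ∃ i, iterLog i t ≤ 1 := by
    intro N
    induction N with
    | zero =>
      intro t ht
      rcases le_or_gt t 1 with h | h
      · exact ⟨0, h⟩
      · refine ⟨1, ?_⟩
        change Real.logb 2 t ≤ 1
        rw [Real.logb_le_iff_le_rpow one_lt_two (by linarith)]
        simpa using ht
    | succ N ih =>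
      intro t ht
      rcases le_or_gt t 2 with h | h
      · exact ih t (h.trans (by linarith [N.cast_nonneg (α := ℝ)]))
      · push_cast at ht
        obtain ⟨i, hi⟩ := ih (Real.logb 2 t) ((logb_two_le_sub_half h.le).trans (by linarith))
        exact ⟨i + 1, hi⟩
  obtain ⟨N, hN⟩ := exists_nat_ge (2 * t)
  exact key N t (by linarith)

lemma iterLog_logStar_le (n : ℕ) : iterLog (logStar n) n ≤ 1 :=
  Nat.sInf_mem (s := {i : ℕ | iterLog i n ≤ 1}) (exists_iterLog_le_one n)

lemma one_lt_iterLog {i : ℕ} (h : i < logStar n) : 1 < iterLog i n :=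
  not_le.mp (Nat.notMem_of_lt_sInf (s := {i : ℕ | iterLog i n ≤ 1}) h)

lemma iterLog_logStar_succ_le (n : ℕ) : iterLog (logStar n + 1) n ≤ 0 := by
  rw [iterLog_succ]
  refine Real.logb_nonpos one_lt_two ?_ (iterLog_logStar_le n)
  rcases Nat.eq_zero_or_eq_succ_pred (logStar n) with h | h
  · rw [h]
    exact n.cast_nonneg
  · rw [h, Nat.succ_eq_add_one, iterLog_succ]
    exact Real.logb_nonneg one_lt_two (one_lt_iterLog (by omega)).le

/-! ### The recursive construction -/

lemma isCorrelatedSampling_treeAlg (hn : 1 ≤ n) (k : ℕ) :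
    IsCorrelatedSampling k (treeAlg n) (1 + 6 * Nat.clog 2 n) := by
  have h := isRounding_treeAlg hn
  refine ⟨h.prob, fun x _ s => h.meas x (MeasurableSet.singleton s), ?_,
    fun x hx => h.marginal x hx.1, fun x hx y hy => h.stretch_le x y hx.1 hy.1⟩
  filter_upwards [h.ae] with ω hω x hx
  exact (hω x hx.1).1

lemma one_le_logb_two (hk : 2 ≤ k) : 1 ≤ Real.logb 2 k := by
  rw [Real.le_logb_iff_rpow_le one_lt_two (by positivity), Real.rpow_one]
  exact_mod_cast hk

lemma logb_numBuckets_le (hk : 2 ≤ k) {s : ℝ} (hs : 1 ≤ s) (hsα : s ≤ α) :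
    Real.logb 2 (numBuckets k s) ≤ 6 + 5 * (Real.logb 2 k + Real.logb 2 α) := by
  have hk0 : (0 : ℝ) < k := by positivity
  have hα0 : 0 < α := by linarith
  have hk1 : (1 : ℝ) ≤ (k : ℝ) ^ 5 := one_le_pow₀ (by exact_mod_cast (by omega : 1 ≤ k))
  have hs1 : (1 : ℝ) ≤ s ^ 5 := one_le_pow₀ hs
  have h1 : (1 : ℝ) ≤ k ^ 5 * s ^ 5 := by nlinarith
  -- Rounding up adds at most 1, and 1 ≤ k⁵s⁵, so the factor 2⁵ grows to at most 2⁶.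
  have hle : (numBuckets k s : ℝ) ≤ 2 ^ 6 * (k ^ 5 * α ^ 5) := by
    refine (Nat.ceil_lt_add_one (by positivity)).le.trans ?_
    have : (k : ℝ) ^ 5 * s ^ 5 ≤ k ^ 5 * α ^ 5 := by gcongr
    nlinarith
  have hpos : (0 : ℝ) < numBuckets k s := by
    have : 0 < numBuckets k s := Nat.ceil_pos.mpr (by positivity)
    exact_mod_cast this
  refine (Real.logb_le_logb_of_le one_lt_two hpos hle).trans_eq ?_
  rw [Real.logb_mul (by positivity) (by positivity), Real.logb_mul (by positivity) (by positivity),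
    Real.logb_pow, Real.logb_pow, Real.logb_pow, Real.logb_self_eq_one one_lt_two]
  push_cast
  ring

/-- The composition turns the stretch `α` into `O(log k + log α)`. -/
lemma isCorrelatedSampling_composedAlg (hn : 1 ≤ n) (hk : 2 ≤ k)
    (hA : IsCorrelatedSampling k A α) :
    IsCorrelatedSampling k (composedAlg k A) (2 ^ 13 * (Real.logb 2 k + Real.logb 2 α)) := by
  have hα : 1 ≤ α := one_le_of_isCorrelatedSampling hn (by omega) hA
  have hα0 : 0 ≤ α := by linarith
  set s := stretch k A with hs
  have hA' : IsCorrelatedSampling k A s :=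
    ⟨hA.prob, hA.meas, hA.cardinality, hA.marginals, hasStretch_stretch hα0 hA.stretch_le⟩
  have hs1 : 1 ≤ s := one_le_of_isCorrelatedSampling hn (by omega) hA'
  have hsα : s ≤ α := csInf_le ⟨0, fun a ha => ha.1⟩ ⟨hα0, hA.stretch_le⟩
  have hm : 0 < numBuckets k s := Nat.ceil_pos.mpr (by positivity)
  rw [composedAlg_eq, ← hs]
  -- With L = log k + log α ≥ 1, the stretch is 66 + 126 · clog(m³) ≤ 192 + 378 log m ≤ 2460 + 1890
  -- L, below 2¹³ L.
  refine (isCorrelatedSampling_composedWith hk (isRounding_treeAlg (pow_pos hm 3))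
    (by positivity) hs1 hA' (Nat.le_ceil _)).mono ?_
  have h1 := clog_two_le (pow_pos hm 3)
  rw [Nat.cast_pow, Real.logb_pow] at h1
  have h2 := logb_numBuckets_le hk hs1 hsα
  have h3 := one_le_logb_two hk
  have h4 : 0 ≤ Real.logb 2 α := Real.logb_nonneg one_lt_two hα
  push_cast at h1
  linarith

/-- The constant is the same at every level, since one composition puts the old constant under a
logarithm. The maximum with 1 keeps the bound valid past log* n, where iterated logarithms leave
their meaningful range. -/
lemma isCorrelatedSampling_recAlg (hn : 1 ≤ n) (hk : 2 ≤ k) (i : ℕ) :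
    IsCorrelatedSampling k (recAlg n k i)
      (2 ^ 18 * (Real.logb 2 k + max 1 (iterLog (i + 1) n))) := by
  have ha := one_le_logb_two hk
  induction i with
  | zero =>
    refine (isCorrelatedSampling_treeAlg hn k).mono ?_
    have h1 := clog_two_le hn
    have h2 : Real.logb 2 n ≤ max 1 (iterLog (0 + 1) n) := le_max_right _ _
    have h3 : 1 ≤ max 1 (iterLog (0 + 1) n) := le_max_left _ _
    linarith
  | succ i ih =>
    refine (isCorrelatedSampling_composedAlg hn hk ih).mono ?_
    set a := Real.logb 2 (k : ℝ)
    set t := iterLog (i + 1) n with ht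
    have hM : 1 ≤ max 1 t := le_max_left _ _
    have hM' : 1 ≤ max 1 (iterLog (i + 1 + 1) n) := le_max_left _ _
    have h1 : Real.logb 2 (max 1 t) ≤ max 1 (iterLog (i + 1 + 1) n) := by
      rw [iterLog_succ, ← ht]
      rcases le_total t 1 with h | h
      · rw [max_eq_left h, Real.logb_one]
        exact zero_le_one.trans (le_max_left _ _)
      · rw [max_eq_right h]
        exact le_max_right _ _
    have h2 : Real.logb 2 (2 ^ 18 * (a + max 1 t)) ≤ 19 + a + Real.logb 2 (max 1 t) := by
      -- Both summands are at least 1, so their sum is at most twice their product, and the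
      -- logarithm splits.
      have hle : 2 ^ 18 * (a + max 1 t) ≤ 2 ^ 19 * (a * max 1 t) := by nlinarith
      refine (Real.logb_le_logb_of_le one_lt_two (by positivity) hle).trans ?_
      rw [Real.logb_mul (by positivity) (by positivity),
        Real.logb_mul (by positivity) (by positivity), Real.logb_pow,
        Real.logb_self_eq_one one_lt_two]
      have := logb_two_le_self (t := a) (by linarith)
      push_cast
      linarith
    -- Since a ≥ 1, the new stretch is at most 2¹³(21a + max 1 (log t⁺)), with t⁺ = max 1 t, and 21
    -- ≤ 2⁵ restores the constant 2¹⁸.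
    nlinarith

end CorrSampling
end

/-! ### Choice of the level and of the absolute constant. -/

theorem mainTheorem3 :
    ∃ c : ℝ, 0 < c ∧
      (∀ n : ℕ, 1 ≤ n → ∃ i : ℕ,
        |(i : ℝ) - (CorrSampling.logStar n : ℝ)|
            ≤ c * Real.logb 2 (CorrSampling.logStar n : ℝ) ∧
        (i : ℝ) ≤ c * (CorrSampling.logStar n : ℝ) ∧
        ∀ k : ℕ, 2 ≤ k →
          CorrSampling.IsCorrelatedSampling k (CorrSampling.recAlg n k i)
            (c * Real.logb 2 (k : ℝ))) ∧
      (∀ n k i : ℕ, 1 ≤ n → 2 ≤ k → i + 2 ≤ CorrSampling.logStar n →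
        CorrSampling.IsCorrelatedSampling k (CorrSampling.recAlg n k i)
          (c * ((i : ℝ) * Real.logb 2 (k : ℝ) + CorrSampling.iterLog i (n : ℝ)))) := by
  -- Level log* n has deviation 0. Its iterated logarithm is at most 0, so the maximum is 1 ≤ log k,
  -- which doubles the constant 2¹⁸.
  refine ⟨2 ^ 19, by positivity, fun n hn => ⟨CorrSampling.logStar n, ?_, ?_, fun k hk => ?_⟩,
    fun n k i hn hk hi => ?_⟩
  · rw [sub_self, abs_zero]
    refine mul_nonneg (by positivity) ?_
    rcases Nat.eq_zero_or_pos (CorrSampling.logStar n) with h | h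
    · simp [h]
    · exact Real.logb_nonneg one_lt_two (by exact_mod_cast h)
  · have : (0 : ℝ) ≤ CorrSampling.logStar n := Nat.cast_nonneg _
    linarith
  · refine (CorrSampling.isCorrelatedSampling_recAlg hn hk _).mono ?_
    have h1 := CorrSampling.one_le_logb_two hk
    rw [max_eq_left ((CorrSampling.iterLog_logStar_succ_le n).trans zero_le_one)]
    linarith
  · have hlog := CorrSampling.one_le_logb_two hk
    rcases Nat.eq_zero_or_pos i with rfl | hi0
    -- For i = 0 the bound has no log k term, so tree rounding is used directly: 1 + 6(log n + 1) ≤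
    -- 13n.
    · refine (CorrSampling.isCorrelatedSampling_treeAlg hn k).mono ?_
      have h1 := CorrSampling.clog_two_le hn
      have hn1 : (1 : ℝ) ≤ n := by exact_mod_cast hn
      have h2 := CorrSampling.logb_two_le_self (t := n) (by linarith)
      have h3 : CorrSampling.iterLog 0 (n : ℝ) = n := rfl
      rw [h3, Nat.cast_zero, zero_mul, zero_add]
      linarith
    · refine (CorrSampling.isCorrelatedSampling_recAlg hn hk i).mono ?_
      have h1 := CorrSampling.one_lt_iterLog (n := n) (i := i) (by omega)
      have h2 := CorrSampling.one_lt_iterLog (n := n) (i := i + 1) (by omega)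
      have h3 := CorrSampling.logb_two_le_self (t := CorrSampling.iterLog i n) (by linarith)
      rw [max_eq_right h2.le, CorrSampling.iterLog_succ]
      have hi1 : (1 : ℝ) ≤ i := by exact_mod_cast hi0
      nlinarith
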